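/- Let $\mathbb D$ be the open unit disc in $\mathbb C$ and $H(\mathbb D)$ the space of analytic functions on $\mathbb D$. Let $0<p,q<\infty$, and let $\phi:[0,1)\to(0,\infty)$ be normal, i.e. continuous and such that for some constants $b>a>0$ the function $\phi(r)/(1-r)^a$ is non-increasing on $[0,1)$ with limit $0$ as $r\to1^-$, and $\phi(r)/(1-r)^b$ is non-decreasing on $[0,1)$ with limit $\infty$ as $r\to1^-$. Let $H(p,q,\phi)$ be the space of all $f\in H(\mathbb D)$ with $$\|f\|_{p,q,\phi}=\Big(\int_0^1 M_q^p(f,r)\,\frac{\phi^p(r)}{1-r}\,dr\Big)^{1/p}<\infty,\qquad M_q(f,r)=\Big(\frac1{2\pi}\int_0^{2\pi}|f(re^{i\theta})|^q\,d\theta\Big)^{1/q}.$$ For a positive continuous function $\mu$ on $\mathbb D$ let $\mathcal Z_\mu$ be the space of all $f\in H(\mathbb D)$ with $\sup_{z\in\mathbb D}\mu(|z|)|f''(z)|<\infty$, with the norm $\|f\|_{\mathcal Z_\mu}=|f(0)|+|f'(0)|+\sup_{z\in\mathbb D}\mu(|z|)|f''(z)|$. For an analytic map $\varphi:\mathbb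 D\to\mathbb D$ and $g\in H(\mathbb D)$ put $$(C_\varphi^g f)(z)=\int_0^z f'(\varphi(\xi))\,g(\xi)\,d\xi ,\qquad z\in\mathbb D.$$ A linear operator $T:H(p,q,\phi)\to\mathcal Z_\mu$ is bounded if $\|Tf\|_{\mathcal Z_\mu}\le K\|f\|_{p,q,\phi}$ for some constant $K$ and all $f$; it is compact if the image of every bounded sequence has a subsequence that converges in $\mathcal Z_\mu$. Put $\|T\|=\sup_{\|f\|_{p,q,\phi}\le1}\|Tf\|_{\mathcal Z_\mu}$ and let $\|T\|_e=\inf\{\|T-S\|:\ S:H(p,q,\phi)\to\mathcal Z_\mu\text{ linear and compact}\}$ be the essential norm. Then there are constants $c,C>0$, depending only on $p$, $q$ and $\phi$, such that for all $\mu$, $\varphi$, $g$ as above for which $C_\varphi^g$ maps $H(p,q,\phi)$ into $\mathcal Z_\mu$ and is bounded, $$c\,\max\{A,B\}\le\|C_\varphi^g\|_e\le C\max\{A,B\},$$ where $$A=\limsup_{|\varphi(z)|\to1}\frac{\mu(|z|)\,|\varphi'(z)g(z)|}{\phi(|\varphi(z)|)\,(1-|\varphi(z)|^2)^{1/q+2}},\qquad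 B=\limsup_{|\varphi(z)|\to1}\frac{\mu(|z|)\,|g'(z)|}{\phi(|\varphi(z)|)\,(1-|\varphi(z)|^2)^{1/q+1}}$$ (both limsups being $0$ when $\sup_{z\in\mathbb D}|\varphi(z)|<1$). Consequently, under the same hypothesis, $C_\varphi^g:H(p,q,\phi)\to\mathcal Z_\mu$ is compact if and only if $A=0$ and $B=0$. -/

import Mathlib

open Set Filter Topology MeasureTheory Metric
open scoped ENNReal NNReal

noncomputable section

namespace MixedZygmund

/-- Analytic functions on the open unit disc. Each one is represented by its extension by zero to
`ℂ`, so that two elements are equal exactly when they agree on the disc. -/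
def discHol : Submodule ℂ (ℂ → ℂ) where
  carrier := {f | DifferentiableOn ℂ f (ball 0 1) ∧ ∀ z ∉ ball (0 : ℂ) 1, f z = 0}
  add_mem' := by
    rintro f h ⟨hf, hf0⟩ ⟨hh, hh0⟩
    exact ⟨hf.add hh, fun z hz => by simp [hf0 z hz, hh0 z hz]⟩
  zero_mem' := ⟨differentiableOn_const 0, fun _ _ => rfl⟩
  smul_mem' := by
    rintro c f ⟨hf, hf0⟩
    exact ⟨hf.const_smul c, fun z hz => by simp [hf0 z hz]⟩

/-- Normal functions on `[0,1)`. Only the values on `[0,1)` matter. -/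
structure IsNormal (phi : ℝ → ℝ) : Prop where
  pos : ∀ r ∈ Ico (0 : ℝ) 1, 0 < phi r
  continuousOn : ContinuousOn phi (Ico 0 1)
  exists_exponents : ∃ a b : ℝ, 0 < a ∧ a < b ∧
    AntitoneOn (fun r => phi r / (1 - r) ^ a) (Ico 0 1) ∧
    Tendsto (fun r => phi r / (1 - r) ^ a) (𝓝[<] 1) (𝓝 0) ∧
    MonotoneOn (fun r => phi r / (1 - r) ^ b) (Ico 0 1) ∧
    Tendsto (fun r => phi r / (1 - r) ^ b) (𝓝[<] 1) atTop

/-- Weights: positive continuous functions on the open unit disc. -/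
structure IsWeight (μ : ℂ → ℝ) : Prop where
  pos : ∀ z ∈ ball (0 : ℂ) 1, 0 < μ z
  continuousOn : ContinuousOn μ (ball 0 1)

/-- The integral mean `M_q(f, r) = ((1 / 2π) ∫₀^{2π} |f(r e^{iθ})|^q dθ)^{1/q}`. -/
def integralMean (q : ℝ) (f : ℂ → ℂ) (r : ℝ) : ℝ :=
  (Real.circleAverage (fun z => ‖f z‖ ^ q) 0 r) ^ (1 / q)

/-- The mixed (quasi-)norm `(∫₀¹ M_q(f, r)^p φ(r)^p / (1 - r) dr)^{1/p}`, with values in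
`[0, ∞]`. -/
def mixedNorm (p q : ℝ) (phi : ℝ → ℝ) (f : ℂ → ℂ) : ℝ≥0∞ :=
  (∫⁻ r in Ioo (0 : ℝ) 1,
    ENNReal.ofReal (integralMean q f r ^ p * (phi r ^ p / (1 - r)))) ^ (1 / p)

lemma add_rpow_le {x y s : ℝ} (hx : 0 ≤ x) (hy : 0 ≤ y) (hs : 0 < s) :
    (x + y) ^ s ≤ 2 ^ s * (x ^ s + y ^ s) := by
  have h1 : x + y ≤ 2 * max x y := by
    linarith [le_max_left x y, le_max_right x y]
  have h2 : (max x y) ^ s ≤ x ^ s + y ^ s := by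
    have := Real.rpow_nonneg hx s
    have := Real.rpow_nonneg hy s
    rcases max_cases x y with ⟨h, _⟩ | ⟨h, _⟩ <;> rw [h] <;> linarith
  calc (x + y) ^ s ≤ (2 * max x y) ^ s := Real.rpow_le_rpow (by positivity) h1 hs.le
    _ = 2 ^ s * (max x y) ^ s := Real.mul_rpow (by norm_num) (le_max_of_le_left hx)
    _ ≤ _ := by gcongr

lemma circleAverage_rpow_nonneg (q : ℝ) (f : ℂ → ℂ) (r : ℝ) :
    0 ≤ Real.circleAverage (fun z => ‖f z‖ ^ q) 0 r :=
  Real.circleAverage_nonneg_of_nonneg fun z _ => by positivity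

lemma circleIntegrable_rpow {q r : ℝ} (hq : 0 < q) (hr : r ∈ Ioo (0 : ℝ) 1) {f : ℂ → ℂ}
    (hf : f ∈ discHol) : CircleIntegrable (fun z => ‖f z‖ ^ q) 0 r := by
  refine ContinuousOn.circleIntegrable hr.1.le ?_
  refine ContinuousOn.rpow_const ?_ fun _ _ => Or.inr hq.le
  exact (hf.1.continuousOn.mono (sphere_subset_ball hr.2)).norm

lemma integralMean_nonneg (q : ℝ) (f : ℂ → ℂ) (r : ℝ) : 0 ≤ integralMean q f r :=
  Real.rpow_nonneg (circleAverage_rpow_nonneg q f r) _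

lemma integralMean_add_le {q r : ℝ} (hq : 0 < q) (hr : r ∈ Ioo (0 : ℝ) 1) {f h : ℂ → ℂ}
    (hf : f ∈ discHol) (hh : h ∈ discHol) :
    integralMean q (f + h) r ≤
      2 * 2 ^ (1 / q) * (integralMean q f r + integralMean q h r) := by
  have hfi := circleIntegrable_rpow hq hr hf
  have hhi := circleIntegrable_rpow hq hr hh
  have hA := circleAverage_rpow_nonneg q f r
  have hB := circleAverage_rpow_nonneg q h r
  have key : Real.circleAverage (fun z => ‖(f + h) z‖ ^ q) 0 r ≤
      2 ^ q * (Real.circleAverage (fun z => ‖f z‖ ^ q) 0 r +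
        Real.circleAverage (fun z => ‖h z‖ ^ q) 0 r) := by
    rw [← Real.circleAverage_add hfi hhi, ← smul_eq_mul, ← Real.circleAverage_smul]
    refine Real.circleAverage_mono (circleIntegrable_rpow hq hr (discHol.add_mem hf hh))
      ((hfi.add hhi).const_smul) fun z _ => ?_
    calc ‖(f + h) z‖ ^ q ≤ (‖f z‖ + ‖h z‖) ^ q :=
          Real.rpow_le_rpow (norm_nonneg _) (norm_add_le _ _) hq.le
      _ ≤ _ := add_rpow_le (norm_nonneg _) (norm_nonneg _) hq
  have hq' : 0 < 1 / q := by positivity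
  unfold integralMean
  calc _ ≤ (2 ^ q * (Real.circleAverage (fun z => ‖f z‖ ^ q) 0 r +
        Real.circleAverage (fun z => ‖h z‖ ^ q) 0 r)) ^ (1 / q) :=
        Real.rpow_le_rpow (circleAverage_rpow_nonneg _ _ _) key hq'.le
    _ = 2 * (Real.circleAverage (fun z => ‖f z‖ ^ q) 0 r +
        Real.circleAverage (fun z => ‖h z‖ ^ q) 0 r) ^ (1 / q) := by
        rw [Real.mul_rpow (by positivity) (by positivity), ← Real.rpow_mul (by norm_num),
          mul_one_div_cancel hq.ne', Real.rpow_one]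
    _ ≤ _ := by
        rw [mul_assoc]
        gcongr
        exact add_rpow_le hA hB hq'

lemma integralMean_smul {q : ℝ} (hq : 0 < q) (c : ℂ) (f : ℂ → ℂ) (r : ℝ) :
    integralMean q (c • f) r = ‖c‖ * integralMean q f r := by
  have : (fun z => ‖(c • f) z‖ ^ q) = (‖c‖ ^ q) • fun z => ‖f z‖ ^ q := by
    funext z
    simp [Real.mul_rpow (norm_nonneg _) (norm_nonneg _)]
  unfold integralMean
  rw [this, Real.circleAverage_smul, smul_eq_mul,
    Real.mul_rpow (by positivity) (circleAverage_rpow_nonneg _ _ _),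
    ← Real.rpow_mul (norm_nonneg _), mul_one_div_cancel hq.ne', Real.rpow_one]

lemma measurable_of_mem_discHol {f : ℂ → ℂ} (hf : f ∈ discHol) : Measurable f := by
  classical
  have h : f = (ball (0 : ℂ) 1).piecewise f (fun _ => 0) := by
    funext z
    by_cases hz : z ∈ ball (0 : ℂ) 1
    · rw [piecewise_eq_of_mem _ _ _ hz]
    · rw [piecewise_eq_of_notMem _ _ _ hz, hf.2 z hz]
  rw [h]
  exact hf.1.continuousOn.measurable_piecewise continuousOn_const measurableSet_ball

lemma measurable_integralMean (q : ℝ) {f : ℂ → ℂ} (hf : f ∈ discHol) :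
    Measurable (integralMean q f) := by
  have hfm := measurable_of_mem_discHol hf
  unfold integralMean
  refine Measurable.pow_const ?_ _
  change Measurable fun r : ℝ =>
    (2 * Real.pi)⁻¹ * ∫ θ in (0 : ℝ)..2 * Real.pi, ‖f (circleMap 0 r θ)‖ ^ q
  refine Measurable.const_mul ?_ _
  simp only [intervalIntegral.integral_of_le Real.two_pi_pos.le]
  refine (StronglyMeasurable.integral_prod_right (f := fun (r θ : ℝ) => ‖f (circleMap 0 r θ)‖ ^ q)
    ?_).measurable
  refine Measurable.stronglyMeasurable ?_
  refine Measurable.pow_const (hfm.comp ?_).norm _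
  refine Continuous.measurable ?_
  simp only [Function.uncurry_def, circleMap]
  fun_prop

lemma mixedNorm_lt_top_iff {p : ℝ} (hp : 0 < p) (q : ℝ) (phi : ℝ → ℝ) (f : ℂ → ℂ) :
    mixedNorm p q phi f < ∞ ↔ ∫⁻ r in Ioo (0 : ℝ) 1,
      ENNReal.ofReal (integralMean q f r ^ p * (phi r ^ p / (1 - r))) < ∞ :=
  ENNReal.rpow_lt_top_iff_of_pos (by positivity)

/-- The mixed-norm space `H(p, q, φ)`. -/
def mixedNormSpace {p q : ℝ} {phi : ℝ → ℝ} (hp : 0 < p) (hq : 0 < q) (hphi : IsNormal phi) :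
    Submodule ℂ (ℂ → ℂ) where
  carrier := {f | f ∈ discHol ∧ mixedNorm p q phi f < ∞}
  add_mem' := by
    rintro f h ⟨hf, hf'⟩ ⟨hh, hh'⟩
    refine ⟨discHol.add_mem hf hh, ?_⟩
    rw [mixedNorm_lt_top_iff hp] at hf' hh' ⊢
    set K : ℝ := (2 * 2 ^ (1 / q)) ^ p * 2 ^ p with hK
    have hK0 : 0 ≤ K := by positivity
    have hw : ∀ r ∈ Ioo (0 : ℝ) 1, 0 ≤ phi r ^ p / (1 - r) := fun r hr =>
      div_nonneg (Real.rpow_nonneg (hphi.pos r ⟨hr.1.le, hr.2⟩).le _) (by linarith [hr.2])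
    have hle : ∫⁻ r in Ioo (0 : ℝ) 1,
          ENNReal.ofReal (integralMean q (f + h) r ^ p * (phi r ^ p / (1 - r))) ≤
        ∫⁻ r in Ioo (0 : ℝ) 1, ENNReal.ofReal K *
          (ENNReal.ofReal (integralMean q f r ^ p * (phi r ^ p / (1 - r))) +
            ENNReal.ofReal (integralMean q h r ^ p * (phi r ^ p / (1 - r)))) := by
      refine setLIntegral_mono' measurableSet_Ioo fun r hr => ?_
      have h1 := integralMean_nonneg q f r
      have h2 := integralMean_nonneg q h r
      rw [← ENNReal.ofReal_add (mul_nonneg (by positivity) (hw r hr))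
        (mul_nonneg (by positivity) (hw r hr)), ← ENNReal.ofReal_mul hK0]
      refine ENNReal.ofReal_le_ofReal ?_
      rw [← add_mul, ← mul_assoc]
      refine mul_le_mul_of_nonneg_right ?_ (hw r hr)
      calc integralMean q (f + h) r ^ p
          ≤ (2 * 2 ^ (1 / q) * (integralMean q f r + integralMean q h r)) ^ p :=
            Real.rpow_le_rpow (integralMean_nonneg _ _ _) (integralMean_add_le hq hr hf hh) hp.le
        _ = (2 * 2 ^ (1 / q)) ^ p * (integralMean q f r + integralMean q h r) ^ p :=
            Real.mul_rpow (by positivity) (by positivity)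
        _ ≤ (2 * 2 ^ (1 / q)) ^ p *
            (2 ^ p * (integralMean q f r ^ p + integralMean q h r ^ p)) := by
            gcongr
            exact add_rpow_le h1 h2 hp
        _ = _ := by rw [hK]; ring
    refine hle.trans_lt ?_
    have hphim : AEMeasurable phi (volume.restrict (Ioo (0 : ℝ) 1)) :=
      (hphi.continuousOn.mono Ioo_subset_Ico_self).aemeasurable measurableSet_Ioo
    have hm : AEMeasurable (fun r => ENNReal.ofReal
        (integralMean q f r ^ p * (phi r ^ p / (1 - r)))) (volume.restrict (Ioo (0 : ℝ) 1)) := by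
      have := (measurable_integralMean q hf).aemeasurable (μ := volume.restrict (Ioo (0 : ℝ) 1))
      exact ((this.pow_const p).mul ((hphim.pow_const p).div
        (by fun_prop))).ennreal_ofReal
    rw [lintegral_const_mul' _ _ ENNReal.ofReal_ne_top, lintegral_add_left' hm]
    exact ENNReal.mul_lt_top ENNReal.ofReal_lt_top (ENNReal.add_lt_top.2 ⟨hf', hh'⟩)
  zero_mem' := by
    refine ⟨discHol.zero_mem, ?_⟩
    rw [mixedNorm_lt_top_iff hp]
    have : ∀ r, integralMean q (0 : ℂ → ℂ) r = 0 := fun r => by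
      simpa using integralMean_smul hq 0 (0 : ℂ → ℂ) r
    simp [this, Real.zero_rpow hp.ne']
  smul_mem' := by
    rintro c f ⟨hf, hf'⟩
    refine ⟨discHol.smul_mem c hf, ?_⟩
    rw [mixedNorm_lt_top_iff hp] at hf' ⊢
    have : ∀ r, ENNReal.ofReal (integralMean q (c • f) r ^ p * (phi r ^ p / (1 - r))) =
        ENNReal.ofReal (‖c‖ ^ p) *
          ENNReal.ofReal (integralMean q f r ^ p * (phi r ^ p / (1 - r))) := fun r => by
      rw [← ENNReal.ofReal_mul (by positivity), integralMean_smul hq,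
        Real.mul_rpow (norm_nonneg _) (integralMean_nonneg _ _ _), mul_assoc]
    simp only [this]
    rw [lintegral_const_mul' _ _ ENNReal.ofReal_ne_top]
    exact ENNReal.mul_lt_top ENNReal.ofReal_lt_top hf'

/-- `sup_{z ∈ 𝔻} μ(|z|) |f''(z)|`, with values in `[0, ∞]`. -/
def zygmundSup (μ : ℂ → ℝ) (f : ℂ → ℂ) : ℝ≥0∞ :=
  ⨆ z ∈ ball (0 : ℂ) 1, ENNReal.ofReal (μ (‖z‖ : ℂ)) * ‖deriv (deriv f) z‖ₑ

/-- The norm `|f(0)| + |f'(0)| + sup_{z ∈ 𝔻} μ(|z|) |f''(z)|`, with values in `[0, ∞]`. -/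
def zygmundNorm (μ : ℂ → ℝ) (f : ℂ → ℂ) : ℝ≥0∞ :=
  ‖f 0‖ₑ + ‖deriv f 0‖ₑ + zygmundSup μ f

/-- The Zygmund-type space `Z_μ`. -/
def zygmundSpace (μ : ℂ → ℝ) : Submodule ℂ (ℂ → ℂ) where
  carrier := {f | f ∈ discHol ∧ zygmundSup μ f < ∞}
  add_mem' := by
    rintro f h ⟨hf, hf'⟩ ⟨hh, hh'⟩
    refine ⟨discHol.add_mem hf hh, ?_⟩
    refine lt_of_le_of_lt ?_ (ENNReal.add_lt_top.2 ⟨hf', hh'⟩)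
    refine iSup₂_le fun z hz => ?_
    have hd : ∀ w ∈ ball (0 : ℂ) 1, deriv (f + h) w = deriv f w + deriv h w := fun w hw =>
      deriv_add (hf.1.differentiableAt (isOpen_ball.mem_nhds hw))
        (hh.1.differentiableAt (isOpen_ball.mem_nhds hw))
    have hev : deriv (f + h) =ᶠ[𝓝 z] deriv f + deriv h :=
      Filter.eventuallyEq_of_mem (isOpen_ball.mem_nhds hz) hd
    rw [hev.deriv_eq, deriv_add
      ((hf.1.deriv isOpen_ball).differentiableAt (isOpen_ball.mem_nhds hz))
      ((hh.1.deriv isOpen_ball).differentiableAt (isOpen_ball.mem_nhds hz))]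
    calc _ ≤ ENNReal.ofReal (μ (‖z‖ : ℂ)) * (‖deriv (deriv f) z‖ₑ + ‖deriv (deriv h) z‖ₑ) := by
          gcongr
          exact enorm_add_le _ _
      _ ≤ _ := by
          rw [mul_add]
          exact add_le_add
            (le_iSup₂ (f := fun z _ => ENNReal.ofReal (μ (‖z‖ : ℂ)) * ‖deriv (deriv f) z‖ₑ) z hz)
            (le_iSup₂ (f := fun z _ => ENNReal.ofReal (μ (‖z‖ : ℂ)) * ‖deriv (deriv h) z‖ₑ) z hz)
  zero_mem' := by
    refine ⟨discHol.zero_mem, ?_⟩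
    have : deriv (0 : ℂ → ℂ) = 0 := by funext z; simp [Pi.zero_def]
    simp [zygmundSup, this]
  smul_mem' := by
    rintro c f ⟨hf, hf'⟩
    refine ⟨discHol.smul_mem c hf, ?_⟩
    refine lt_of_le_of_lt ?_ (ENNReal.mul_lt_top (a := ‖c‖ₑ) enorm_lt_top hf')
    refine iSup₂_le fun z hz => ?_
    have h1 : deriv (c • f) = c • deriv f := by
      funext w
      exact deriv_const_smul_field c f
    have h2 : deriv (c • deriv f) z = c • deriv (deriv f) z := deriv_const_smul_field c _
    rw [h1, h2, enorm_smul, mul_left_comm]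
    gcongr
    exact le_iSup₂ (f := fun z _ => ENNReal.ofReal (μ (‖z‖ : ℂ)) * ‖deriv (deriv f) z‖ₑ) z hz

/-- `(C_φ^g f)(z) = ∫₀^z f'(φ(ξ)) g(ξ) dξ` for `|z| < 1`, the (path independent) integral being
taken along the segment from `0` to `z`. -/
def integralOp (vphi g f : ℂ → ℂ) (z : ℂ) : ℂ :=
  z * ∫ t in (0 : ℝ)..1, deriv f (vphi (t * z)) * g (t * z)

section Operators

variable {p q : ℝ} {phi : ℝ → ℝ} {hp : 0 < p} {hq : 0 < q} {hphi : IsNormal phi} {μ : ℂ → ℝ}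

/-- Boundedness of a linear operator `H(p, q, φ) → Z_μ`. -/
def IsBoundedOp (T : mixedNormSpace hp hq hphi →ₗ[ℂ] zygmundSpace μ) : Prop :=
  ∃ K : ℝ≥0, ∀ f, zygmundNorm μ (T f) ≤ K * mixedNorm p q phi f

/-- The operator norm `sup {‖T f‖ : ‖f‖ ≤ 1}`, with values in `[0, ∞]`. -/
def opNorm (T : mixedNormSpace hp hq hphi →ₗ[ℂ] zygmundSpace μ) : ℝ≥0∞ :=
  ⨆ (f : mixedNormSpace hp hq hphi) (_ : mixedNorm p q phi f ≤ 1), zygmundNorm μ (T f)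

/-- Compactness of a linear operator `H(p, q, φ) → Z_μ`: the image of every bounded sequence has
a subsequence which converges in `Z_μ`. -/
def IsCompactOp (T : mixedNormSpace hp hq hphi →ₗ[ℂ] zygmundSpace μ) : Prop :=
  ∀ f : ℕ → mixedNormSpace hp hq hphi,
    (∃ K : ℝ≥0, ∀ k, mixedNorm p q phi (f k) ≤ K) →
    ∃ (h : zygmundSpace μ) (s : ℕ → ℕ), StrictMono s ∧
      Tendsto (fun k => zygmundNorm μ (T (f (s k)) - h : zygmundSpace μ)) atTop (𝓝 0)

/-- The essential norm: the distance to the compact operators `H(p, q, φ) → Z_μ`. -/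
def essNorm (T : mixedNormSpace hp hq hphi →ₗ[ℂ] zygmundSpace μ) : ℝ≥0∞ :=
  ⨅ (S : mixedNormSpace hp hq hphi →ₗ[ℂ] zygmundSpace μ) (_ : IsCompactOp S), opNorm (T - S)

end Operators

/-- `limsup_{|φ(z)| → 1} F(z)`, where `z` ranges over the unit disc; it is `0` if `|φ|` stays away
from `1` on the disc. -/
def limsupToBoundary (vphi : ℂ → ℂ) (F : ℂ → ℝ) : ℝ≥0∞ :=
  limsup (fun z => ENNReal.ofReal (F z)) (comap (fun z => ‖vphi z‖) (𝓝 1) ⊓ 𝓟 (ball 0 1))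

end MixedZygmund

end

/-!
Everything rests on `(C_φ^g f)'' = f''(φ) φ' g + f'(φ) g'` together with the sharp growth estimates
`|f'(w)| ≲ ‖f‖ / (φ(|w|) (1 - |w|²)^{1/q+1})` and `|f''(w)| ≲ ‖f‖ / (φ(|w|) (1 - |w|²)^{1/q+2})` for
`f` in `H(p, q, φ)` (`exists_deriv_growth`). Here `φ(z)` is the value of the analytic self-map of the
disc at `z`, and `φ(|w|)` that of the normal function. The estimates use the subharmonicity of
`|f|^q` for all `q > 0`, which is obtained from a Blaschke product and an analytic logarithm
(`norm_rpow_le_mul_circleAverage`), and the fact that a normal function has comparable values at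
radii whose distances to `1` are comparable.

*Upper estimate.* Composing `C_φ^g` with the dilation `f ↦ f(r ·)` gives a compact operator, by
Montel's theorem. As `r → 1` the function `f - f(r ·)` is small with its derivatives on compact
discs, uniformly on the unit ball, while where `|φ(z)|` is close to `1` the growth estimates bound
`μ(|z|) |(C_φ^g (f - f(r ·)))''(z)|` by a multiple of the two quotients defining `A` and `B`
(`exists_essNorm_le`). The same splitting shows that `C_φ^g` is compact when `A = B = 0`
(`IsIntegralOp.isCompactOp_of_limsup_eq_zero`).

*Lower estimate.* Suitable combinations of two powers of `(1 - |a|²) / (1 - ā z)` form bounded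
families in `H(p, q, φ)` whose first (or second) derivative vanishes at `a` while the other one
attains the growth rate (`exists_peak_functions`). Take `a = φ(z_k)` along a sequence that realizes
the upper limit `A` (or `B`), and let `t_k` be the corresponding functions. Boundedness of `C_φ^g`,
tested on the peak functions, forces `μ |φ' g|` and `μ |g'|` to tend to zero as `|φ(z)| → 1`, so
each fixed `C_φ^g t_j` contributes nothing at `z_k` in the limit. If `S` is compact, `S t_k`
converges along a subsequence, so `(C_φ^g - S)(t_k - t_j)` has second derivative at `z_k` about as
large as that of `C_φ^g t_k` (`IsCompactOp.ofReal_le_mul_opNorm_sub`). The differences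
make it unnecessary to know the limit of `S t_k`.
-/

noncomputable section

namespace MixedZygmund

/-! ### Growth of analytic functions inside a circle -/

lemma norm_sq_blaschke_sub (R : ℝ) (u z : ℂ) :
    ‖(R : ℂ) ^ 2 - (starRingEnd ℂ) u * z‖ ^ 2 - R ^ 2 * ‖z - u‖ ^ 2 =
      (R ^ 2 - ‖z‖ ^ 2) * (R ^ 2 - ‖u‖ ^ 2) := by
  simp only [← Complex.normSq_eq_norm_sq, Complex.normSq_apply]
  simp [pow_two]
  ring

/-- If `f` has finitely many zeros in the disc of radius `R`, multiplying it by the inverse of the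
corresponding Blaschke product removes them, enlarges `|f|` inside and keeps it on the circle. -/
lemma exists_zeroFree_majorant {R : ℝ} (hR : 0 < R) (s : Finset ℂ) :
    ∀ f : ℂ → ℂ, DifferentiableOn ℂ f (ball 0 1) →
      (∃ z₀ ∈ ball (0 : ℂ) 1 ∩ ball (0 : ℂ) R, f z₀ ≠ 0) →
      (∀ z ∈ ball (0 : ℂ) 1 ∩ ball (0 : ℂ) R, f z = 0 → z ∈ s) →
      ∃ F : ℂ → ℂ, DifferentiableOn ℂ F (ball 0 1) ∧
        (∀ z ∈ ball (0 : ℂ) 1 ∩ ball (0 : ℂ) R, F z ≠ 0 ∧ ‖f z‖ ≤ ‖F z‖) ∧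
        ∀ z ∈ ball (0 : ℂ) 1 ∩ sphere (0 : ℂ) R, ‖F z‖ = ‖f z‖ := by
  classical
  induction s using Finset.induction_on with
  | empty =>
    intro f hf _ hz
    exact ⟨f, hf, fun z hz' => ⟨fun h => by simpa using hz z hz' h, le_rfl⟩, fun _ _ => rfl⟩
  | insert u s hu ih =>
    intro f hf h0 hz
    by_cases hfu : u ∈ ball (0 : ℂ) 1 ∩ ball (0 : ℂ) R ∧ f u = 0
    swap
    · refine ih f hf h0 fun z hz1 hz2 => ?_
      rcases Finset.mem_insert.1 (hz z hz1 hz2) with rfl | h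
      · exact absurd ⟨hz1, hz2⟩ hfu
      · exact h
    obtain ⟨⟨hu1, huR⟩, hfu⟩ := hfu
    have hfa : AnalyticOnNhd ℂ f (ball 0 1) := hf.analyticOnNhd isOpen_ball
    have hne : ¬ ∀ᶠ z in 𝓝 u, f z = 0 := by
      intro h
      obtain ⟨z₀, hz₀, hfz₀⟩ := h0
      exact hfz₀ (hfa.eqOn_zero_of_preconnected_of_eventuallyEq_zero
        (convex_ball _ _).isPreconnected hu1 h hz₀.1)
    obtain ⟨n, k, hk, hku, hfk⟩ :=
      (hfa u hu1).exists_eventuallyEq_pow_smul_nonzero_iff.2 hne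
    -- `h` is `f` with its zero at `u` divided out, `n` being the multiplicity of that zero.
    set h : ℂ → ℂ := Function.update (fun z => f z / (z - u) ^ n) u (k u) with hh
    have hhu : h u = k u := by simp [hh]
    have hhz : ∀ z ≠ u, h z = f z / (z - u) ^ n := fun z hz => by simp [hh, hz]
    have hfh : ∀ z, z ≠ u → f z = (z - u) ^ n * h z := fun z hzu => by
      rw [hhz z hzu, mul_div_cancel₀]
      exact pow_ne_zero _ (sub_ne_zero.2 hzu)
    have hhd : DifferentiableOn ℂ h (ball 0 1) := by
      intro z hzb
      refine DifferentiableAt.differentiableWithinAt ?_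
      by_cases hzu : z = u
      · subst hzu
        refine hk.differentiableAt.congr_of_eventuallyEq ?_
        filter_upwards [hfk] with w hw
        by_cases hwz : w = z
        · rw [hwz, hhu]
        · rw [hhz w hwz, hw, smul_eq_mul, mul_div_cancel_left₀]
          exact pow_ne_zero _ (sub_ne_zero.2 hwz)
      · have : DifferentiableAt ℂ (fun z => f z / (z - u) ^ n) z :=
          (hf.differentiableAt (isOpen_ball.mem_nhds hzb)).div (by fun_prop)
            (pow_ne_zero _ (sub_ne_zero.2 hzu))
        refine this.congr_of_eventuallyEq ?_
        filter_upwards [isOpen_ne.mem_nhds hzu] with w hw using hhz w hw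
    set b : ℂ → ℂ := fun z => ((R : ℂ) ^ 2 - (starRingEnd ℂ) u * z) / R with hb
    have hRc : ‖(R : ℂ)‖ = R := by simp [abs_of_pos hR]
    rw [mem_ball_zero_iff] at huR
    have hub : 0 < R ^ 2 - ‖u‖ ^ 2 := by nlinarith [norm_nonneg u]
    have hble : ∀ z, ‖z‖ ≤ R → ‖z - u‖ ≤ ‖b z‖ := fun z hzR => by
      have := norm_sq_blaschke_sub R u z
      have h2 : 0 ≤ R ^ 2 - ‖z‖ ^ 2 := by nlinarith [norm_nonneg z]
      rw [hb, norm_div, hRc, le_div_iff₀ hR]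
      refine le_of_sq_le_sq ?_ (norm_nonneg _)
      rw [mul_pow]
      nlinarith [mul_nonneg h2 hub.le]
    have hbeq : ∀ z, ‖z‖ = R → ‖b z‖ = ‖z - u‖ := fun z hzR => by
      have := norm_sq_blaschke_sub R u z
      rw [hb, norm_div, hRc, div_eq_iff hR.ne']
      refine (sq_eq_sq₀ (norm_nonneg _) (by positivity)).1 ?_
      rw [hzR] at this
      rw [mul_pow]
      nlinarith
    have hbne : ∀ z, ‖z‖ < R → b z ≠ 0 := fun z hzR h => by
      have := norm_sq_blaschke_sub R u z
      have h2 : 0 < R ^ 2 - ‖z‖ ^ 2 := by nlinarith [norm_nonneg z]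
      have h3 : (R : ℂ) ^ 2 - (starRingEnd ℂ) u * z = 0 := by
        have := (div_eq_zero_iff.1 h).resolve_right (by exact_mod_cast hR.ne')
        exact this
      rw [h3] at this
      simp only [norm_zero] at this
      nlinarith [mul_pos h2 hub, sq_nonneg (R * ‖z - u‖)]
    have hnorm : ∀ z, ‖z‖ ≤ R → ‖f z‖ ≤ ‖h z * b z ^ n‖ := fun z hzR => by
      by_cases hzu : z = u
      · rw [hzu, hfu, norm_zero]; positivity
      · rw [hfh z hzu, norm_mul, norm_mul, norm_pow, norm_pow, mul_comm]
        have := hble z hzR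
        gcongr
    have hne' : ∃ z₀ ∈ ball (0 : ℂ) 1 ∩ ball (0 : ℂ) R, h z₀ * b z₀ ^ n ≠ 0 := by
      obtain ⟨z₀, hz₀, hfz₀⟩ := h0
      refine ⟨z₀, hz₀, fun h => hfz₀ ?_⟩
      have := hnorm z₀ (mem_ball_zero_iff.1 hz₀.2).le
      rw [h, norm_zero] at this
      exact norm_le_zero_iff.1 this
    have hzero : ∀ z ∈ ball (0 : ℂ) 1 ∩ ball (0 : ℂ) R, h z * b z ^ n = 0 → z ∈ s := by
      intro z hz1 hz2
      have hzR := mem_ball_zero_iff.1 hz1.2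
      have h1 : h z = 0 := (mul_eq_zero.1 hz2).resolve_right (pow_ne_zero _ (hbne z hzR))
      have hzu : z ≠ u := by rintro rfl; exact hku (by rw [← hhu, h1])
      have := hz z hz1 (by rw [hfh z hzu, h1, mul_zero])
      exact (Finset.mem_insert.1 this).resolve_left hzu
    have hbd : DifferentiableOn ℂ (fun z => b z ^ n) (ball 0 1) := by
      simp only [hb]
      fun_prop
    obtain ⟨F, hF1, hF2, hF3⟩ := ih (fun z => h z * b z ^ n) (hhd.mul hbd) hne' hzero
    refine ⟨F, hF1, fun z hz => ⟨(hF2 z hz).1,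
      (hnorm z (mem_ball_zero_iff.1 hz.2).le).trans (hF2 z hz).2⟩, fun z hz => ?_⟩
    rw [hF3 z hz]
    have hzR : ‖z‖ = R := mem_sphere_zero_iff_norm.1 hz.2
    have hzu : z ≠ u := by rintro rfl; linarith
    rw [hfh z hzu, norm_mul, norm_mul, norm_pow, norm_pow, hbeq z hzR, mul_comm]

/-- A zero-free analytic function on a disc has an analytic logarithm there. -/
lemma exists_log_of_ne_zero {R : ℝ} (hR : 0 < R) {F : ℂ → ℂ}
    (hF : DifferentiableOn ℂ F (ball 0 R)) (hF0 : ∀ z ∈ ball (0 : ℂ) R, F z ≠ 0) :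
    ∃ L : ℂ → ℂ, DifferentiableOn ℂ L (ball 0 R) ∧
      ∀ z ∈ ball (0 : ℂ) R, F z = Complex.exp (L z) := by
  obtain ⟨L, hL0, hL⟩ := ((hF.deriv isOpen_ball).div hF hF0).isExactOn_ball.with_val_at 0
    (Complex.log (F 0))
  have hLd : DifferentiableOn ℂ L (ball 0 R) := fun z hz =>
    (hL z hz).differentiableAt.differentiableWithinAt
  refine ⟨L, hLd, fun z hz => ?_⟩
  have hconst : ∀ z ∈ ball (0 : ℂ) R, HasDerivAt (fun z => F z * Complex.exp (-L z)) 0 z := by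
    intro z hz
    have h1 := (hF.differentiableAt (isOpen_ball.mem_nhds hz)).hasDerivAt
    have h2 := h1.mul (hL z hz).neg.cexp
    convert! h2 using 1
    simp only [Pi.div_apply]
    field_simp [hF0 z hz]
    ring
  have h0 : (0 : ℂ) ∈ ball (0 : ℂ) R := mem_ball_self hR
  have key := (convex_ball (0 : ℂ) R).is_const_of_fderivWithin_eq_zero (𝕜 := ℂ)
    (f := fun z => F z * Complex.exp (-L z))
    (fun z hz => (hconst z hz).differentiableAt.differentiableWithinAt)
    (fun z hz => by
      rw [fderivWithin_of_isOpen isOpen_ball hz]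
      have := (hconst z hz).hasFDerivAt.fderiv
      rw [this]; ext; simp) hz h0
  simp only [hL0] at key
  rw [Complex.exp_neg (Complex.log _), Complex.exp_log (hF0 0 h0), mul_inv_cancel₀ (hF0 0 h0),
    Complex.exp_neg, mul_inv_eq_one₀ (Complex.exp_ne_zero _)] at key
  exact key

/-- Harnack's bound for the Poisson kernel, applied to the Poisson integral of `G`. -/
lemma norm_le_mul_circleAverage {r : ℝ} {G : ℂ → ℂ} (hG : DiffContOnCl ℂ G (ball 0 r))
    {w : ℂ} (hw : w ∈ ball (0 : ℂ) r) :
    ‖G w‖ ≤ (r + ‖w‖) / (r - ‖w‖) * Real.circleAverage (fun z => ‖G z‖) 0 r := by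
  have hr : 0 < r := pos_of_mem_ball hw
  have h := hG.circleAverage_re_herglotzRieszKernel_smul' hw
  simp only [sub_zero] at h
  have hGc : ContinuousOn G (sphere 0 r) := by
    have := hG.continuousOn
    rw [closure_ball _ hr.ne'] at this
    exact this.mono sphere_subset_closedBall
  have hwr := mem_ball_zero_iff.1 hw
  have hpt : ∀ z ∈ sphere (0 : ℂ) r, ‖((z + w) / (z - w)).re • G z‖ ≤
      (r + ‖w‖) / (r - ‖w‖) * ‖G z‖ := fun z hz => by
    have h1 := re_herglotzRieszKernel_le hz hw
    have h2 := le_re_herglotzRieszKernel hz hw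
    simp only [sub_zero] at h1 h2
    rw [norm_smul, Real.norm_eq_abs, abs_of_nonneg]
    · gcongr
    · exact le_trans (div_nonneg (by linarith) (by positivity)) h2
  rw [← smul_eq_mul, ← Real.circleAverage_fun_smul]
  rw [← h]
  have hint : CircleIntegrable (fun z => ((r + ‖w‖) / (r - ‖w‖)) • ‖G z‖) 0 r :=
    (continuousOn_const.fun_smul hGc.norm).circleIntegrable hr.le
  simp only [Real.circleAverage]
  rw [norm_smul, Real.norm_of_nonneg (by positivity), smul_eq_mul]
  refine mul_le_mul_of_nonneg_left ?_ (by positivity)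
  refine intervalIntegral.norm_integral_le_of_norm_le Real.two_pi_pos.le ?_ hint
  refine Eventually.of_forall fun θ _ => ?_
  exact hpt _ (circleMap_mem_sphere _ hr.le _)

/-- The Poisson majorant of the subharmonic function `|f|^q`, for every `q > 0`: once the zeros of
`f` are divided out, `f^q` is itself analytic. -/
lemma norm_rpow_le_mul_circleAverage {q : ℝ} (hq : 0 < q) {f : ℂ → ℂ}
    (hf : DifferentiableOn ℂ f (ball 0 1)) {R : ℝ} (hR1 : R < 1) {w : ℂ} (hw : ‖w‖ < R) :
    ‖f w‖ ^ q ≤ (R + ‖w‖) / (R - ‖w‖) * Real.circleAverage (fun z => ‖f z‖ ^ q) 0 R := by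
  have hR : 0 < R := (norm_nonneg w).trans_lt hw
  have hsub : ball (0 : ℂ) 1 ∩ ball 0 R = ball 0 R :=
    inter_eq_right.2 (ball_subset_ball hR1.le)
  have hsub' : ball (0 : ℂ) 1 ∩ sphere 0 R = sphere 0 R :=
    inter_eq_right.2 (sphere_subset_ball hR1)
  have hnn : 0 ≤ Real.circleAverage (fun z => ‖f z‖ ^ q) 0 R :=
    Real.circleAverage_nonneg_of_nonneg fun z _ => by positivity
  by_cases h0 : ∃ z₀ ∈ ball (0 : ℂ) R, f z₀ ≠ 0
  swap
  · push Not at h0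
    rw [h0 w (mem_ball_zero_iff.2 hw), norm_zero, Real.zero_rpow hq.ne']
    exact mul_nonneg (div_nonneg (by positivity) (by linarith)) hnn
  have hfin : {z | z ∈ ball (0 : ℂ) R ∧ f z = 0}.Finite := by
    by_contra hinf
    obtain ⟨x, hx, hacc⟩ := Set.Infinite.exists_accPt_of_subset_isCompact hinf
      (isCompact_closedBall (0 : ℂ) R) (fun z hz => ball_subset_closedBall hz.1)
    have hx1 : x ∈ ball (0 : ℂ) 1 := closedBall_subset_ball hR1 hx
    obtain ⟨z₀, hz₀, hfz₀⟩ := h0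
    refine hfz₀ ((hf.analyticOnNhd isOpen_ball).eqOn_zero_of_preconnected_of_frequently_eq_zero
      (convex_ball _ _).isPreconnected hx1 ?_ (ball_subset_ball hR1.le hz₀))
    exact (accPt_iff_frequently_nhdsNE.1 hacc).mono fun z hz => hz.2
  obtain ⟨F, hF, hF1, hF2⟩ := exists_zeroFree_majorant hR hfin.toFinset f hf
    (by rwa [hsub]) (by
      rw [hsub]
      intro z hz1 hz2
      exact hfin.mem_toFinset.2 ⟨hz1, hz2⟩)
  rw [hsub] at hF1
  rw [hsub'] at hF2
  obtain ⟨L, hL, hFL⟩ := exists_log_of_ne_zero hR (hF.mono (ball_subset_ball hR1.le))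
    fun z hz => (hF1 z hz).1
  have hG : ∀ z ∈ ball (0 : ℂ) R, ‖Complex.exp (q * L z)‖ = ‖F z‖ ^ q := fun z hz => by
    rw [hFL z hz, Complex.norm_exp, Complex.norm_exp, ← Real.exp_mul]
    congr 1
    simp [mul_comm]
  have hFq : ContinuousOn (fun z => ‖F z‖ ^ q) (ball 0 1) :=
    ContinuousOn.rpow_const hF.continuousOn.norm fun _ _ => Or.inr hq.le
  -- The bound on the circles of radius `r < R`, where the logarithm of `F` is available.
  have hr : ∀ r ∈ Ioo ‖w‖ R, ‖f w‖ ^ q ≤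
      (r + ‖w‖) / (r - ‖w‖) * Real.circleAverage (fun z => ‖F z‖ ^ q) 0 r := by
    rintro r ⟨hr1, hr2⟩
    have hr0 : 0 < r := (norm_nonneg w).trans_lt hr1
    have hd : DiffContOnCl ℂ (fun z => Complex.exp (q * L z)) (ball 0 r) := by
      refine DifferentiableOn.diffContOnCl_ball (U := ball 0 R) ?_ (closedBall_subset_ball hr2)
      exact (hL.const_mul _).cexp
    have h1 := norm_le_mul_circleAverage hd (mem_ball_zero_iff.2 hr1)
    rw [hG w (mem_ball_zero_iff.2 hw)] at h1
    have h2 : Real.circleAverage (fun z => ‖Complex.exp (q * L z)‖) 0 r =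
        Real.circleAverage (fun z => ‖F z‖ ^ q) 0 r := by
      refine Real.circleAverage_congr_sphere fun z hz => hG z ?_
      rw [abs_of_pos hr0] at hz
      exact sphere_subset_ball hr2 hz
    rw [h2] at h1
    exact (Real.rpow_le_rpow (norm_nonneg _) (hF1 w (mem_ball_zero_iff.2 hw)).2 hq.le).trans h1
  have hlim : Tendsto (fun r : ℝ => (r + ‖w‖) / (r - ‖w‖) *
      Real.circleAverage (fun z => ‖F z‖ ^ q) 0 r) (𝓝[<] R)
      (𝓝 ((R + ‖w‖) / (R - ‖w‖) * Real.circleAverage (fun z => ‖F z‖ ^ q) 0 R)) := by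
    refine Tendsto.mono_left ?_ nhdsWithin_le_nhds
    have hc : ContinuousOn (fun r : ℝ => Real.circleAverage (fun z => ‖F z‖ ^ q) 0 r)
        (Ioo 0 1) :=
      Real.ContinuousOn.circleAverage (hFq.mono fun z hz => by simpa using hz.2) fun r hr => hr.1.le
    refine Tendsto.mul ?_ (hc.continuousAt (Ioo_mem_nhds hR hR1))
    exact Tendsto.div (tendsto_id.add_const _) (tendsto_id.sub_const _) (by linarith)
  have hfin2 := ge_of_tendsto hlim (by
    filter_upwards [Ioo_mem_nhdsLT hw] with r hr' using hr r hr')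
  have h3 : Real.circleAverage (fun z => ‖F z‖ ^ q) 0 R =
      Real.circleAverage (fun z => ‖f z‖ ^ q) 0 R := by
    refine Real.circleAverage_congr_sphere fun z hz => ?_
    rw [abs_of_pos hR] at hz
    simp only [hF2 z hz]
  rwa [h3] at hfin2

/-! ### Normal functions and the growth of functions in `H(p, q, φ)` -/

lemma IsNormal.exists_antitone_monotone {phi : ℝ → ℝ} (h : IsNormal phi) :
    ∃ a b : ℝ, 0 < a ∧ 0 < b ∧
      AntitoneOn (fun r => phi r / (1 - r) ^ a) (Ico 0 1) ∧
      MonotoneOn (fun r => phi r / (1 - r) ^ b) (Ico 0 1) := by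
  obtain ⟨a, b, ha, hab, h1, -, h2, -⟩ := h.exists_exponents
  exact ⟨a, b, ha, ha.trans hab, h1, h2⟩

lemma le_mul_div_rpow_of_antitoneOn {phi : ℝ → ℝ} {a : ℝ}
    (h : AntitoneOn (fun r => phi r / (1 - r) ^ a) (Ico 0 1)) {r s : ℝ} (hr : 0 ≤ r) (hrs : r ≤ s)
    (hs : s < 1) : phi s ≤ phi r * ((1 - s) / (1 - r)) ^ a := by
  have h1 := h ⟨hr, hrs.trans_lt hs⟩ ⟨hr.trans hrs, hs⟩ hrs
  have hs0 : 0 < 1 - s := by linarith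
  have hr0 : 0 < 1 - r := by linarith
  simp only at h1
  rw [Real.div_rpow hs0.le hr0.le]
  rw [div_le_iff₀ (Real.rpow_pos_of_pos hs0 _)] at h1
  calc _ ≤ _ := h1
    _ = _ := by ring

lemma le_mul_div_rpow_of_monotoneOn {phi : ℝ → ℝ} {b : ℝ}
    (h : MonotoneOn (fun r => phi r / (1 - r) ^ b) (Ico 0 1)) {r s : ℝ} (hr : 0 ≤ r) (hrs : r ≤ s)
    (hs : s < 1) : phi r ≤ phi s * ((1 - r) / (1 - s)) ^ b := by
  have h1 := h ⟨hr, hrs.trans_lt hs⟩ ⟨hr.trans hrs, hs⟩ hrs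
  have hs0 : 0 < 1 - s := by linarith
  have hr0 : 0 < 1 - r := by linarith
  simp only at h1
  rw [Real.div_rpow hr0.le hs0.le]
  rw [div_le_iff₀ (Real.rpow_pos_of_pos hr0 _)] at h1
  calc _ ≤ _ := h1
    _ = _ := by ring

lemma IsNormal.antitoneOn {phi : ℝ → ℝ} (h : IsNormal phi) : AntitoneOn phi (Ico 0 1) := by
  obtain ⟨a, b, ha, -, h1, -⟩ := h.exists_antitone_monotone
  intro r hr s hs hrs
  refine (le_mul_div_rpow_of_antitoneOn h1 hr.1 hrs hs.2).trans ?_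
  refine mul_le_of_le_one_right (h.pos r hr).le (Real.rpow_le_one ?_ ?_ ha.le)
  · exact div_nonneg (by linarith [hs.2]) (by linarith [hr.2])
  · rw [div_le_one (by linarith [hr.2])]
    linarith

/-- `φ(t) (1 - t²)^s` does not increase in `t`. -/
lemma IsNormal.mul_rpow_le {phi : ℝ → ℝ} (h : IsNormal phi) {s r t : ℝ} (hs : 0 ≤ s) (hr : 0 ≤ r)
    (hrt : r ≤ t) (ht : t < 1) :
    phi t * (1 - t ^ 2) ^ s ≤ phi r * (1 - r ^ 2) ^ s := by
  have h1 := h.antitoneOn ⟨hr, hrt.trans_lt ht⟩ ⟨hr.trans hrt, ht⟩ hrt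
  have h2 : 0 ≤ 1 - t ^ 2 := by nlinarith
  have h3 : 1 - t ^ 2 ≤ 1 - r ^ 2 := by nlinarith
  have := (h.pos r ⟨hr, hrt.trans_lt ht⟩).le
  gcongr

lemma lintegral_one_sub_rpow {s x : ℝ} (hs : 0 < s) (hx1 : x < 1) :
    ∫⁻ r in Ioo x 1, ENNReal.ofReal ((1 - r) ^ (s - 1)) = ENNReal.ofReal ((1 - x) ^ s / s) := by
  have hint : IntervalIntegrable (fun r : ℝ => (1 - r) ^ (s - 1)) volume x 1 := by
    have := (intervalIntegral.intervalIntegrable_rpow' (r := s - 1) (by linarith)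
      (a := 1 - x) (b := 0)).comp_sub_left 1
    simpa using this
  have hint' := (intervalIntegrable_iff_integrableOn_Ioo_of_le hx1.le).1 hint
  rw [← ofReal_integral_eq_lintegral_ofReal hint']
  · congr 1
    rw [← integral_Ioc_eq_integral_Ioo, ← intervalIntegral.integral_of_le hx1.le]
    rw [intervalIntegral.integral_comp_sub_left (fun r => r ^ (s - 1)) 1]
    rw [integral_rpow (Or.inl (by linarith))]
    simp [hs.ne']
  · refine (ae_restrict_iff' measurableSet_Ioo).2 (Eventually.of_forall fun r hr => ?_)
    exact Real.rpow_nonneg (by linarith [hr.2]) _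

lemma lintegral_one_sub_rpow_neg_le {s x : ℝ} (hs : 0 < s) (hx0 : 0 ≤ x) (hx1 : x < 1) :
    ∫⁻ r in Ioc 0 x, ENNReal.ofReal ((1 - r) ^ (-s - 1)) ≤
      ENNReal.ofReal ((1 - x) ^ (-s) / s) := by
  have h0 : (0 : ℝ) ∉ uIcc 1 (1 - x) := by
    rw [uIcc_of_ge (by linarith)]
    intro h
    linarith [h.1]
  have hint : IntervalIntegrable (fun r : ℝ => (1 - r) ^ (-s - 1)) volume 0 x := by
    have := (intervalIntegral.intervalIntegrable_rpow (r := -s - 1) (Or.inr h0)).comp_sub_left 1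
    simpa using this
  have hint' := (intervalIntegrable_iff_integrableOn_Ioc_of_le hx0).1 hint
  rw [← ofReal_integral_eq_lintegral_ofReal hint']
  · refine ENNReal.ofReal_le_ofReal ?_
    rw [← intervalIntegral.integral_of_le hx0]
    rw [intervalIntegral.integral_comp_sub_left (fun r => r ^ (-s - 1)) 1]
    rw [uIcc_comm] at h0
    rw [integral_rpow (Or.inr ⟨by linarith, by simpa using h0⟩)]
    simp only [sub_add_cancel, sub_zero, Real.one_rpow]
    rw [div_neg, ← neg_div]
    gcongr
    linarith
  · refine (ae_restrict_iff' measurableSet_Ioc).2 (Eventually.of_forall fun r hr => ?_)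
    exact Real.rpow_nonneg (by linarith [hr.2]) _

lemma integralMean_le {q r M : ℝ} (hq : 0 < q) (hr : r ∈ Ioo (0 : ℝ) 1) {f : ℂ → ℂ}
    (hf : f ∈ discHol) (hM : ∀ z, ‖z‖ = r → ‖f z‖ ≤ M) : integralMean q f r ≤ M := by
  have hM0 : 0 ≤ M := (norm_nonneg _).trans (hM r (by simp [abs_of_pos hr.1]))
  have h : Real.circleAverage (fun z => ‖f z‖ ^ q) 0 r ≤ M ^ q := by
    refine Real.circleAverage_mono_on_of_le_circle (circleIntegrable_rpow hq hr hf) fun z hz => ?_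
    rw [abs_of_pos hr.1, mem_sphere_zero_iff_norm] at hz
    exact Real.rpow_le_rpow (norm_nonneg _) (hM z hz) hq.le
  calc integralMean q f r ≤ (M ^ q) ^ (1 / q) :=
        Real.rpow_le_rpow (circleAverage_rpow_nonneg q f r) h (by positivity)
    _ = M := by rw [← Real.rpow_mul hM0, mul_one_div_cancel hq.ne', Real.rpow_one]

/-- Bounded analytic functions belong to `H(p, q, φ)`. -/
lemma mem_mixedNormSpace_of_bounded {p q : ℝ} {phi : ℝ → ℝ} (hp : 0 < p) (hq : 0 < q)
    (hphi : IsNormal phi) {f : ℂ → ℂ} (hf : f ∈ discHol) {M : ℝ}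
    (hM : ∀ z ∈ ball (0 : ℂ) 1, ‖f z‖ ≤ M) : f ∈ mixedNormSpace hp hq hphi := by
  refine ⟨hf, ?_⟩
  rw [mixedNorm_lt_top_iff hp]
  obtain ⟨a, b, ha, -, h1, -⟩ := hphi.exists_antitone_monotone
  have hM0 : 0 ≤ M := (norm_nonneg _).trans (hM 0 (by simp))
  have hphi0 := hphi.pos 0 (by simp)
  have hle : ∀ r ∈ Ioo (0 : ℝ) 1,
      ENNReal.ofReal (integralMean q f r ^ p * (phi r ^ p / (1 - r))) ≤
        ENNReal.ofReal (M ^ p * phi 0 ^ p) * ENNReal.ofReal ((1 - r) ^ (a * p - 1)) := by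
    intro r hr
    rw [← ENNReal.ofReal_mul (by positivity)]
    refine ENNReal.ofReal_le_ofReal ?_
    have hr1 : 0 < 1 - r := by linarith [hr.2]
    have h2 := le_mul_div_rpow_of_antitoneOn h1 le_rfl hr.1.le hr.2
    have h3 : integralMean q f r ≤ M := integralMean_le hq hr hf fun z hz =>
      hM z (by rw [mem_ball_zero_iff, hz]; exact hr.2)
    have h4 := integralMean_nonneg q f r
    have h5 := hphi.pos r ⟨hr.1.le, hr.2⟩
    simp only [sub_zero, div_one] at h2
    rw [mul_assoc, Real.rpow_sub_one hr1.ne', Real.rpow_mul hr1.le]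
    calc _ ≤ M ^ p * ((phi 0 * (1 - r) ^ a) ^ p / (1 - r)) := by gcongr
      _ = _ := by rw [Real.mul_rpow hphi0.le (by positivity)]; ring
  refine (setLIntegral_mono' measurableSet_Ioo hle).trans_lt ?_
  rw [lintegral_const_mul' _ _ ENNReal.ofReal_ne_top, lintegral_one_sub_rpow (by positivity)
    one_pos.gt]
  exact ENNReal.mul_lt_top ENNReal.ofReal_lt_top ENNReal.ofReal_lt_top

lemma lintegral_le_of_mixedNorm_le {p q N : ℝ} {phi : ℝ → ℝ} (hp : 0 < p) {f : ℂ → ℂ}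
    (hN : 0 ≤ N) (h : mixedNorm p q phi f ≤ ENNReal.ofReal N) :
    ∫⁻ r in Ioo (0 : ℝ) 1, ENNReal.ofReal (integralMean q f r ^ p * (phi r ^ p / (1 - r))) ≤
      ENNReal.ofReal (N ^ p) := by
  have h1 := ENNReal.rpow_le_rpow h hp.le
  rwa [mixedNorm, ← ENNReal.rpow_mul, one_div_mul_cancel hp.ne', ENNReal.rpow_one,
    ENNReal.ofReal_rpow_of_nonneg hN hp.le] at h1

lemma mixedNorm_le_of_lintegral_le {p q N : ℝ} {phi : ℝ → ℝ} (hp : 0 < p) {f : ℂ → ℂ}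
    (hN : 0 ≤ N) (h : ∫⁻ r in Ioo (0 : ℝ) 1,
      ENNReal.ofReal (integralMean q f r ^ p * (phi r ^ p / (1 - r))) ≤ ENNReal.ofReal N) :
    mixedNorm p q phi f ≤ ENNReal.ofReal (N ^ (1 / p)) := by
  rw [mixedNorm, ← ENNReal.ofReal_rpow_of_nonneg hN (by positivity)]
  exact ENNReal.rpow_le_rpow h (by positivity)

/-- A function at `z` is controlled by its mean over any circle whose radius lies between the
midpoint `(1 + |z|) / 2` and `1`. -/
lemma mul_rpow_le_integralMean {q : ℝ} (hq : 0 < q) {f : ℂ → ℂ}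
    (hf : f ∈ discHol) {z : ℂ} {R : ℝ} (hzR : (1 + ‖z‖) / 2 < R) (hR : R < 1) :
    ‖f z‖ * ((1 - ‖z‖) / 4) ^ (1 / q) ≤ integralMean q f R := by
  have hz1 : ‖z‖ < 1 := by linarith
  have hd : 0 < 1 - ‖z‖ := by linarith
  have h1 := norm_rpow_le_mul_circleAverage hq hf.1 hR (w := z) (by linarith)
  have hA := circleAverage_rpow_nonneg q f R
  have h2 : (R + ‖z‖) / (R - ‖z‖) ≤ 4 / (1 - ‖z‖) := by
    rw [div_le_div_iff₀ (by linarith) hd]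
    nlinarith [norm_nonneg z]
  have h3 : ‖f z‖ ^ q * ((1 - ‖z‖) / 4) ≤ Real.circleAverage (fun z => ‖f z‖ ^ q) 0 R := by
    have := h1.trans (mul_le_mul_of_nonneg_right h2 hA)
    rw [div_mul_eq_mul_div, le_div_iff₀ hd] at this
    linarith
  calc ‖f z‖ * ((1 - ‖z‖) / 4) ^ (1 / q) = (‖f z‖ ^ q * ((1 - ‖z‖) / 4)) ^ (1 / q) := by
        rw [Real.mul_rpow (by positivity) (by positivity), ← Real.rpow_mul (norm_nonneg _),
          mul_one_div_cancel hq.ne', Real.rpow_one]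
    _ ≤ _ := Real.rpow_le_rpow (by positivity) h3 (by positivity)

/-- Point evaluations on `H(p, q, φ)` grow at most like `1 / (φ(|z|) (1 - |z|)^{1/q})`. -/
lemma exists_growth {p q : ℝ} {phi : ℝ → ℝ} (hp : 0 < p) (hq : 0 < q) (hphi : IsNormal phi) :
    ∃ C : ℝ, 0 < C ∧ ∀ f ∈ discHol, ∀ N : ℝ, 0 ≤ N → mixedNorm p q phi f ≤ ENNReal.ofReal N →
      ∀ z ∈ ball (0 : ℂ) 1, ‖f z‖ * (phi ‖z‖ * (1 - ‖z‖) ^ (1 / q)) ≤ C * N := by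
  obtain ⟨a, b, -, hb, -, hmono⟩ := hphi.exists_antitone_monotone
  refine ⟨4 ^ b * 4 ^ (1 / q) * 2 ^ (1 / p), by positivity, fun f hf N hN h z hz => ?_⟩
  have h0 := lintegral_le_of_mixedNorm_le hp hN h
  have hz1 : ‖z‖ < 1 := mem_ball_zero_iff.1 hz
  set d := 1 - ‖z‖ with hd
  have hd0 : 0 < d := by linarith
  have hd1 : d ≤ 1 := by linarith [norm_nonneg z]
  have hphiz := hphi.pos ‖z‖ ⟨norm_nonneg _, hz1⟩
  set X := ‖f z‖ * (d / 4) ^ (1 / q) with hX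
  have hX0 : 0 ≤ X := by positivity
  set c := X ^ p * ((phi ‖z‖ / 4 ^ b) ^ p / (d / 2)) with hc
  have hc0 : 0 ≤ c := by positivity
  -- For these radii `1 - R` is comparable to `1 - |z|`, hence `φ(R)` to `φ(|z|)`.
  have hlow : ∀ R ∈ Ioo (1 - d / 2) (1 - d / 4),
      ENNReal.ofReal c ≤ ENNReal.ofReal (integralMean q f R ^ p * (phi R ^ p / (1 - R))) := by
    rintro R ⟨hR1, hR2⟩
    refine ENNReal.ofReal_le_ofReal ?_
    have h1 : X ≤ integralMean q f R :=
      mul_rpow_le_integralMean hq hf (by linarith) (by linarith)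
    have h2 : phi ‖z‖ / 4 ^ b ≤ phi R := by
      have h3 := le_mul_div_rpow_of_monotoneOn hmono (norm_nonneg z) (s := R) (by linarith)
        (by linarith)
      have h4 : (1 - ‖z‖) / (1 - R) ≤ 4 := by
        rw [div_le_iff₀ (by linarith)]
        linarith
      have h5 := hphi.pos R ⟨by linarith, by linarith⟩
      rw [div_le_iff₀ (by positivity)]
      refine h3.trans ?_
      gcongr
      exact div_nonneg (by linarith) (by linarith)
    have h6 : 0 < 1 - R := by linarith
    have h7 : 1 - R ≤ d / 2 := by linarith
    have h8 := integralMean_nonneg q f R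
    have h9 := (hphi.pos R ⟨by linarith, by linarith⟩).le
    rw [hc]
    gcongr
  have hsub : Ioo (1 - d / 2) (1 - d / 4) ⊆ Ioo (0 : ℝ) 1 := Ioo_subset_Ioo (by linarith)
    (by linarith)
  have h1 : ENNReal.ofReal (c * (d / 4)) ≤ ENNReal.ofReal (N ^ p) := by
    calc ENNReal.ofReal (c * (d / 4)) = ∫⁻ R in Ioo (1 - d / 2) (1 - d / 4), ENNReal.ofReal c := by
          rw [setLIntegral_const, Real.volume_Ioo, ENNReal.ofReal_mul hc0]
          congr 2
          ring
      _ ≤ ∫⁻ R in Ioo (1 - d / 2) (1 - d / 4),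
          ENNReal.ofReal (integralMean q f R ^ p * (phi R ^ p / (1 - R))) :=
          setLIntegral_mono' measurableSet_Ioo hlow
      _ ≤ _ := lintegral_mono_set hsub
      _ ≤ _ := h0
  rw [ENNReal.ofReal_le_ofReal_iff (by positivity)] at h1
  have h2 : (X * (phi ‖z‖ / 4 ^ b)) ^ p ≤ 2 * N ^ p := by
    rw [Real.mul_rpow hX0 (by positivity)]
    have : c * (d / 4) = X ^ p * (phi ‖z‖ / 4 ^ b) ^ p / 2 := by
      rw [hc]
      field_simp
      ring
    linarith
  have h3 := Real.rpow_le_rpow (by positivity) h2 (z := 1 / p) (by positivity)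
  rw [← Real.rpow_mul (by positivity), mul_one_div_cancel hp.ne', Real.rpow_one,
    Real.mul_rpow (by positivity) (by positivity), ← Real.rpow_mul hN, mul_one_div_cancel hp.ne',
    Real.rpow_one, hX, Real.div_rpow hd0.le (by norm_num)] at h3
  have h4 : ‖f z‖ * (phi ‖z‖ * d ^ (1 / q)) =
      4 ^ b * 4 ^ (1 / q) * (‖f z‖ * (d ^ (1 / q) / 4 ^ (1 / q)) * (phi ‖z‖ / 4 ^ b)) := by
    field_simp
  rw [h4]
  calc _ ≤ 4 ^ b * 4 ^ (1 / q) * (2 ^ (1 / p) * N) := by gcongr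
    _ = _ := by ring

/-- Cauchy's estimates for the first two derivatives at the centre of a disc. -/
lemma norm_deriv_le_of_sphere {f : ℂ → ℂ} (hf : DifferentiableOn ℂ f (ball 0 1)) {z : ℂ} {R M : ℝ}
    (hR : 0 < R) (hsub : closedBall z R ⊆ ball 0 1) (hM : ∀ w ∈ sphere z R, ‖f w‖ ≤ M) :
    ‖deriv f z‖ ≤ M / R ∧ ‖deriv (deriv f) z‖ ≤ 2 * M / R ^ 2 := by
  have hd : DiffContOnCl ℂ f (ball z R) := hf.diffContOnCl_ball hsub
  refine ⟨Complex.norm_deriv_le_of_forall_mem_sphere_norm_le hR hd hM, ?_⟩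
  have := Complex.norm_iteratedDeriv_le_of_forall_mem_sphere_norm_le 2 hR hd hM
  rw [iteratedDeriv_succ, iteratedDeriv_one] at this
  simpa using this

/-- Growth of the first two derivatives of functions in `H(p, q, φ)`. -/
lemma exists_deriv_growth {p q : ℝ} {phi : ℝ → ℝ} (hp : 0 < p) (hq : 0 < q)
    (hphi : IsNormal phi) :
    ∃ C : ℝ, 0 < C ∧ ∀ f ∈ discHol, ∀ N : ℝ, 0 ≤ N → mixedNorm p q phi f ≤ ENNReal.ofReal N →
      ∀ z ∈ ball (0 : ℂ) 1,
        ‖deriv f z‖ * (phi ‖z‖ * (1 - ‖z‖ ^ 2) ^ (1 / q + 1)) ≤ C * N ∧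
        ‖deriv (deriv f) z‖ * (phi ‖z‖ * (1 - ‖z‖ ^ 2) ^ (1 / q + 2)) ≤ C * N := by
  obtain ⟨C, hC, hgrow⟩ := exists_growth hp hq hphi
  obtain ⟨a, b, -, hb, -, hmono⟩ := hphi.exists_antitone_monotone
  set K : ℝ := C * 2 ^ b * 2 ^ (1 / q) with hK
  have hK0 : 0 < K := by positivity
  refine ⟨8 * K * 2 ^ (1 / q + 2), by positivity, fun f hf N hN h z hz => ?_⟩
  have hz1 : ‖z‖ < 1 := mem_ball_zero_iff.1 hz
  set d := 1 - ‖z‖ with hd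
  have hd0 : 0 < d := by linarith
  have hphiz := hphi.pos ‖z‖ ⟨norm_nonneg _, hz1⟩
  have hsub : closedBall z (d / 2) ⊆ ball 0 1 := by
    intro w hw
    rw [mem_closedBall, dist_eq_norm] at hw
    rw [mem_ball_zero_iff]
    have := norm_le_insert' w z
    linarith
  set W := phi ‖z‖ * d ^ (1 / q) with hW
  have hW0 : 0 < W := by positivity
  have hM : ∀ w ∈ sphere z (d / 2), ‖f w‖ ≤ K * N / W := by
    intro w hw
    have hwb := hsub (sphere_subset_closedBall hw)
    have hw1 := mem_ball_zero_iff.1 hwb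
    have h1 := hgrow f hf N hN h w hwb
    have hwz : ‖w‖ ≤ 1 - d / 2 := by
      rw [mem_sphere, dist_eq_norm] at hw
      have := norm_le_insert' w z
      linarith
    have h2 : phi (1 - d / 2) ≤ phi ‖w‖ :=
      hphi.antitoneOn ⟨norm_nonneg _, hw1⟩ ⟨by linarith [norm_nonneg z], by linarith⟩ hwz
    have h3 : phi ‖z‖ ≤ phi (1 - d / 2) * 2 ^ b := by
      have := le_mul_div_rpow_of_monotoneOn hmono (norm_nonneg z) (s := 1 - d / 2) (by linarith)
        (by linarith)
      have h5 : (1 - ‖z‖) / (1 - (1 - d / 2)) = 2 := by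
        rw [← hd, div_eq_iff (by linarith)]
        ring
      rwa [h5] at this
    have h4 : W ≤ phi ‖w‖ * (1 - ‖w‖) ^ (1 / q) * (2 ^ b * 2 ^ (1 / q)) := by
      have h5 : d ≤ (1 - ‖w‖) * 2 := by linarith
      have h6 : 0 ≤ 1 - ‖w‖ := by linarith
      have h7 := hphi.pos ‖w‖ ⟨norm_nonneg _, hw1⟩
      calc W ≤ (phi ‖w‖ * 2 ^ b) * ((1 - ‖w‖) * 2) ^ (1 / q) := by
            rw [hW]
            gcongr
            exact h3.trans (by gcongr)
        _ = _ := by rw [Real.mul_rpow h6 (by norm_num)]; ring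
    rw [le_div_iff₀ hW0]
    calc ‖f w‖ * W ≤ ‖f w‖ * (phi ‖w‖ * (1 - ‖w‖) ^ (1 / q) * (2 ^ b * 2 ^ (1 / q))) := by gcongr
      _ = (‖f w‖ * (phi ‖w‖ * (1 - ‖w‖) ^ (1 / q))) * (2 ^ b * 2 ^ (1 / q)) := by ring
      _ ≤ (C * N) * (2 ^ b * 2 ^ (1 / q)) := by gcongr
      _ = _ := by rw [hK]; ring
  obtain ⟨h1, h2⟩ := norm_deriv_le_of_sphere hf.1 (by positivity) hsub hM
  have hD : 1 - ‖z‖ ^ 2 ≤ 2 * d := by rw [hd]; nlinarith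
  have hD0 : 0 ≤ 1 - ‖z‖ ^ 2 := by nlinarith [norm_nonneg z]
  have hpow : ∀ s : ℝ, 0 ≤ s → (1 - ‖z‖ ^ 2) ^ s ≤ 2 ^ s * d ^ s := fun s hs => by
    rw [← Real.mul_rpow (by norm_num) hd0.le]
    exact Real.rpow_le_rpow hD0 hD hs
  constructor
  · calc _ ≤ (K * N / W / (d / 2)) * (phi ‖z‖ * (2 ^ (1 / q + 1) * d ^ (1 / q + 1))) := by
          gcongr
          exact hpow _ (by positivity)
      _ = 2 * K * 2 ^ (1 / q + 1) * N := by
          rw [hW, Real.rpow_add hd0, Real.rpow_one]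
          field_simp
      _ ≤ 8 * K * 2 ^ (1 / q + 2) * N := by
          gcongr <;> norm_num
  · calc _ ≤ (2 * (K * N / W) / (d / 2) ^ 2) *
          (phi ‖z‖ * (2 ^ (1 / q + 2) * d ^ (1 / q + 2))) := by
          gcongr
          exact hpow _ (by positivity)
      _ = 8 * K * 2 ^ (1 / q + 2) * N := by
          rw [hW, Real.rpow_add hd0, Real.rpow_two]
          field_simp
          ring

/-! ### Normal families -/

lemma norm_deriv_le_of_closedBall {f : ℂ → ℂ} (hf : DifferentiableOn ℂ f (ball 0 1)) {δ ρ M : ℝ}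
    (hδρ : δ < ρ) (hρ : ρ < 1) (hM : ∀ w, ‖w‖ ≤ ρ → ‖f w‖ ≤ M) {z : ℂ} (hz : ‖z‖ ≤ δ) :
    ‖deriv f z‖ ≤ M / (ρ - δ) ∧ ‖deriv (deriv f) z‖ ≤ 2 * M / (ρ - δ) ^ 2 := by
  have h : ∀ w ∈ closedBall z (ρ - δ), ‖w‖ ≤ ρ := fun w hw => by
    rw [mem_closedBall, dist_eq_norm] at hw
    have := norm_le_insert' w z
    linarith
  refine norm_deriv_le_of_sphere hf (by linarith) (fun w hw => ?_) fun w hw =>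
    hM w (h w (sphere_subset_closedBall hw))
  rw [mem_ball_zero_iff]
  linarith [h w hw]

/-- **Montel's theorem** on the unit disc. -/
lemma exists_subseq_tendstoUniformly {f : ℕ → ℂ → ℂ} (hf : ∀ k, DifferentiableOn ℂ (f k) (ball 0 1))
    (hb : ∀ ρ < 1, ∃ M : ℝ, ∀ k z, ‖z‖ ≤ ρ → ‖f k z‖ ≤ M) :
    ∃ F ∈ discHol, ∃ s : ℕ → ℕ, StrictMono s ∧
      ∀ ρ < 1, ∀ ε > 0, ∀ᶠ k in atTop, ∀ z, ‖z‖ ≤ ρ → ‖f (s k) z - F z‖ ≤ ε := by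
  -- The Taylor coefficients lie in a compact product of discs, so they converge along a subsequence.
  set c : ℕ → ℕ → ℂ := fun k n => (n.factorial : ℂ)⁻¹ * iteratedDeriv n (f k) 0 with hc
  have hcb : ∀ ρ, 0 < ρ → ρ < 1 → ∃ M : ℝ, 0 ≤ M ∧ ∀ k n, ‖c k n‖ ≤ M / ρ ^ n := by
    intro ρ h0 h1
    obtain ⟨M, hM⟩ := hb ρ h1
    refine ⟨M, (norm_nonneg _).trans (hM 0 0 (by simpa using h0.le)), fun k n => ?_⟩
    have := Complex.norm_iteratedDeriv_le_of_forall_mem_sphere_norm_le n h0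
      ((hf k).diffContOnCl_ball (closedBall_subset_ball h1)) fun z hz =>
        hM k z (mem_sphere_zero_iff_norm.1 hz).le
    rw [hc, norm_mul, norm_inv, Complex.norm_natCast, inv_mul_le_iff₀ (by positivity)]
    rwa [mul_div_assoc] at this
  have hsum : ∀ k, ∀ z ∈ ball (0 : ℂ) 1, HasSum (fun n => c k n * z ^ n) (f k z) := by
    intro k z hz
    have := Complex.hasSum_taylorSeries_on_ball (r := 1) (hf k) hz
    simp only [sub_zero, smul_eq_mul] at this
    have he : (fun n => c k n * z ^ n) =
        fun n => (n.factorial : ℂ)⁻¹ * (z ^ n * iteratedDeriv n (f k) 0) := by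
      funext n
      simp only [hc]
      ring
    rwa [he]
  obtain ⟨M₀, -, hM₀⟩ := hcb (1 / 2) (by norm_num) (by norm_num)
  have hK : IsCompact (Set.pi univ fun n : ℕ => closedBall (0 : ℂ) (M₀ / (1 / 2) ^ n)) :=
    isCompact_univ_pi fun n => isCompact_closedBall _ _
  obtain ⟨a, -, s, hs, hlim⟩ := hK.tendsto_subseq (x := c) fun k n _ => by
    simpa using hM₀ k n
  rw [tendsto_pi_nhds] at hlim
  have hab : ∀ ρ, 0 < ρ → ρ < 1 → ∃ M : ℝ, 0 ≤ M ∧ (∀ n, ‖a n‖ ≤ M / ρ ^ n) ∧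
      ∀ k n, ‖c k n‖ ≤ M / ρ ^ n := by
    intro ρ h0 h1
    obtain ⟨M, hM0, hM⟩ := hcb ρ h0 h1
    exact ⟨M, hM0, fun n => le_of_tendsto (hlim n).norm (Eventually.of_forall fun k => hM _ n), hM⟩
  set F : ℂ → ℂ := (ball (0 : ℂ) 1).indicator fun z => ∑' n, a n * z ^ n with hF
  have hconv : ∀ ρ < 1, ∀ ε > 0, ∀ᶠ k in atTop, ∀ z, ‖z‖ ≤ ρ → ‖f (s k) z - F z‖ ≤ ε := by
    intro ρ' hρ'1 ε hε
    set ρ := max ρ' 0 with hρ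
    have hρ1 : ρ < 1 := max_lt hρ'1 one_pos
    have hρ0 : 0 ≤ ρ := le_max_right _ _
    obtain ⟨M, hM0, hMa, hMc⟩ := hab ((1 + ρ) / 2) (by positivity) (by linarith)
    set x := ρ / ((1 + ρ) / 2) with hx
    have hx0 : 0 ≤ x := by positivity
    have hx1 : x < 1 := by rw [hx, div_lt_one (by positivity)]; linarith
    have hgeom : Summable fun n : ℕ => 2 * M * x ^ n :=
      (summable_geometric_of_lt_one hx0 hx1).mul_left _
    have hterm : ∀ u : ℂ, ∀ n : ℕ, ‖u‖ ≤ M / ((1 + ρ) / 2) ^ n → ‖u‖ * ρ ^ n ≤ M * x ^ n := by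
      intro u n hu
      calc _ ≤ M / ((1 + ρ) / 2) ^ n * ρ ^ n := by gcongr
        _ = _ := by rw [hx, div_pow ρ, mul_div_assoc', div_mul_eq_mul_div]
    have hbound : ∀ k n, ‖c (s k) n - a n‖ * ρ ^ n ≤ 2 * M * x ^ n := by
      intro k n
      have h1 := hterm _ n (hMa n)
      have h2 := hterm _ n (hMc (s k) n)
      calc _ ≤ (‖c (s k) n‖ + ‖a n‖) * ρ ^ n := by gcongr; exact norm_sub_le _ _
        _ ≤ _ := by rw [add_mul]; linarith
    have hsummable : ∀ k, Summable fun n => ‖c (s k) n - a n‖ * ρ ^ n := fun k =>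
      Summable.of_nonneg_of_le (fun n => by positivity) (hbound k) hgeom
    have ht : Tendsto (fun k => ∑' n, ‖c (s k) n - a n‖ * ρ ^ n) atTop (𝓝 (∑' _ : ℕ, (0 : ℝ))) := by
      refine tendsto_tsum_of_dominated_convergence hgeom (fun n => ?_)
        (Eventually.of_forall fun k n => ?_)
      · have := ((hlim n).sub_const (a n)).norm.mul_const (ρ ^ n)
        simpa using this
      · rw [Real.norm_of_nonneg (by positivity)]
        exact hbound k n
    rw [tsum_zero] at ht
    filter_upwards [ht.eventually_le_const hε] with k hk z hz
    have hzρ : ‖z‖ ≤ ρ := hz.trans (le_max_left _ _)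
    have hzb : z ∈ ball (0 : ℂ) 1 := mem_ball_zero_iff.2 (hzρ.trans_lt hρ1)
    have hsa : Summable fun n => a n * z ^ n := by
      refine Summable.of_norm_bounded (g := fun n => M * x ^ n)
        ((summable_geometric_of_lt_one hx0 hx1).mul_left _) fun n => ?_
      rw [norm_mul, norm_pow]
      exact le_trans (by gcongr) (hterm _ n (hMa n))
    have h1 := (hsum (s k) z hzb).sub hsa.hasSum
    rw [hF, indicator_of_mem hzb, ← h1.tsum_eq]
    refine (tsum_of_norm_bounded (hsummable k).hasSum fun n => ?_).trans hk
    rw [← sub_mul, norm_mul, norm_pow]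
    gcongr
  refine ⟨F, ⟨?_, fun z hz => indicator_of_notMem hz _⟩, s, hs, hconv⟩
  have hlu : TendstoLocallyUniformlyOn (fun k => f (s k)) F atTop (ball 0 1) := by
    rw [Metric.tendstoLocallyUniformlyOn_iff]
    intro ε hε z hz
    have hz1 := mem_ball_zero_iff.1 hz
    refine ⟨ball 0 ((1 + ‖z‖) / 2), mem_nhdsWithin_of_mem_nhds
      (isOpen_ball.mem_nhds (by rw [mem_ball_zero_iff]; linarith)), ?_⟩
    filter_upwards [hconv ((1 + ‖z‖) / 2) (by linarith) (ε / 2) (by positivity)] with k hk w hw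
    rw [dist_comm, dist_eq_norm]
    linarith [hk w (mem_ball_zero_iff.1 hw).le]
  exact hlu.differentiableOn (Eventually.of_forall fun k => hf (s k)) isOpen_ball

/-! ### The quasi-norm of `H(p, q, φ)` -/

lemma aemeasurable_mixedNorm_integrand {p q : ℝ} {phi : ℝ → ℝ} (hphi : IsNormal phi) {f : ℂ → ℂ}
    (hf : f ∈ discHol) : AEMeasurable (fun r => ENNReal.ofReal
        (integralMean q f r ^ p * (phi r ^ p / (1 - r)))) (volume.restrict (Ioo (0 : ℝ) 1)) := by
  have hphim : AEMeasurable phi (volume.restrict (Ioo (0 : ℝ) 1)) :=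
    (hphi.continuousOn.mono Ioo_subset_Ico_self).aemeasurable measurableSet_Ioo
  have := (measurable_integralMean q hf).aemeasurable (μ := volume.restrict (Ioo (0 : ℝ) 1))
  exact ((this.pow_const p).mul ((hphim.pow_const p).div (by fun_prop))).ennreal_ofReal

lemma mixedNorm_smul {p q : ℝ} {phi : ℝ → ℝ} (hp : 0 < p) (hq : 0 < q) (c : ℂ) (f : ℂ → ℂ) :
    mixedNorm p q phi (c • f) = ENNReal.ofReal ‖c‖ * mixedNorm p q phi f := by
  have : ∀ r, ENNReal.ofReal (integralMean q (c • f) r ^ p * (phi r ^ p / (1 - r))) =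
      ENNReal.ofReal (‖c‖ ^ p) *
        ENNReal.ofReal (integralMean q f r ^ p * (phi r ^ p / (1 - r))) := fun r => by
    rw [← ENNReal.ofReal_mul (by positivity), integralMean_smul hq,
      Real.mul_rpow (norm_nonneg _) (integralMean_nonneg _ _ _), mul_assoc]
  unfold mixedNorm
  simp only [this]
  rw [lintegral_const_mul' _ _ ENNReal.ofReal_ne_top, ENNReal.mul_rpow_of_nonneg _ _ (by positivity),
    ← ENNReal.ofReal_rpow_of_nonneg (norm_nonneg _) hp.le, ← ENNReal.rpow_mul,
    mul_one_div_cancel hp.ne', ENNReal.rpow_one]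

/-- The quasi-triangle inequality, for two functions of quasi-norm at most `N`. -/
lemma exists_mixedNorm_sub_le {p q : ℝ} {phi : ℝ → ℝ} (hp : 0 < p) (hq : 0 < q)
    (hphi : IsNormal phi) :
    ∃ K : ℝ, 0 < K ∧ ∀ f ∈ discHol, ∀ h ∈ discHol, ∀ N : ℝ, 0 ≤ N →
      mixedNorm p q phi f ≤ ENNReal.ofReal N → mixedNorm p q phi h ≤ ENNReal.ofReal N →
      mixedNorm p q phi (f - h) ≤ ENNReal.ofReal (K * N) := by
  set K : ℝ := (2 * 2 ^ (1 / q)) ^ p * 2 ^ p with hK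
  have hK0 : 0 ≤ K := by positivity
  refine ⟨(K * 2) ^ (1 / p), by positivity, fun f hf h hh N hN hfN hhN => ?_⟩
  have hh' : -h ∈ discHol := discHol.neg_mem hh
  have hneg : ∀ r, integralMean q (-h) r = integralMean q h r := fun r => by
    simpa using integralMean_smul hq (-1) h r
  have hfN' := lintegral_le_of_mixedNorm_le hp hN hfN
  have hhN' := lintegral_le_of_mixedNorm_le hp hN hhN
  have hw : ∀ r ∈ Ioo (0 : ℝ) 1, 0 ≤ phi r ^ p / (1 - r) := fun r hr =>
    div_nonneg (Real.rpow_nonneg (hphi.pos r ⟨hr.1.le, hr.2⟩).le _) (by linarith [hr.2])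
  have hle : ∫⁻ r in Ioo (0 : ℝ) 1,
        ENNReal.ofReal (integralMean q (f - h) r ^ p * (phi r ^ p / (1 - r))) ≤
      ∫⁻ r in Ioo (0 : ℝ) 1, ENNReal.ofReal K *
        (ENNReal.ofReal (integralMean q f r ^ p * (phi r ^ p / (1 - r))) +
          ENNReal.ofReal (integralMean q h r ^ p * (phi r ^ p / (1 - r)))) := by
    refine setLIntegral_mono' measurableSet_Ioo fun r hr => ?_
    have h1 := integralMean_nonneg q f r
    have h2 := integralMean_nonneg q h r
    rw [← ENNReal.ofReal_add (mul_nonneg (by positivity) (hw r hr))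
      (mul_nonneg (by positivity) (hw r hr)), ← ENNReal.ofReal_mul hK0]
    refine ENNReal.ofReal_le_ofReal ?_
    rw [← add_mul, ← mul_assoc]
    refine mul_le_mul_of_nonneg_right ?_ (hw r hr)
    have h3 := integralMean_add_le hq hr hf hh'
    rw [hneg, ← sub_eq_add_neg] at h3
    calc integralMean q (f - h) r ^ p
        ≤ (2 * 2 ^ (1 / q) * (integralMean q f r + integralMean q h r)) ^ p :=
          Real.rpow_le_rpow (integralMean_nonneg _ _ _) h3 hp.le
      _ = (2 * 2 ^ (1 / q)) ^ p * (integralMean q f r + integralMean q h r) ^ p :=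
          Real.mul_rpow (by positivity) (by positivity)
      _ ≤ (2 * 2 ^ (1 / q)) ^ p *
          (2 ^ p * (integralMean q f r ^ p + integralMean q h r ^ p)) := by
          gcongr
          exact add_rpow_le h1 h2 hp
      _ = _ := by rw [hK]; ring
  rw [lintegral_const_mul' _ _ ENNReal.ofReal_ne_top,
    lintegral_add_left' (aemeasurable_mixedNorm_integrand hphi hf)] at hle
  have hle2 := hle.trans (mul_le_mul_right (add_le_add hfN' hhN') (ENNReal.ofReal K))
  rw [← ENNReal.ofReal_add (by positivity) (by positivity), ← ENNReal.ofReal_mul hK0] at hle2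
  have := mixedNorm_le_of_lintegral_le hp (by positivity) hle2
  convert this using 2
  rw [← two_mul, ← mul_assoc, Real.mul_rpow (x := K * 2) (y := N ^ p) (by positivity)
    (by positivity), ← Real.rpow_mul hN, mul_one_div_cancel hp.ne', Real.rpow_one]

/-- Balls of `H(p, q, φ)` are closed under locally uniform convergence (Fatou's lemma). -/
lemma mixedNorm_le_of_tendsto {p q : ℝ} {phi : ℝ → ℝ} (hp : 0 < p) (hq : 0 < q)
    (hphi : IsNormal phi) {f : ℕ → ℂ → ℂ} {F : ℂ → ℂ} (hf : ∀ k, f k ∈ discHol) (hF : F ∈ discHol)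
    (hconv : ∀ ρ < 1, ∀ ε > 0, ∀ᶠ k in atTop, ∀ z, ‖z‖ ≤ ρ → ‖f k z - F z‖ ≤ ε) {N : ℝ}
    (hN : 0 ≤ N) (hfN : ∀ k, mixedNorm p q phi (f k) ≤ ENNReal.ofReal N) :
    mixedNorm p q phi F ≤ ENNReal.ofReal N := by
  have hmean : ∀ r ∈ Ioo (0 : ℝ) 1,
      Tendsto (fun k => integralMean q (f k) r) atTop (𝓝 (integralMean q F r)) := by
    intro r hr
    have hcont : ContinuousOn F (sphere 0 r) := hF.1.continuousOn.mono (sphere_subset_ball hr.2)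
    obtain ⟨M, hM⟩ := (isCompact_sphere (0 : ℂ) r).exists_bound_of_continuousOn hcont
    refine Tendsto.rpow_const ?_ (Or.inr (by positivity))
    refine Tendsto.const_smul ?_ _
    have hmem : ∀ θ, ‖circleMap 0 r θ‖ = r := fun θ => by simp [abs_of_pos hr.1]
    refine intervalIntegral.tendsto_integral_filter_of_dominated_convergence
      (fun _ => (M + 1) ^ q) ?_ ?_ intervalIntegrable_const ?_
    · refine Eventually.of_forall fun k => ?_
      exact (intervalIntegrable_iff.1 (circleIntegrable_rpow hq hr (hf k))).aestronglyMeasurable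
    · filter_upwards [hconv r hr.2 1 one_pos] with k hk
      refine Eventually.of_forall fun θ _ => ?_
      rw [Real.norm_of_nonneg (by positivity)]
      refine Real.rpow_le_rpow (norm_nonneg _) ?_ hq.le
      have h1 := hk _ (hmem θ).le
      have h2 := hM _ (circleMap_mem_sphere 0 hr.1.le θ)
      have h3 := norm_le_insert' (f k (circleMap 0 r θ)) (F (circleMap 0 r θ))
      linarith
    · refine Eventually.of_forall fun θ _ => ?_
      refine Tendsto.rpow_const (Tendsto.norm ?_) (Or.inr hq.le)
      rw [tendsto_iff_norm_sub_tendsto_zero, Metric.tendsto_nhds]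
      intro ε hε
      filter_upwards [hconv r hr.2 (ε / 2) (by positivity)] with k hk
      rw [dist_zero_right, norm_norm]
      linarith [hk _ (hmem θ).le]
  have h1 : ∫⁻ r in Ioo (0 : ℝ) 1,
      ENNReal.ofReal (integralMean q F r ^ p * (phi r ^ p / (1 - r))) ≤ ENNReal.ofReal (N ^ p) := by
    calc _ = ∫⁻ r in Ioo (0 : ℝ) 1, liminf (fun k => ENNReal.ofReal
          (integralMean q (f k) r ^ p * (phi r ^ p / (1 - r)))) atTop := by
          refine setLIntegral_congr_fun measurableSet_Ioo fun r hr => ?_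
          refine (Tendsto.liminf_eq ?_).symm
          refine ENNReal.tendsto_ofReal (Tendsto.mul_const _ ?_)
          exact (hmean r hr).rpow_const (Or.inr hp.le)
      _ ≤ liminf (fun k => ∫⁻ r in Ioo (0 : ℝ) 1, ENNReal.ofReal
          (integralMean q (f k) r ^ p * (phi r ^ p / (1 - r)))) atTop :=
          lintegral_liminf_le' fun k => aemeasurable_mixedNorm_integrand hphi (hf k)
      _ ≤ _ := by
          refine (liminf_le_liminf (Eventually.of_forall fun k =>
            lintegral_le_of_mixedNorm_le hp hN (hfN k))).trans ?_
          simp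
  have := mixedNorm_le_of_lintegral_le hp (by positivity) h1
  rwa [← Real.rpow_mul hN, mul_one_div_cancel hp.ne', Real.rpow_one] at this

/-! ### The operator `C_φ^g` -/

lemma ofReal_mem_ball {z : ℂ} (hz : z ∈ ball (0 : ℂ) 1) : ((‖z‖ : ℝ) : ℂ) ∈ ball (0 : ℂ) 1 := by
  simpa using hz

lemma indicator_mem_discHol {f : ℂ → ℂ} (hf : DifferentiableOn ℂ f (ball 0 1)) :
    (ball (0 : ℂ) 1).indicator f ∈ discHol :=
  ⟨hf.congr fun _ hz => indicator_of_mem hz f, fun _ hz => indicator_of_notMem hz f⟩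

lemma indicator_eventuallyEq (f : ℂ → ℂ) {z : ℂ} (hz : z ∈ ball (0 : ℂ) 1) :
    (ball (0 : ℂ) 1).indicator f =ᶠ[𝓝 z] f :=
  Filter.eventuallyEq_of_mem (isOpen_ball.mem_nhds hz) fun _ hw => indicator_of_mem hw f

lemma deriv_indicator (f : ℂ → ℂ) {z : ℂ} (hz : z ∈ ball (0 : ℂ) 1) :
    deriv ((ball (0 : ℂ) 1).indicator f) z = deriv f z :=
  (indicator_eventuallyEq f hz).deriv_eq

lemma deriv_deriv_indicator (f : ℂ → ℂ) {z : ℂ} (hz : z ∈ ball (0 : ℂ) 1) :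
    deriv (deriv ((ball (0 : ℂ) 1).indicator f)) z = deriv (deriv f) z :=
  (indicator_eventuallyEq f hz).deriv.deriv_eq

lemma deriv_sub_apply {f h : ℂ → ℂ} (hf : f ∈ discHol) (hh : h ∈ discHol) {z : ℂ}
    (hz : z ∈ ball (0 : ℂ) 1) :
    deriv (f - h) z = deriv f z - deriv h z ∧
      deriv (deriv (f - h)) z = deriv (deriv f) z - deriv (deriv h) z := by
  have hd : ∀ w ∈ ball (0 : ℂ) 1, deriv (f - h) w = deriv f w - deriv h w := fun w hw =>
    deriv_sub (hf.1.differentiableAt (isOpen_ball.mem_nhds hw))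
      (hh.1.differentiableAt (isOpen_ball.mem_nhds hw))
  have hev : deriv (f - h) =ᶠ[𝓝 z] deriv f - deriv h :=
    Filter.eventuallyEq_of_mem (isOpen_ball.mem_nhds hz) hd
  refine ⟨hd z hz, ?_⟩
  rw [hev.deriv_eq, deriv_sub
    ((hf.1.deriv isOpen_ball).differentiableAt (isOpen_ball.mem_nhds hz))
    ((hh.1.deriv isOpen_ball).differentiableAt (isOpen_ball.mem_nhds hz))]

/-- `C_φ^g f` is the primitive of `(f' ∘ φ) g` that vanishes at `0`. -/
lemma hasDerivAt_integralOp {vphi g f : ℂ → ℂ} (hv : DifferentiableOn ℂ vphi (ball 0 1))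
    (hm : MapsTo vphi (ball 0 1) (ball 0 1)) (hg : DifferentiableOn ℂ g (ball 0 1))
    (hf : DifferentiableOn ℂ f (ball 0 1)) {z : ℂ} (hz : z ∈ ball (0 : ℂ) 1) :
    HasDerivAt (integralOp vphi g f) (deriv f (vphi z) * g z) z := by
  set G : ℂ → ℂ := fun z => deriv f (vphi z) * g z with hG
  have hGd : DifferentiableOn ℂ G (ball 0 1) := ((hf.deriv isOpen_ball).comp hv hm).mul hg
  obtain ⟨P, hP0, hP⟩ := hGd.isExactOn_ball.with_val_at 0 0
  have key : ∀ w ∈ ball (0 : ℂ) 1, integralOp vphi g f w = P w := by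
    intro w hw
    have hmem : ∀ t ∈ uIcc (0 : ℝ) 1, (t : ℂ) * w ∈ ball (0 : ℂ) 1 := by
      intro t ht
      rw [uIcc_of_le zero_le_one] at ht
      rw [mem_ball_zero_iff] at hw ⊢
      rw [norm_mul, Complex.norm_real, Real.norm_of_nonneg ht.1]
      nlinarith [ht.1, ht.2, norm_nonneg w]
    have hder : ∀ t ∈ uIcc (0 : ℝ) 1,
        HasDerivAt (fun t : ℝ => P (t * w)) (G (t * w) * w) t := by
      intro t ht
      have h1 : HasDerivAt (fun t : ℝ => (t : ℂ) * w) (1 * w) t :=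
        (HasDerivAt.ofReal_comp (hasDerivAt_id t)).mul_const w
      have h2 := (hP _ (hmem t ht)).comp t h1
      rwa [one_mul] at h2
    have hcont : ContinuousOn (fun t : ℝ => G (t * w) * w) (uIcc 0 1) := by
      refine ContinuousOn.mul ?_ continuousOn_const
      exact hGd.continuousOn.comp (by fun_prop) hmem
    have := intervalIntegral.integral_eq_sub_of_hasDerivAt hder hcont.intervalIntegrable
    rw [intervalIntegral.integral_mul_const] at this
    simp only [Complex.ofReal_one, one_mul, Complex.ofReal_zero, zero_mul, hP0, sub_zero] at this
    rw [integralOp, mul_comm]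
    exact this
  exact (hP z hz).congr_of_eventuallyEq
    (Filter.eventuallyEq_of_mem (isOpen_ball.mem_nhds hz) key)

lemma ofReal_mul_norm_le_zygmundNorm (μ : ℂ → ℝ) (F : ℂ → ℂ) {z : ℂ} (hz : z ∈ ball (0 : ℂ) 1) :
    ENNReal.ofReal (μ (‖z‖ : ℂ)) * ‖deriv (deriv F) z‖ₑ ≤ zygmundNorm μ F :=
  (le_iSup₂ (f := fun z _ => ENNReal.ofReal (μ (‖z‖ : ℂ)) * ‖deriv (deriv F) z‖ₑ) z hz).trans
    le_add_self

section Operator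

variable {p q : ℝ} {phi : ℝ → ℝ} {hp : 0 < p} {hq : 0 < q} {hphi : IsNormal phi} {μ : ℂ → ℝ}
  {vphi g : ℂ → ℂ}

/-- `T` is the operator `C_φ^g` for analytic `φ : 𝔻 → 𝔻` and analytic `g`, and `μ` is a weight. -/
structure IsIntegralOp (vphi g : ℂ → ℂ) (T : mixedNormSpace hp hq hphi →ₗ[ℂ] zygmundSpace μ) :
    Prop where
  weight : IsWeight μ
  diff_symbol : DifferentiableOn ℂ vphi (ball 0 1)
  mapsTo : MapsTo vphi (ball 0 1) (ball 0 1)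
  diff_factor : DifferentiableOn ℂ g (ball 0 1)
  apply_eq : ∀ f : mixedNormSpace hp hq hphi, ∀ z ∈ ball (0 : ℂ) 1,
    (T f : ℂ → ℂ) z = integralOp vphi g f z

variable {T : mixedNormSpace hp hq hphi →ₗ[ℂ] zygmundSpace μ}

lemma IsWeight.nonneg (h : IsWeight μ) {z : ℂ} (hz : z ∈ ball (0 : ℂ) 1) : 0 ≤ μ (‖z‖ : ℂ) :=
  (h.pos _ (ofReal_mem_ball hz)).le

lemma IsIntegralOp.deriv_apply (hT : IsIntegralOp vphi g T) (f : mixedNormSpace hp hq hphi) {z : ℂ}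
    (hz : z ∈ ball (0 : ℂ) 1) :
    deriv (T f : ℂ → ℂ) z = deriv (f : ℂ → ℂ) (vphi z) * g z := by
  have h : (T f : ℂ → ℂ) =ᶠ[𝓝 z] integralOp vphi g f :=
    Filter.eventuallyEq_of_mem (isOpen_ball.mem_nhds hz) (hT.apply_eq f)
  rw [h.deriv_eq]
  exact (hasDerivAt_integralOp hT.diff_symbol hT.mapsTo hT.diff_factor f.2.1.1 hz).deriv

lemma IsIntegralOp.deriv_deriv_apply (hT : IsIntegralOp vphi g T)
    (f : mixedNormSpace hp hq hphi) {z : ℂ} (hz : z ∈ ball (0 : ℂ) 1) :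
    deriv (deriv (T f : ℂ → ℂ)) z =
      deriv (deriv (f : ℂ → ℂ)) (vphi z) * (deriv vphi z * g z) + deriv f (vphi z) * deriv g z := by
  have h : deriv (T f : ℂ → ℂ) =ᶠ[𝓝 z] fun z => deriv f (vphi z) * g z :=
    Filter.eventuallyEq_of_mem (isOpen_ball.mem_nhds hz) fun w hw => hT.deriv_apply f hw
  rw [h.deriv_eq]
  have h1 : HasDerivAt (deriv (f : ℂ → ℂ)) (deriv (deriv (f : ℂ → ℂ)) (vphi z)) (vphi z) :=
    ((f.2.1.1.deriv isOpen_ball).differentiableAt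
      (isOpen_ball.mem_nhds (hT.mapsTo hz))).hasDerivAt
  have h2 := (hT.diff_symbol.differentiableAt (isOpen_ball.mem_nhds hz)).hasDerivAt
  have h3 := (hT.diff_factor.differentiableAt (isOpen_ball.mem_nhds hz)).hasDerivAt
  have h4 := (h1.comp z h2).mul h3
  refine h4.deriv.trans ?_
  simp only [Function.comp_apply]
  ring

lemma IsIntegralOp.zygmundNorm_le (hT : IsIntegralOp vphi g T) (f : mixedNormSpace hp hq hphi)
    {E₀ E : ℝ} (h0 : ‖deriv (f : ℂ → ℂ) (vphi 0)‖ * ‖g 0‖ ≤ E₀)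
    (h : ∀ z ∈ ball (0 : ℂ) 1, μ (‖z‖ : ℂ) * (‖deriv (deriv (f : ℂ → ℂ)) (vphi z)‖ * ‖deriv vphi z * g z‖ +
      ‖deriv (f : ℂ → ℂ) (vphi z)‖ * ‖deriv g z‖) ≤ E) :
    zygmundNorm μ (T f) ≤ ENNReal.ofReal (E₀ + E) := by
  have hb0 : (0 : ℂ) ∈ ball (0 : ℂ) 1 := mem_ball_self one_pos
  have hE₀ : 0 ≤ E₀ := le_trans (by positivity) h0
  have hE : 0 ≤ E := le_trans (mul_nonneg (hT.weight.nonneg hb0) (by positivity)) (h 0 hb0)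
  rw [ENNReal.ofReal_add hE₀ hE, zygmundNorm, hT.apply_eq f 0 hb0, hT.deriv_apply f hb0]
  refine add_le_add ?_ (iSup₂_le fun z hz => ?_)
  · rw [integralOp, zero_mul, enorm_zero, zero_add, ← ofReal_norm, norm_mul]
    exact ENNReal.ofReal_le_ofReal h0
  · rw [hT.deriv_deriv_apply f hz, ← ofReal_norm, ← ENNReal.ofReal_mul (hT.weight.nonneg hz)]
    refine ENNReal.ofReal_le_ofReal (le_trans ?_ (h z hz))
    refine mul_le_mul_of_nonneg_left ?_ (hT.weight.nonneg hz)
    refine (norm_add_le _ _).trans ?_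
    rw [norm_mul (deriv (deriv _) _), norm_mul (deriv _ (vphi z)) (deriv g z)]

lemma IsBoundedOp.exists_bound (hb : IsBoundedOp T) (f : mixedNormSpace hp hq hphi) :
    ∃ M : ℝ, ∀ z ∈ ball (0 : ℂ) 1, μ (‖z‖ : ℂ) * ‖deriv (deriv (T f : ℂ → ℂ)) z‖ ≤ M := by
  obtain ⟨K, hK⟩ := hb
  have hfin : zygmundNorm μ (T f) ≠ ∞ :=
    ((hK f).trans_lt (ENNReal.mul_lt_top ENNReal.coe_lt_top f.2.2)).ne
  refine ⟨(zygmundNorm μ (T f)).toReal, fun z hz => ?_⟩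
  have h := ENNReal.toReal_mono hfin (ofReal_mul_norm_le_zygmundNorm μ (T f) hz)
  rw [ENNReal.toReal_mul, toReal_enorm] at h
  refine le_trans ?_ h
  gcongr
  rw [ENNReal.toReal_ofReal']
  exact le_max_left _ _

/-- Testing a bounded `C_φ^g` on `z` and `z²` bounds `μ |φ' g|` and `μ |g'|`. -/
lemma IsIntegralOp.exists_bound (hT : IsIntegralOp vphi g T) (hb : IsBoundedOp T) :
    ∃ M : ℝ, 0 ≤ M ∧ ∀ z ∈ ball (0 : ℂ) 1, μ (‖z‖ : ℂ) * ‖deriv vphi z * g z‖ ≤ M ∧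
      μ (‖z‖ : ℂ) * ‖deriv g z‖ ≤ M := by
  have hd1 : DifferentiableOn ℂ (fun z : ℂ => z) (ball 0 1) := by fun_prop
  have hd2 : DifferentiableOn ℂ (fun z : ℂ => z ^ 2) (ball 0 1) := by fun_prop
  let f₁ : mixedNormSpace hp hq hphi := ⟨_, mem_mixedNormSpace_of_bounded hp hq hphi
    (indicator_mem_discHol hd1) (M := 1) fun z hz => by
      rw [indicator_of_mem hz]
      exact (mem_ball_zero_iff.1 hz).le⟩
  let f₂ : mixedNormSpace hp hq hphi := ⟨_, mem_mixedNormSpace_of_bounded hp hq hphi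
    (indicator_mem_discHol hd2) (M := 1) fun z hz => by
      rw [indicator_of_mem hz, norm_pow]
      exact pow_le_one₀ (norm_nonneg _) (mem_ball_zero_iff.1 hz).le⟩
  obtain ⟨M₁, h₁⟩ := hb.exists_bound f₁
  obtain ⟨M₂, h₂⟩ := hb.exists_bound f₂
  have hs : deriv (fun z : ℂ => z ^ 2) = fun z => 2 * z := by
    funext z
    simp
  have hs' : ∀ z : ℂ, deriv (fun z : ℂ => 2 * z) z = 2 := fun z => by
    simp
  have e₁ : ∀ z ∈ ball (0 : ℂ) 1, deriv (deriv (T f₁ : ℂ → ℂ)) z = deriv g z := fun z hz => by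
    rw [hT.deriv_deriv_apply f₁ hz, deriv_indicator _ (hT.mapsTo hz),
      deriv_deriv_indicator _ (hT.mapsTo hz)]
    simp
  have e₂ : ∀ z ∈ ball (0 : ℂ) 1, deriv (deriv (T f₂ : ℂ → ℂ)) z =
      2 * (deriv vphi z * g z) + 2 * vphi z * deriv g z := fun z hz => by
    rw [hT.deriv_deriv_apply f₂ hz, deriv_indicator _ (hT.mapsTo hz),
      deriv_deriv_indicator _ (hT.mapsTo hz), hs, hs']
  have hg : ∀ z ∈ ball (0 : ℂ) 1, μ (‖z‖ : ℂ) * ‖deriv g z‖ ≤ M₁ := fun z hz => by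
    rw [← e₁ z hz]
    exact h₁ z hz
  have h0 : (0 : ℂ) ∈ ball (0 : ℂ) 1 := mem_ball_self one_pos
  have hM₁ : 0 ≤ M₁ := le_trans (mul_nonneg (hT.weight.nonneg h0) (norm_nonneg _)) (hg 0 h0)
  have hM₂ : 0 ≤ M₂ := le_trans (mul_nonneg (hT.weight.nonneg h0) (norm_nonneg _)) (h₂ 0 h0)
  refine ⟨M₁ + M₂, by positivity, fun z hz => ⟨?_, (hg z hz).trans (by linarith)⟩⟩
  have hz2 := h₂ z hz
  rw [e₂ z hz] at hz2
  have hv := mem_ball_zero_iff.1 (hT.mapsTo hz)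
  have h3 : 2 * ‖deriv vphi z * g z‖ ≤
      ‖2 * (deriv vphi z * g z) + 2 * vphi z * deriv g z‖ + 2 * ‖deriv g z‖ := by
    have h4 := norm_sub_le (2 * (deriv vphi z * g z) + 2 * vphi z * deriv g z)
      (2 * vphi z * deriv g z)
    have h5 : ‖2 * vphi z * deriv g z‖ ≤ 2 * ‖deriv g z‖ := by
      rw [norm_mul, norm_mul, Complex.norm_ofNat]
      nlinarith [norm_nonneg (deriv g z)]
    rw [add_sub_cancel_right, norm_mul, Complex.norm_ofNat] at h4
    linarith
  have h6 := mul_le_mul_of_nonneg_left h3 (hT.weight.nonneg hz)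
  nlinarith [hg z hz]

end Operator

/-! ### The upper estimate -/

lemma exists_bound_closedBall {p q : ℝ} {phi : ℝ → ℝ} (hp : 0 < p) (hq : 0 < q)
    (hphi : IsNormal phi) {ρ : ℝ} (hρ : ρ < 1) :
    ∃ M : ℝ, 0 ≤ M ∧ ∀ f ∈ discHol, ∀ N : ℝ, 0 ≤ N → mixedNorm p q phi f ≤ ENNReal.ofReal N →
      ∀ z, ‖z‖ ≤ ρ → ‖f z‖ ≤ M * N := by
  obtain ⟨C, hC, hgrow⟩ := exists_growth hp hq hphi
  by_cases hρ0 : 0 ≤ ρ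
  swap
  · exact ⟨0, le_rfl, fun f _ N _ _ z hz => absurd ((norm_nonneg z).trans hz) hρ0⟩
  have h1 := hphi.pos ρ ⟨hρ0, hρ⟩
  have h2 : 0 < 1 - ρ := by linarith
  have hW : 0 < phi ρ * (1 - ρ) ^ (1 / q) := by positivity
  refine ⟨C / (phi ρ * (1 - ρ) ^ (1 / q)), by positivity, fun f hf N hN h z hz => ?_⟩
  have hz1 : ‖z‖ < 1 := hz.trans_lt hρ
  have h3 := hgrow f hf N hN h z (mem_ball_zero_iff.2 hz1)
  have h4 : phi ρ * (1 - ρ) ^ (1 / q) ≤ phi ‖z‖ * (1 - ‖z‖) ^ (1 / q) := by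
    have := hphi.antitoneOn ⟨norm_nonneg _, hz1⟩ ⟨hρ0, hρ⟩ hz
    have := (hphi.pos ‖z‖ ⟨norm_nonneg _, hz1⟩).le
    gcongr
  rw [div_mul_eq_mul_div, le_div_iff₀ hW]
  exact (mul_le_mul_of_nonneg_left h4 (norm_nonneg _)).trans h3

/-- A bounded sequence in `H(p, q, φ)` has a subsequence which converges, together with its first
two derivatives, uniformly on compact subsets of the disc to an element of `H(p, q, φ)`. -/
lemma exists_subseq_deriv_tendsto {p q : ℝ} {phi : ℝ → ℝ} {hp : 0 < p} {hq : 0 < q}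
    {hphi : IsNormal phi} (f : ℕ → mixedNormSpace hp hq hphi) {N : ℝ} (hN : 0 ≤ N)
    (hf : ∀ k, mixedNorm p q phi (f k) ≤ ENNReal.ofReal N) :
    ∃ F : mixedNormSpace hp hq hphi, mixedNorm p q phi F ≤ ENNReal.ofReal N ∧
      ∃ s : ℕ → ℕ, StrictMono s ∧ ∀ ρ < 1, ∀ ε > 0, ∀ᶠ k in atTop, ∀ z, ‖z‖ ≤ ρ →
        ‖deriv ((f (s k) - F : mixedNormSpace hp hq hphi) : ℂ → ℂ) z‖ ≤ ε ∧
        ‖deriv (deriv ((f (s k) - F : mixedNormSpace hp hq hphi) : ℂ → ℂ)) z‖ ≤ ε := by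
  obtain ⟨F, hF, s, hs, hconv⟩ := exists_subseq_tendstoUniformly (f := fun k => (f k : ℂ → ℂ))
    (fun k => (f k).2.1.1) fun ρ hρ => by
      obtain ⟨M, -, hM⟩ := exists_bound_closedBall hp hq hphi hρ
      exact ⟨M * N, fun k z hz => hM _ (f k).2.1 N hN (hf k) z hz⟩
  have hFN := mixedNorm_le_of_tendsto hp hq hphi (fun k => (f (s k)).2.1) hF hconv hN
    fun k => hf (s k)
  refine ⟨⟨F, hF, hFN.trans_lt ENNReal.ofReal_lt_top⟩, hFN, s, hs, fun ρ hρ ε hε => ?_⟩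
  set ρ' := (1 + ρ) / 2 with hρ'
  have h1 : ρ < ρ' := by linarith
  have h2 : ρ' < 1 := by linarith
  have h3 : 0 < ρ' - ρ := by linarith
  set η := min (ε * (ρ' - ρ)) (ε * (ρ' - ρ) ^ 2 / 2) with hη
  have hη0 : 0 < η := lt_min (by positivity) (by positivity)
  filter_upwards [hconv ρ' h2 η hη0] with k hk z hz
  obtain ⟨h4, h5⟩ := norm_deriv_le_of_closedBall (f := (f (s k) : ℂ → ℂ) - F)
    ((f (s k)).2.1.1.sub hF.1) h1 h2 hk hz
  refine ⟨h4.trans ?_, h5.trans ?_⟩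
  · rw [div_le_iff₀ h3]
    exact min_le_left _ _
  · rw [div_le_iff₀ (by positivity)]
    linarith [min_le_right (ε * (ρ' - ρ)) (ε * (ρ' - ρ) ^ 2 / 2)]

lemma tendsto_zero_of_eventually_le {x : ℕ → ℝ≥0∞} {c : ℝ} (hc : 0 ≤ c)
    (h : ∀ ε > 0, ∀ᶠ k in atTop, x k ≤ ENNReal.ofReal (ε * c)) : Tendsto x atTop (𝓝 0) := by
  rw [ENNReal.tendsto_nhds_zero]
  intro ε hε
  by_cases hεt : ε = ∞
  · exact Eventually.of_forall fun k => hεt ▸ le_top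
  have h1 : 0 < ε.toReal := ENNReal.toReal_pos hε.ne' hεt
  filter_upwards [h (ε.toReal / (c + 1)) (by positivity)] with k hk
  refine hk.trans ((ENNReal.ofReal_le_ofReal ?_).trans (ENNReal.ofReal_toReal hεt).le)
  rw [div_mul_eq_mul_div, div_le_iff₀ (by positivity)]
  nlinarith

/-- The quotient `μ(|z|) |u(z)| / (φ(|φ(z)|) (1 - |φ(z)|²)^s)`. -/
def boundaryQuotient (μ : ℂ → ℝ) (phi : ℝ → ℝ) (vphi u : ℂ → ℂ) (s : ℝ) (z : ℂ) : ℝ :=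
  μ (‖z‖ : ℂ) * ‖u z‖ / (phi ‖vphi z‖ * (1 - ‖vphi z‖ ^ 2) ^ s)

lemma exists_le_of_limsupToBoundary_lt {vphi : ℂ → ℂ} {F : ℂ → ℝ} {α : ℝ} (hα : 0 ≤ α)
    (h : limsupToBoundary vphi F < ENNReal.ofReal α) :
    ∃ δ < 1, ∀ z ∈ ball (0 : ℂ) 1, ‖vphi z‖ < 1 → δ < ‖vphi z‖ → F z ≤ α := by
  have h1 := eventually_lt_of_limsup_lt h
  rw [eventually_inf_principal, eventually_comap] at h1
  obtain ⟨ε, hε, h2⟩ := Metric.eventually_nhds_iff.1 h1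
  refine ⟨1 - ε, by linarith, fun z hz hv1 hv2 => ?_⟩
  have h3 := h2 (y := ‖vphi z‖) (by rw [Real.dist_eq, abs_lt]; constructor <;> linarith) z rfl hz
  exact (ENNReal.ofReal_le_ofReal_iff hα).1 h3.le

section Operator

variable {p q : ℝ} {phi : ℝ → ℝ} {hp : 0 < p} {hq : 0 < q} {hphi : IsNormal phi} {μ : ℂ → ℝ}
  {vphi g : ℂ → ℂ}

/-- Pre-composition with the dilation `z ↦ r z`, as an operator on `H(p, q, φ)`. -/
def dilation (hp : 0 < p) (hq : 0 < q) (hphi : IsNormal phi) {r : ℝ} (hr0 : 0 ≤ r) (hr1 : r < 1) :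
    mixedNormSpace hp hq hphi →ₗ[ℂ] mixedNormSpace hp hq hphi where
  toFun f := ⟨(ball (0 : ℂ) 1).indicator fun z => (f : ℂ → ℂ) (r * z), by
    have hmem : ∀ z ∈ ball (0 : ℂ) 1, (r : ℂ) * z ∈ closedBall (0 : ℂ) r := fun z hz => by
      rw [mem_closedBall_zero_iff, norm_mul, Complex.norm_real, Real.norm_of_nonneg hr0]
      exact mul_le_of_le_one_right hr0 (mem_ball_zero_iff.1 hz).le
    obtain ⟨M, hM⟩ := (isCompact_closedBall (0 : ℂ) r).exists_bound_of_continuousOn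
      (f.2.1.1.continuousOn.mono (closedBall_subset_ball hr1))
    refine mem_mixedNormSpace_of_bounded hp hq hphi (indicator_mem_discHol ?_) (M := M)
      fun z hz => ?_
    · exact f.2.1.1.comp (by fun_prop) fun z hz => closedBall_subset_ball hr1 (hmem z hz)
    · rw [indicator_of_mem hz]
      exact hM _ (hmem z hz)⟩
  map_add' f h := by
    ext z
    by_cases hz : z ∈ ball (0 : ℂ) 1 <;> simp [hz]
  map_smul' c f := by
    ext z
    by_cases hz : z ∈ ball (0 : ℂ) 1 <;> simp [hz]

lemma deriv_dilation {r : ℝ} (hr0 : 0 ≤ r) (hr1 : r < 1) (f : mixedNormSpace hp hq hphi) {z : ℂ}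
    (hz : z ∈ ball (0 : ℂ) 1) :
    deriv (dilation hp hq hphi hr0 hr1 f : ℂ → ℂ) z = r * deriv (f : ℂ → ℂ) (r * z) ∧
      deriv (deriv (dilation hp hq hphi hr0 hr1 f : ℂ → ℂ)) z =
        r ^ 2 * deriv (deriv (f : ℂ → ℂ)) (r * z) := by
  have h1 : deriv (fun z => (f : ℂ → ℂ) (r * z)) = fun z => (r : ℂ) * deriv (f : ℂ → ℂ) (r * z) := by
    funext z
    exact deriv_comp_mul_left (r : ℂ) (f : ℂ → ℂ) z
  constructor
  · exact (deriv_indicator _ hz).trans (congrFun h1 z)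
  · refine (deriv_deriv_indicator _ hz).trans ?_
    rw [h1, deriv_const_mul_field, deriv_comp_mul_left (r : ℂ) (deriv (f : ℂ → ℂ)) z, smul_eq_mul]
    ring

variable {T : mixedNormSpace hp hq hphi →ₗ[ℂ] zygmundSpace μ}

lemma norm_mul_mem_of_dilation {r : ℝ} (hr0 : 0 ≤ r) {z : ℂ} (hz : z ∈ ball (0 : ℂ) 1) :
    ‖(r : ℂ) * z‖ = r * ‖z‖ ∧ r * ‖z‖ ≤ r := by
  rw [norm_mul, Complex.norm_real, Real.norm_of_nonneg hr0]
  exact ⟨rfl, mul_le_of_le_one_right hr0 (mem_ball_zero_iff.1 hz).le⟩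

/-- `C_φ^g` only sees the dilation of `f` on a compact disc, where bounded sequences have convergent
subsequences; hence the composition with a dilation is compact. -/
lemma IsIntegralOp.isCompactOp_comp_dilation (hT : IsIntegralOp vphi g T) (hb : IsBoundedOp T)
    {r : ℝ} (hr0 : 0 ≤ r) (hr1 : r < 1) :
    IsCompactOp (T ∘ₗ dilation hp hq hphi hr0 hr1) := by
  rintro f ⟨K, hK⟩
  obtain ⟨M, hM0, hM⟩ := hT.exists_bound hb
  obtain ⟨F, -, s, hs, hconv⟩ := exists_subseq_deriv_tendsto f K.coe_nonneg fun k => by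
    rw [ENNReal.ofReal_coe_nnreal]
    exact hK k
  refine ⟨T (dilation hp hq hphi hr0 hr1 F), s, hs, ?_⟩
  refine tendsto_zero_of_eventually_le (c := ‖g 0‖ + 2 * M) (by positivity) fun ε hε => ?_
  filter_upwards [hconv r hr1 ε hε] with k hk
  rw [LinearMap.comp_apply, ← map_sub, ← map_sub]
  set d := f (s k) - F
  have hd : ∀ z ∈ ball (0 : ℂ) 1, ‖deriv (dilation hp hq hphi hr0 hr1 d : ℂ → ℂ) z‖ ≤ ε ∧
      ‖deriv (deriv (dilation hp hq hphi hr0 hr1 d : ℂ → ℂ)) z‖ ≤ ε := by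
    intro z hz
    obtain ⟨h1, h2⟩ := deriv_dilation hr0 hr1 d hz
    obtain ⟨h3, h4⟩ := norm_mul_mem_of_dilation hr0 hz
    obtain ⟨h5, h6⟩ := hk (r * z) (h3.le.trans h4)
    rw [h1, h2, norm_mul, norm_mul, norm_pow, Complex.norm_real, Real.norm_of_nonneg hr0]
    exact ⟨(mul_le_of_le_one_left (norm_nonneg _) hr1.le).trans h5,
      (mul_le_of_le_one_left (norm_nonneg _) (pow_le_one₀ hr0 hr1.le)).trans h6⟩
  have h := hT.zygmundNorm_le (dilation hp hq hphi hr0 hr1 d) (E₀ := ε * ‖g 0‖) (E := 2 * (ε * M))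
    ?_ fun z hz => ?_
  · refine h.trans (ENNReal.ofReal_le_ofReal ?_)
    linarith
  · have := (hd _ (hT.mapsTo (mem_ball_self one_pos))).1
    gcongr
  · obtain ⟨h1, h2⟩ := hd _ (hT.mapsTo hz)
    obtain ⟨h3, h4⟩ := hM z hz
    have h5 := hT.weight.nonneg hz
    calc _ ≤ μ (‖z‖ : ℂ) * (ε * ‖deriv vphi z * g z‖ + ε * ‖deriv g z‖) := by gcongr
      _ = ε * (μ (‖z‖ : ℂ) * ‖deriv vphi z * g z‖) + ε * (μ (‖z‖ : ℂ) * ‖deriv g z‖) := by ring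
      _ ≤ ε * M + ε * M := by gcongr
      _ = _ := by ring

/-- The basic estimate: derivatives of `f` that are small on `|w| ≤ δ`, together with the growth of
`f` where `|φ(z)| > δ`, control `C_φ^g f`. -/
lemma IsIntegralOp.zygmundNorm_le_of_split (hT : IsIntegralOp vphi g T)
    (f : mixedNormSpace hp hq hphi) {δ η N M α β : ℝ} (hη : 0 ≤ η) (hM0 : 0 ≤ M)
    (hα : 0 ≤ α) (hβ : 0 ≤ β)
    (hM : ∀ z ∈ ball (0 : ℂ) 1, μ (‖z‖ : ℂ) * ‖deriv vphi z * g z‖ ≤ M ∧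
      μ (‖z‖ : ℂ) * ‖deriv g z‖ ≤ M)
    (h0 : ‖vphi 0‖ ≤ δ)
    (hsmall : ∀ w ∈ ball (0 : ℂ) 1, ‖w‖ ≤ δ →
      ‖deriv (f : ℂ → ℂ) w‖ ≤ η ∧ ‖deriv (deriv (f : ℂ → ℂ)) w‖ ≤ η)
    (hN : ∀ w ∈ ball (0 : ℂ) 1,
      ‖deriv (f : ℂ → ℂ) w‖ * (phi ‖w‖ * (1 - ‖w‖ ^ 2) ^ (1 / q + 1)) ≤ N ∧
      ‖deriv (deriv (f : ℂ → ℂ)) w‖ * (phi ‖w‖ * (1 - ‖w‖ ^ 2) ^ (1 / q + 2)) ≤ N)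
    (hA : ∀ z ∈ ball (0 : ℂ) 1, δ < ‖vphi z‖ →
      boundaryQuotient μ phi vphi (fun z => deriv vphi z * g z) (1 / q + 2) z ≤ α)
    (hB : ∀ z ∈ ball (0 : ℂ) 1, δ < ‖vphi z‖ →
      boundaryQuotient μ phi vphi (deriv g) (1 / q + 1) z ≤ β) :
    zygmundNorm μ (T f) ≤ ENNReal.ofReal (η * (‖g 0‖ + 2 * M) + N * (α + β)) := by
  have hb0 : (0 : ℂ) ∈ ball (0 : ℂ) 1 := mem_ball_self one_pos
  have hN0 : 0 ≤ N := by
    have h := (hN 0 hb0).1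
    have := hphi.pos 0 (by simp)
    simp only [norm_zero] at h
    refine le_trans ?_ h
    positivity
  have h := hT.zygmundNorm_le f (E₀ := η * ‖g 0‖) (E := 2 * (η * M) + N * (α + β)) ?_ fun z hz => ?_
  · refine h.trans (ENNReal.ofReal_le_ofReal ?_)
    linarith
  · have := (hsmall _ (hT.mapsTo hb0) h0).1
    gcongr
  · have h5 := hT.weight.nonneg hz
    obtain ⟨h3, h4⟩ := hM z hz
    rcases le_or_gt ‖vphi z‖ δ with hzδ | hzδ
    · obtain ⟨h1, h2⟩ := hsmall _ (hT.mapsTo hz) hzδ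
      calc _ ≤ μ (‖z‖ : ℂ) * (η * ‖deriv vphi z * g z‖ + η * ‖deriv g z‖) := by gcongr
        _ = η * (μ (‖z‖ : ℂ) * ‖deriv vphi z * g z‖) + η * (μ (‖z‖ : ℂ) * ‖deriv g z‖) := by ring
        _ ≤ η * M + η * M := by gcongr
        _ ≤ _ := by nlinarith [mul_nonneg hN0 (add_nonneg hα hβ)]
    · obtain ⟨h1, h2⟩ := hN _ (hT.mapsTo hz)
      have h6 := hA z hz hzδ
      have h7 := hB z hz hzδ
      have hv := mem_ball_zero_iff.1 (hT.mapsTo hz)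
      have hphiv := hphi.pos ‖vphi z‖ ⟨norm_nonneg _, hv⟩
      have hD : 0 < 1 - ‖vphi z‖ ^ 2 := by nlinarith [norm_nonneg (vphi z)]
      have hW1 : 0 < phi ‖vphi z‖ * (1 - ‖vphi z‖ ^ 2) ^ (1 / q + 1) := by positivity
      have hW2 : 0 < phi ‖vphi z‖ * (1 - ‖vphi z‖ ^ 2) ^ (1 / q + 2) := by positivity
      rw [boundaryQuotient, div_le_iff₀ hW2] at h6
      rw [boundaryQuotient, div_le_iff₀ hW1] at h7
      have h8 : ‖deriv (deriv (f : ℂ → ℂ)) (vphi z)‖ * (μ (‖z‖ : ℂ) * ‖deriv vphi z * g z‖) ≤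
          N * α := by
        calc _ ≤ ‖deriv (deriv (f : ℂ → ℂ)) (vphi z)‖ *
              (α * (phi ‖vphi z‖ * (1 - ‖vphi z‖ ^ 2) ^ (1 / q + 2))) := by gcongr
          _ = (‖deriv (deriv (f : ℂ → ℂ)) (vphi z)‖ *
              (phi ‖vphi z‖ * (1 - ‖vphi z‖ ^ 2) ^ (1 / q + 2))) * α := by ring
          _ ≤ _ := by gcongr
      have h9 : ‖deriv (f : ℂ → ℂ) (vphi z)‖ * (μ (‖z‖ : ℂ) * ‖deriv g z‖) ≤ N * β := by
        calc _ ≤ ‖deriv (f : ℂ → ℂ) (vphi z)‖ *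
              (β * (phi ‖vphi z‖ * (1 - ‖vphi z‖ ^ 2) ^ (1 / q + 1))) := by gcongr
          _ = (‖deriv (f : ℂ → ℂ) (vphi z)‖ *
              (phi ‖vphi z‖ * (1 - ‖vphi z‖ ^ 2) ^ (1 / q + 1))) * β := by ring
          _ ≤ _ := by gcongr
      have h10 : 0 ≤ η * M := by positivity
      calc _ = ‖deriv (deriv (f : ℂ → ℂ)) (vphi z)‖ * (μ (‖z‖ : ℂ) * ‖deriv vphi z * g z‖) +
            ‖deriv (f : ℂ → ℂ) (vphi z)‖ * (μ (‖z‖ : ℂ) * ‖deriv g z‖) := by ring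
        _ ≤ N * α + N * β := add_le_add h8 h9
        _ ≤ _ := by linarith

/-- A radius beyond which both quotients are almost bounded by their upper limits. -/
lemma IsIntegralOp.exists_radius (hT : IsIntegralOp vphi g T) {α β : ℝ} (hα : 0 ≤ α) (hβ : 0 ≤ β)
    (hA : limsupToBoundary vphi (boundaryQuotient μ phi vphi (fun z => deriv vphi z * g z)
      (1 / q + 2)) < ENNReal.ofReal α)
    (hB : limsupToBoundary vphi (boundaryQuotient μ phi vphi (deriv g) (1 / q + 1)) <
      ENNReal.ofReal β) :
    ∃ δ < 1, 0 ≤ δ ∧ ‖vphi 0‖ ≤ δ ∧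
      (∀ z ∈ ball (0 : ℂ) 1, δ < ‖vphi z‖ →
        boundaryQuotient μ phi vphi (fun z => deriv vphi z * g z) (1 / q + 2) z ≤ α) ∧
      ∀ z ∈ ball (0 : ℂ) 1, δ < ‖vphi z‖ →
        boundaryQuotient μ phi vphi (deriv g) (1 / q + 1) z ≤ β := by
  obtain ⟨δ₁, h₁, h₁'⟩ := exists_le_of_limsupToBoundary_lt hα hA
  obtain ⟨δ₂, h₂, h₂'⟩ := exists_le_of_limsupToBoundary_lt hβ hB
  have h0 := mem_ball_zero_iff.1 (hT.mapsTo (mem_ball_self one_pos))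
  refine ⟨max (max δ₁ δ₂) ‖vphi 0‖, max_lt (max_lt h₁ h₂) h0,
    (norm_nonneg _).trans (le_max_right _ _), le_max_right _ _, fun z hz hz' => ?_,
    fun z hz hz' => ?_⟩
  · exact h₁' z hz (mem_ball_zero_iff.1 (hT.mapsTo hz))
      (((le_max_left _ _).trans (le_max_left _ _)).trans_lt hz')
  · exact h₂' z hz (mem_ball_zero_iff.1 (hT.mapsTo hz))
      (((le_max_right _ _).trans (le_max_left _ _)).trans_lt hz')

lemma IsIntegralOp.isCompactOp_of_limsup_eq_zero (hT : IsIntegralOp vphi g T) (hb : IsBoundedOp T)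
    (hA : limsupToBoundary vphi (boundaryQuotient μ phi vphi (fun z => deriv vphi z * g z)
      (1 / q + 2)) = 0)
    (hB : limsupToBoundary vphi (boundaryQuotient μ phi vphi (deriv g) (1 / q + 1)) = 0) :
    IsCompactOp T := by
  rintro f ⟨K, hK⟩
  obtain ⟨C, hC, hgrow⟩ := exists_deriv_growth hp hq hphi
  obtain ⟨M, hM0, hM⟩ := hT.exists_bound hb
  have hK' : ∀ k, mixedNorm p q phi (f k) ≤ ENNReal.ofReal K := fun k => by
    rw [ENNReal.ofReal_coe_nnreal]
    exact hK k
  have hK0 : (0 : ℝ) ≤ K := K.coe_nonneg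
  obtain ⟨F, hF, s, hs, hconv⟩ := exists_subseq_deriv_tendsto f hK0 hK'
  refine ⟨T F, s, hs, ?_⟩
  refine tendsto_zero_of_eventually_le (c := ‖g 0‖ + 2 * M + 2 * (C * K) * 2) (by positivity)
    fun ε hε => ?_
  have hε' : (0 : ℝ≥0∞) < ENNReal.ofReal ε := ENNReal.ofReal_pos.2 hε
  obtain ⟨δ, hδ1, hδ0, h0, hA', hB'⟩ := hT.exists_radius hε.le hε.le (hA.trans_lt hε')
    (hB.trans_lt hε')
  filter_upwards [hconv δ hδ1 ε hε] with k hk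
  rw [← map_sub]
  refine (hT.zygmundNorm_le_of_split (f (s k) - F) hε.le hM0 hε.le hε.le hM h0
    (fun w _ hw => hk w hw) (N := 2 * (C * K)) (fun w hw => ?_) hA' hB').trans
    (ENNReal.ofReal_le_ofReal (by linarith))
  obtain ⟨h1, h2⟩ := hgrow _ (f (s k)).2.1 K hK0 (hK' (s k)) w hw
  obtain ⟨h3, h4⟩ := hgrow _ F.2.1 K hK0 hF w hw
  obtain ⟨h5, h6⟩ := deriv_sub_apply (f (s k)).2.1 F.2.1 hw
  have hw1 := mem_ball_zero_iff.1 hw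
  have hphiw := hphi.pos ‖w‖ ⟨norm_nonneg _, hw1⟩
  have hD : 0 < 1 - ‖w‖ ^ 2 := by nlinarith [norm_nonneg w]
  constructor
  · calc _ ≤ (‖deriv (f (s k) : ℂ → ℂ) w‖ + ‖deriv (F : ℂ → ℂ) w‖) *
          (phi ‖w‖ * (1 - ‖w‖ ^ 2) ^ (1 / q + 1)) := by
          gcongr
          exact (congrArg norm h5).trans_le (norm_sub_le _ _)
      _ ≤ _ := by rw [add_mul]; linarith
  · calc _ ≤ (‖deriv (deriv (f (s k) : ℂ → ℂ)) w‖ + ‖deriv (deriv (F : ℂ → ℂ)) w‖) *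
          (phi ‖w‖ * (1 - ‖w‖ ^ 2) ^ (1 / q + 2)) := by
          gcongr
          exact (congrArg norm h6).trans_le (norm_sub_le _ _)
      _ ≤ _ := by rw [add_mul]; linarith

/-- On a compact disc `f` and its dilation are uniformly close for `f` in the unit ball. -/
lemma exists_dilation_close (hp : 0 < p) (hq : 0 < q) (hphi : IsNormal phi) {δ ε : ℝ}
    (hδ : δ < 1) (hε : 0 < ε) :
    ∃ (r : ℝ) (hr0 : 0 ≤ r) (hr1 : r < 1), ∀ f : mixedNormSpace hp hq hphi,
      mixedNorm p q phi f ≤ 1 → ∀ w, ‖w‖ ≤ δ →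
        ‖deriv ((f - dilation hp hq hphi hr0 hr1 f : mixedNormSpace hp hq hphi) : ℂ → ℂ) w‖ ≤ ε ∧
        ‖deriv (deriv ((f - dilation hp hq hphi hr0 hr1 f : mixedNormSpace hp hq hphi) : ℂ → ℂ)) w‖ ≤ ε := by
  set δ₁ := (1 + δ) / 2 with hδ₁
  set δ₂ := (1 + δ₁) / 2 with hδ₂
  have h1 : δ < δ₁ := by linarith
  have h2 : δ₁ < δ₂ := by linarith
  have h3 : δ₂ < 1 := by linarith
  obtain ⟨M, hM0, hM⟩ := exists_bound_closedBall hp hq hphi h3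
  set L := M / (δ₂ - δ₁) with hL
  have hL0 : 0 ≤ L := div_nonneg hM0 (by linarith)
  set c := L / (δ₁ - δ) + 2 * L / (δ₁ - δ) ^ 2 with hc
  have h4 : 0 < δ₁ - δ := by linarith
  have hc1 : 0 ≤ L / (δ₁ - δ) := by positivity
  have hc2 : 0 ≤ 2 * L / (δ₁ - δ) ^ 2 := by positivity
  have hc0 : 0 ≤ c := by positivity
  -- The dilation factor is `1 - t`, and `c t` bounds the two derivatives of the difference.
  set t := ε / (ε + c) with ht
  have ht0 : 0 < t := by positivity
  have ht1 : t ≤ 1 := by rw [ht, div_le_one (by positivity)]; linarith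
  have htc : c * t ≤ ε := by
    rw [ht, mul_div_assoc', div_le_iff₀ (by positivity)]
    nlinarith
  have hr0 : 0 ≤ 1 - t := by linarith
  have hr1 : 1 - t < 1 := by linarith
  refine ⟨1 - t, hr0, hr1, fun f hf w hw => ?_⟩
  have hf' : mixedNorm p q phi f ≤ ENNReal.ofReal 1 := by simpa using hf
  have hder : ∀ z ∈ closedBall (0 : ℂ) δ₁, ‖deriv (f : ℂ → ℂ) z‖ ≤ L := fun z hz => by
    have := (norm_deriv_le_of_closedBall f.2.1.1 h2 h3 (M := M)
      (fun w hw => by simpa using hM f f.2.1 1 zero_le_one hf' w hw)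
      (mem_closedBall_zero_iff.1 hz)).1
    exact this
  have hclose : ∀ z, ‖z‖ ≤ δ₁ →
      ‖((f - dilation hp hq hphi hr0 hr1 f : mixedNormSpace hp hq hphi) : ℂ → ℂ) z‖ ≤ L * t := by
    intro z hz
    have hz1 : ‖z‖ < 1 := by linarith
    have hzb : z ∈ ball (0 : ℂ) 1 := mem_ball_zero_iff.2 hz1
    obtain ⟨h5, -⟩ := norm_mul_mem_of_dilation hr0 hzb
    have h6 : ‖((1 - t : ℝ) : ℂ) * z‖ ≤ δ₁ := by
      rw [h5]
      nlinarith [norm_nonneg z]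
    have h7 := (convex_closedBall (0 : ℂ) δ₁).norm_image_sub_le_of_norm_deriv_le (𝕜 := ℂ)
      (fun x hx => f.2.1.1.differentiableAt (isOpen_ball.mem_nhds
        (closedBall_subset_ball (by linarith) hx))) hder (mem_closedBall_zero_iff.2 h6)
      (mem_closedBall_zero_iff.2 hz)
    have h8 : ((f - dilation hp hq hphi hr0 hr1 f : mixedNormSpace hp hq hphi) : ℂ → ℂ) z =
        (f : ℂ → ℂ) z - (f : ℂ → ℂ) (((1 - t : ℝ) : ℂ) * z) := by
      change (f : ℂ → ℂ) z - (ball (0 : ℂ) 1).indicator _ z = _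
      rw [indicator_of_mem hzb]
    rw [h8]
    refine h7.trans ?_
    have h9 : z - ((1 - t : ℝ) : ℂ) * z = (t : ℂ) * z := by push_cast; ring
    rw [h9, norm_mul, Complex.norm_real, Real.norm_of_nonneg ht0.le]
    gcongr
    exact mul_le_of_le_one_right ht0.le hz1.le
  obtain ⟨h10, h11⟩ := norm_deriv_le_of_closedBall
    (f - dilation hp hq hphi hr0 hr1 f).2.1.1 h1 (by linarith) hclose hw
  refine ⟨h10.trans (le_trans ?_ htc), h11.trans (le_trans ?_ htc)⟩
  · rw [mul_div_right_comm]
    gcongr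
    linarith
  · rw [← mul_assoc, mul_div_right_comm]
    gcongr
    linarith

lemma norm_dilation_mul_le {r : ℝ} (hr0 : 0 ≤ r) (hr1 : r < 1) {N : ℝ}
    (f : mixedNormSpace hp hq hphi)
    (hN : ∀ w ∈ ball (0 : ℂ) 1,
      ‖deriv (f : ℂ → ℂ) w‖ * (phi ‖w‖ * (1 - ‖w‖ ^ 2) ^ (1 / q + 1)) ≤ N ∧
      ‖deriv (deriv (f : ℂ → ℂ)) w‖ * (phi ‖w‖ * (1 - ‖w‖ ^ 2) ^ (1 / q + 2)) ≤ N)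
    {w : ℂ} (hw : w ∈ ball (0 : ℂ) 1) :
    ‖deriv (dilation hp hq hphi hr0 hr1 f : ℂ → ℂ) w‖ *
        (phi ‖w‖ * (1 - ‖w‖ ^ 2) ^ (1 / q + 1)) ≤ N ∧
      ‖deriv (deriv (dilation hp hq hphi hr0 hr1 f : ℂ → ℂ)) w‖ *
        (phi ‖w‖ * (1 - ‖w‖ ^ 2) ^ (1 / q + 2)) ≤ N := by
  obtain ⟨h1, h2⟩ := deriv_dilation hr0 hr1 f hw
  obtain ⟨h3, h4⟩ := norm_mul_mem_of_dilation hr0 hw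
  have hw1 := mem_ball_zero_iff.1 hw
  have hrw : (r : ℂ) * w ∈ ball (0 : ℂ) 1 := by
    rw [mem_ball_zero_iff, h3]
    linarith
  obtain ⟨h5, h6⟩ := hN _ hrw
  have h7 : r * ‖w‖ ≤ ‖w‖ := mul_le_of_le_one_left (norm_nonneg _) hr1.le
  have hW : ∀ s : ℝ, 0 ≤ s → phi ‖w‖ * (1 - ‖w‖ ^ 2) ^ s ≤
      phi ‖(r : ℂ) * w‖ * (1 - ‖(r : ℂ) * w‖ ^ 2) ^ s := fun s hs => by
    rw [h3]
    exact hphi.mul_rpow_le hs (by positivity) h7 hw1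
  have hW0 : ∀ s : ℝ, 0 ≤ phi ‖w‖ * (1 - ‖w‖ ^ 2) ^ s := fun s => by
    have hphiw := hphi.pos ‖w‖ ⟨norm_nonneg _, hw1⟩
    have hD : 0 < 1 - ‖w‖ ^ 2 := by nlinarith [norm_nonneg w]
    positivity
  rw [h1, h2, norm_mul, norm_mul, norm_pow, Complex.norm_real, Real.norm_of_nonneg hr0]
  constructor
  · refine le_trans (mul_le_mul (mul_le_of_le_one_left (norm_nonneg _) hr1.le)
      (hW _ (by positivity)) (hW0 _) (norm_nonneg _)) h5
  · refine le_trans (mul_le_mul (mul_le_of_le_one_left (norm_nonneg _) (pow_le_one₀ hr0 hr1.le))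
      (hW _ (by positivity)) (hW0 _) (norm_nonneg _)) h6

/-- The upper estimate: the compact operators `f ↦ C_φ^g f_r`, where `f_r` is the dilation of `f`,
approximate `C_φ^g` as well as the two upper limits allow. -/
lemma exists_essNorm_le (hp : 0 < p) (hq : 0 < q) (hphi : IsNormal phi) :
    ∃ C : ℝ, 0 < C ∧ ∀ (μ : ℂ → ℝ) (vphi g : ℂ → ℂ)
      (T : mixedNormSpace hp hq hphi →ₗ[ℂ] zygmundSpace μ), IsIntegralOp vphi g T →
      IsBoundedOp T → ∀ a b : ℝ, 0 ≤ a → 0 ≤ b →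
      limsupToBoundary vphi (boundaryQuotient μ phi vphi (fun z => deriv vphi z * g z)
        (1 / q + 2)) ≤ ENNReal.ofReal a →
      limsupToBoundary vphi (boundaryQuotient μ phi vphi (deriv g) (1 / q + 1)) ≤
        ENNReal.ofReal b →
      essNorm T ≤ ENNReal.ofReal (C * (a + b)) := by
  obtain ⟨C, hC, hgrow⟩ := exists_deriv_growth hp hq hphi
  refine ⟨2 * C, by positivity, fun μ vphi g T hT hb a b ha hb0 hA hB => ?_⟩
  obtain ⟨M, hM0, hM⟩ := hT.exists_bound hb
  have key : ∀ ε > 0, essNorm T ≤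
      ENNReal.ofReal (ε * (‖g 0‖ + 2 * M) + 2 * C * ((a + ε) + (b + ε))) := by
    intro ε hε
    obtain ⟨δ, hδ1, hδ0, h0, hA', hB'⟩ := hT.exists_radius (α := a + ε) (β := b + ε) (by positivity)
      (by positivity)
      (hA.trans_lt ((ENNReal.ofReal_lt_ofReal_iff (by positivity)).2 (by linarith)))
      (hB.trans_lt ((ENNReal.ofReal_lt_ofReal_iff (by positivity)).2 (by linarith)))
    obtain ⟨r, hr0, hr1, hclose⟩ := exists_dilation_close hp hq hphi hδ1 hε
    refine (iInf₂_le (T ∘ₗ dilation hp hq hphi hr0 hr1)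
      (hT.isCompactOp_comp_dilation hb hr0 hr1)).trans (iSup₂_le fun f hf => ?_)
    have hf' : mixedNorm p q phi f ≤ ENNReal.ofReal 1 := by simpa using hf
    rw [LinearMap.sub_apply, LinearMap.comp_apply, ← map_sub]
    refine hT.zygmundNorm_le_of_split _ hε.le hM0 (by positivity) (by positivity) hM h0
      (fun w _ hw => hclose f hf w hw) (fun w hw => ?_) hA' hB'
    have hN : ∀ w ∈ ball (0 : ℂ) 1,
      ‖deriv (f : ℂ → ℂ) w‖ * (phi ‖w‖ * (1 - ‖w‖ ^ 2) ^ (1 / q + 1)) ≤ C ∧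
      ‖deriv (deriv (f : ℂ → ℂ)) w‖ * (phi ‖w‖ * (1 - ‖w‖ ^ 2) ^ (1 / q + 2)) ≤ C :=
      fun w hw => by simpa using hgrow f f.2.1 1 zero_le_one hf' w hw
    obtain ⟨h1, h2⟩ := hN w hw
    obtain ⟨h3, h4⟩ := norm_dilation_mul_le hr0 hr1 f hN hw
    obtain ⟨h5, h6⟩ := deriv_sub_apply f.2.1 (dilation hp hq hphi hr0 hr1 f).2.1 hw
    have hw1 := mem_ball_zero_iff.1 hw
    have hphiw := hphi.pos ‖w‖ ⟨norm_nonneg _, hw1⟩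
    have hD : 0 < 1 - ‖w‖ ^ 2 := by nlinarith [norm_nonneg w]
    constructor
    · calc _ ≤ (‖deriv (f : ℂ → ℂ) w‖ + ‖deriv (dilation hp hq hphi hr0 hr1 f : ℂ → ℂ) w‖) *
            (phi ‖w‖ * (1 - ‖w‖ ^ 2) ^ (1 / q + 1)) := by
            gcongr
            exact (congrArg norm h5).trans_le (norm_sub_le _ _)
        _ ≤ _ := by rw [add_mul]; linarith
    · calc _ ≤ (‖deriv (deriv (f : ℂ → ℂ)) w‖ +
            ‖deriv (deriv (dilation hp hq hphi hr0 hr1 f : ℂ → ℂ)) w‖) *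
            (phi ‖w‖ * (1 - ‖w‖ ^ 2) ^ (1 / q + 2)) := by
            gcongr
            exact (congrArg norm h6).trans_le (norm_sub_le _ _)
        _ ≤ _ := by rw [add_mul]; linarith
  have hlim : Tendsto (fun ε : ℝ => ENNReal.ofReal
      (ε * (‖g 0‖ + 2 * M) + 2 * C * ((a + ε) + (b + ε)))) (𝓝[>] 0)
      (𝓝 (ENNReal.ofReal (2 * C * (a + b)))) := by
    refine Tendsto.mono_left ?_ nhdsWithin_le_nhds
    refine ENNReal.tendsto_ofReal ?_
    have : Continuous fun ε : ℝ => ε * (‖g 0‖ + 2 * M) + 2 * C * ((a + ε) + (b + ε)) := by fun_prop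
    simpa using this.tendsto 0
  refine ge_of_tendsto hlim ?_
  filter_upwards [self_mem_nhdsWithin] with ε hε using key ε hε

end Operator

/-! ### Test functions -/

/-- The kernel `(1 - |a|²) / (1 - ā z)`, which equals `1` at `z = a`. -/
def diskKernel (a z : ℂ) : ℂ := ((1 - ‖a‖ ^ 2 : ℝ) : ℂ) / (1 - (starRingEnd ℂ) a * z)

/-- The test function attached to `a ∈ 𝔻`: a combination of two consecutive powers of the kernel
`(1 - |a|²) / (1 - ā z)`, divided by `φ(|a|) (1 - |a|²)^{1/q}` and extended by zero. -/
def testFunction (q : ℝ) (phi : ℝ → ℝ) (n : ℕ) (α β a : ℂ) : ℂ → ℂ :=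
  (ball (0 : ℂ) 1).indicator fun z => (((phi ‖a‖ * (1 - ‖a‖ ^ 2) ^ (1 / q))⁻¹ : ℝ) : ℂ) *
    (α * diskKernel a z ^ (n + 1) + β * diskKernel a z ^ (n + 2))

lemma one_sub_conj_mul_ne_zero {a z : ℂ} (ha : a ∈ ball (0 : ℂ) 1) (hz : z ∈ ball (0 : ℂ) 1) :
    1 - (starRingEnd ℂ) a * z ≠ 0 := by
  rw [mem_ball_zero_iff] at ha hz
  intro h
  have h1 : ‖(starRingEnd ℂ) a * z‖ = 1 := by
    rw [← sub_eq_zero.1 h, norm_one]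
  rw [norm_mul, RCLike.norm_conj] at h1
  nlinarith [norm_nonneg a, norm_nonneg z]

lemma one_sub_sq_pos {a : ℂ} (ha : a ∈ ball (0 : ℂ) 1) : 0 < 1 - ‖a‖ ^ 2 := by
  rw [mem_ball_zero_iff] at ha
  nlinarith [norm_nonneg a]

lemma diskKernel_self {a : ℂ} (ha : a ∈ ball (0 : ℂ) 1) : diskKernel a a = 1 := by
  have h : ((1 - ‖a‖ ^ 2 : ℝ) : ℂ) = 1 - (starRingEnd ℂ) a * a := by
    rw [← Complex.normSq_eq_conj_mul_self, Complex.normSq_eq_norm_sq]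
    push_cast
    ring
  rw [diskKernel, h, div_self (one_sub_conj_mul_ne_zero ha ha)]

lemma le_norm_one_sub_conj_mul (a z : ℂ) : 1 - ‖a‖ * ‖z‖ ≤ ‖1 - (starRingEnd ℂ) a * z‖ := by
  have := norm_sub_norm_le 1 ((starRingEnd ℂ) a * z)
  rwa [norm_one, norm_mul, RCLike.norm_conj] at this

lemma norm_diskKernel_le {a z : ℂ} (ha : a ∈ ball (0 : ℂ) 1) (hz : z ∈ ball (0 : ℂ) 1) :
    ‖diskKernel a z‖ ≤ 2 := by
  have h1 := le_norm_one_sub_conj_mul a z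
  have h2 := one_sub_sq_pos ha
  have h3 := norm_pos_iff.2 (one_sub_conj_mul_ne_zero ha hz)
  rw [mem_ball_zero_iff] at ha hz
  rw [diskKernel, norm_div, Complex.norm_real, Real.norm_of_nonneg h2.le, div_le_iff₀ h3]
  nlinarith [norm_nonneg a, norm_nonneg z]

lemma hasDerivAt_diskKernel_pow {a z : ℂ} (ha : a ∈ ball (0 : ℂ) 1) (hz : z ∈ ball (0 : ℂ) 1)
    (n : ℕ) :
    HasDerivAt (fun z => diskKernel a z ^ (n + 1))
      ((starRingEnd ℂ) a / ((1 - ‖a‖ ^ 2 : ℝ) : ℂ) * ((n + 1) * diskKernel a z ^ (n + 2))) z := by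
  have h1 := one_sub_conj_mul_ne_zero ha hz
  have h2 : ((1 - ‖a‖ ^ 2 : ℝ) : ℂ) ≠ 0 := by exact_mod_cast (one_sub_sq_pos ha).ne'
  have h3 : HasDerivAt (fun z => 1 - (starRingEnd ℂ) a * z) (-(starRingEnd ℂ) a) z := by
    simpa using ((hasDerivAt_id z).const_mul ((starRingEnd ℂ) a)).const_sub 1
  have h4 : HasDerivAt (diskKernel a)
      ((starRingEnd ℂ) a / ((1 - ‖a‖ ^ 2 : ℝ) : ℂ) * diskKernel a z ^ 2) z := by
    have := (h3.inv h1).const_mul ((1 - ‖a‖ ^ 2 : ℝ) : ℂ)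
    refine (this.congr_deriv ?_).congr_of_eventuallyEq
      (Eventually.of_forall fun w => by simp [diskKernel, div_eq_mul_inv])
    rw [diskKernel]
    field_simp
  refine (h4.pow (n + 1)).congr_deriv ?_
  rw [Nat.add_sub_cancel]
  push_cast
  ring

section TestFunction

variable {p q : ℝ} {phi : ℝ → ℝ}

lemma hasDerivAt_diskKernel_combination {a z : ℂ} (ha : a ∈ ball (0 : ℂ) 1)
    (hz : z ∈ ball (0 : ℂ) 1) (n : ℕ) (κ α β : ℂ) :
    HasDerivAt (fun z => κ * (α * diskKernel a z ^ (n + 1) + β * diskKernel a z ^ (n + 2)))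
      (κ * ((starRingEnd ℂ) a / ((1 - ‖a‖ ^ 2 : ℝ) : ℂ)) *
        ((α * (n + 1)) * diskKernel a z ^ (n + 2) + (β * (n + 2)) * diskKernel a z ^ (n + 3))) z := by
  have h1 := (hasDerivAt_diskKernel_pow ha hz n).const_mul α
  have h2 := (hasDerivAt_diskKernel_pow ha hz (n + 1)).const_mul β
  refine ((h1.add h2).const_mul κ).congr_deriv ?_
  push_cast
  ring

lemma testFunction_mem_discHol (n : ℕ) (α β : ℂ) {a : ℂ} (ha : a ∈ ball (0 : ℂ) 1) :
    testFunction q phi n α β a ∈ discHol :=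
  indicator_mem_discHol fun _ hz =>
    (hasDerivAt_diskKernel_combination ha hz n _ α β).differentiableAt.differentiableWithinAt

lemma deriv_testFunction (n : ℕ) (α β : ℂ) {a z : ℂ} (ha : a ∈ ball (0 : ℂ) 1)
    (hz : z ∈ ball (0 : ℂ) 1) :
    deriv (testFunction q phi n α β a) z =
      (((phi ‖a‖ * (1 - ‖a‖ ^ 2) ^ (1 / q))⁻¹ : ℝ) : ℂ) *
        ((starRingEnd ℂ) a / ((1 - ‖a‖ ^ 2 : ℝ) : ℂ)) *
        ((α * (n + 1)) * diskKernel a z ^ (n + 2) + (β * (n + 2)) * diskKernel a z ^ (n + 3)) :=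
  (deriv_indicator _ hz).trans (hasDerivAt_diskKernel_combination ha hz n _ α β).deriv

lemma deriv_deriv_testFunction (n : ℕ) (α β : ℂ) {a z : ℂ} (ha : a ∈ ball (0 : ℂ) 1)
    (hz : z ∈ ball (0 : ℂ) 1) :
    deriv (deriv (testFunction q phi n α β a)) z =
      (((phi ‖a‖ * (1 - ‖a‖ ^ 2) ^ (1 / q))⁻¹ : ℝ) : ℂ) *
        ((starRingEnd ℂ) a / ((1 - ‖a‖ ^ 2 : ℝ) : ℂ)) *
        ((starRingEnd ℂ) a / ((1 - ‖a‖ ^ 2 : ℝ) : ℂ)) *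
        ((α * (n + 1) * (n + 2)) * diskKernel a z ^ (n + 3) +
          (β * (n + 2) * (n + 3)) * diskKernel a z ^ (n + 4)) := by
  have h : deriv (testFunction q phi n α β a) =ᶠ[𝓝 z] _ :=
    Filter.eventuallyEq_of_mem (isOpen_ball.mem_nhds hz) fun w hw =>
      deriv_testFunction n α β ha hw
  rw [h.deriv_eq]
  refine (hasDerivAt_diskKernel_combination ha hz (n + 1) _ _ _).deriv.trans ?_
  push_cast
  ring

lemma exists_deriv_testFunction_le (n : ℕ) (α β : ℂ) {a : ℂ} (ha : a ∈ ball (0 : ℂ) 1) :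
    ∃ M : ℝ, 0 ≤ M ∧ ∀ z ∈ ball (0 : ℂ) 1, ‖deriv (testFunction q phi n α β a) z‖ ≤ M ∧
      ‖deriv (deriv (testFunction q phi n α β a)) z‖ ≤ M := by
  have hk : ∀ (u v w : ℂ) (i j : ℕ), ∀ z ∈ ball (0 : ℂ) 1,
      ‖u * (v * diskKernel a z ^ i + w * diskKernel a z ^ j)‖ ≤
        ‖u‖ * (‖v‖ * 2 ^ i + ‖w‖ * 2 ^ j) := fun u v w i j z hz => by
    have h := norm_diskKernel_le ha hz
    rw [norm_mul]
    gcongr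
    refine (norm_add_le _ _).trans ?_
    rw [norm_mul, norm_mul, norm_pow, norm_pow]
    gcongr
  obtain ⟨M₁, h₁⟩ : ∃ M : ℝ, ∀ z ∈ ball (0 : ℂ) 1, ‖deriv (testFunction q phi n α β a) z‖ ≤ M :=
    ⟨_, fun z hz => by
      rw [deriv_testFunction n α β ha hz]
      exact hk _ _ _ _ _ z hz⟩
  obtain ⟨M₂, h₂⟩ : ∃ M : ℝ, ∀ z ∈ ball (0 : ℂ) 1,
      ‖deriv (deriv (testFunction q phi n α β a)) z‖ ≤ M :=
    ⟨_, fun z hz => by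
      rw [deriv_deriv_testFunction n α β ha hz]
      exact hk _ _ _ _ _ z hz⟩
  have h0 := (norm_nonneg _).trans (h₁ 0 (mem_ball_self one_pos))
  exact ⟨max M₁ M₂, le_max_of_le_left h0, fun z hz =>
    ⟨(h₁ z hz).trans (le_max_left _ _), (h₂ z hz).trans (le_max_right _ _)⟩⟩

/-- On `|z| = r` the function `|1 - ā z|⁻²` is a multiple of the Poisson kernel at the point
`r² a`, whose circle average is `1`. -/
lemma circleAverage_inv_norm_sq {a : ℂ} (ha : a ∈ ball (0 : ℂ) 1) {r : ℝ} (hr : r ∈ Ioo (0 : ℝ) 1) :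
    Real.circleAverage (fun z => (‖1 - (starRingEnd ℂ) a * z‖ ^ 2)⁻¹) 0 r =
      (1 - r ^ 2 * ‖a‖ ^ 2)⁻¹ := by
  have hr0 := hr.1
  have hr1 := hr.2
  have ha1 := mem_ball_zero_iff.1 ha
  set w : ℂ := (r : ℂ) ^ 2 * a with hw
  have hwn : ‖w‖ = r ^ 2 * ‖a‖ := by
    rw [hw, norm_mul, norm_pow, Complex.norm_real, Real.norm_of_nonneg hr0.le]
  have hwr : ‖w‖ < r := by rw [hwn]; nlinarith [norm_nonneg a]
  have h1 : r ^ 2 * ‖a‖ ^ 2 < 1 := by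
    have : r * ‖a‖ < 1 := by nlinarith [norm_nonneg a]
    nlinarith [mul_nonneg hr0.le (norm_nonneg a)]
  have h := (diffContOnCl_const (c := (1 : ℝ → ℂ) 0) (s := ball (0 : ℂ) r) (𝕜 := ℂ)
    (E := ℂ)).circleAverage_poissonKernel_smul' (w := w) (mem_ball_zero_iff.2 hwr)
  simp only [sub_zero, Pi.one_apply] at h
  have h2 : Real.circleAverage (fun z => ((‖z‖ ^ 2 - ‖w‖ ^ 2) / ‖z - w‖ ^ 2) • (1 : ℂ)) 0 r =
      Real.circleAverage (fun z => (((1 - r ^ 2 * ‖a‖ ^ 2) *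
        (‖1 - (starRingEnd ℂ) a * z‖ ^ 2)⁻¹ : ℝ) : ℂ)) 0 r := by
    refine Real.circleAverage_congr_sphere fun z hz => ?_
    rw [abs_of_pos hr0, mem_sphere_zero_iff_norm] at hz
    have h3 : r ^ 2 * ‖1 - (starRingEnd ℂ) a * z‖ ^ 2 = ‖z - w‖ ^ 2 := by
      have hz2 : z.re ^ 2 + z.im ^ 2 = r ^ 2 := by
        rw [← hz, ← Complex.normSq_eq_norm_sq, Complex.normSq_apply]
        ring
      rw [hw, ← Complex.normSq_eq_norm_sq, ← Complex.normSq_eq_norm_sq, Complex.normSq_apply,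
        Complex.normSq_apply, ← Complex.ofReal_pow]
      simp only [Complex.sub_re, Complex.sub_im, Complex.mul_re, Complex.mul_im, Complex.one_re,
        Complex.one_im, Complex.conj_re, Complex.conj_im, Complex.ofReal_re, Complex.ofReal_im]
      linear_combination (-1 + r ^ 2 * (a.re ^ 2 + a.im ^ 2)) * hz2
    have hne : ‖1 - (starRingEnd ℂ) a * z‖ ^ 2 ≠ 0 := by
      have := one_sub_conj_mul_ne_zero ha (z := z) (mem_ball_zero_iff.2 (by linarith))
      exact pow_ne_zero _ (norm_ne_zero_iff.2 this)
    simp only [Complex.real_smul, mul_one]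
    rw [← h3, hwn, hz]
    congr 1
    field_simp
  rw [h2] at h
  have h4 : Real.circleAverage (fun z => (((1 - r ^ 2 * ‖a‖ ^ 2) *
        (‖1 - (starRingEnd ℂ) a * z‖ ^ 2)⁻¹ : ℝ) : ℂ)) 0 r =
      ((Real.circleAverage (fun z => (1 - r ^ 2 * ‖a‖ ^ 2) *
        (‖1 - (starRingEnd ℂ) a * z‖ ^ 2)⁻¹) 0 r : ℝ) : ℂ) := by
    simp only [Real.circleAverage, intervalIntegral.integral_ofReal, Complex.real_smul,
      smul_eq_mul]
    push_cast
    rfl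
  rw [h4] at h
  have h5 : Real.circleAverage (fun z => (1 - r ^ 2 * ‖a‖ ^ 2) *
        (‖1 - (starRingEnd ℂ) a * z‖ ^ 2)⁻¹) 0 r = 1 := by exact_mod_cast h
  have h6 : Real.circleAverage (fun z => (1 - r ^ 2 * ‖a‖ ^ 2) *
        (‖1 - (starRingEnd ℂ) a * z‖ ^ 2)⁻¹) 0 r = (1 - r ^ 2 * ‖a‖ ^ 2) *
          Real.circleAverage (fun z => (‖1 - (starRingEnd ℂ) a * z‖ ^ 2)⁻¹) 0 r :=
    Real.circleAverage_fun_smul (a := 1 - r ^ 2 * ‖a‖ ^ 2)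
      (f := fun z => (‖1 - (starRingEnd ℂ) a * z‖ ^ 2)⁻¹)
  exact eq_inv_of_mul_eq_one_right (h6.symm.trans h5)

/-- Two of the powers of `|1 - ā z|⁻¹` are averaged exactly; the remaining ones are bounded by their
maximum on the circle. -/
lemma integralMean_testFunction_le (hq : 0 < q) (hphi : IsNormal phi) {n : ℕ}
    (hn : 2 ≤ (n + 1) * q) {α β a : ℂ} (hα : ‖α‖ ≤ 3) (hβ : ‖β‖ ≤ 3) (ha : a ∈ ball (0 : ℂ) 1)
    {r : ℝ} (hr : r ∈ Ioo (0 : ℝ) 1) :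
    integralMean q (testFunction q phi n α β a) r ≤
      9 / phi ‖a‖ * ((1 - ‖a‖ ^ 2) / (1 - ‖a‖ * r)) ^ (n + 1 - 1 / q : ℝ) := by
  have hD := one_sub_sq_pos ha
  have ha1 := mem_ball_zero_iff.1 ha
  have hphia := hphi.pos ‖a‖ ⟨norm_nonneg _, ha1⟩
  set D := 1 - ‖a‖ ^ 2 with hDdef
  set y := 1 - ‖a‖ * r with hy
  have hy0 : 0 < y := by nlinarith [norm_nonneg a, hr.1, hr.2]
  set κ := (phi ‖a‖ * D ^ (1 / q))⁻¹ with hκ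
  have hκ0 : 0 < κ := by positivity
  have hsphere : ∀ z ∈ sphere (0 : ℂ) r, ‖testFunction q phi n α β a z‖ ^ q ≤
      ((9 * κ) ^ q * D ^ ((n + 1) * q) * y ^ (-((n + 1) * q - 2))) *
        (‖1 - (starRingEnd ℂ) a * z‖ ^ 2)⁻¹ := by
    intro z hz
    rw [mem_sphere_zero_iff_norm] at hz
    have hzb : z ∈ ball (0 : ℂ) 1 := mem_ball_zero_iff.2 (hz ▸ hr.2)
    have h1 : ‖testFunction q phi n α β a z‖ ≤ 9 * κ * ‖diskKernel a z‖ ^ (n + 1) := by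
      rw [testFunction, indicator_of_mem hzb, norm_mul, Complex.norm_real,
        Real.norm_of_nonneg hκ0.le]
      have h2 := norm_diskKernel_le ha hzb
      have h3 : ‖α * diskKernel a z ^ (n + 1) + β * diskKernel a z ^ (n + 2)‖ ≤
          3 * ‖diskKernel a z‖ ^ (n + 1) + 3 * (‖diskKernel a z‖ ^ (n + 1) * 2) := by
        refine (norm_add_le _ _).trans ?_
        rw [norm_mul, norm_mul, norm_pow, norm_pow, pow_succ _ (n + 1)]
        gcongr
      calc _ ≤ κ * (3 * ‖diskKernel a z‖ ^ (n + 1) + 3 * (‖diskKernel a z‖ ^ (n + 1) * 2)) := by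
            gcongr
        _ = _ := by ring
    set X := ‖1 - (starRingEnd ℂ) a * z‖ with hX
    have hyX : y ≤ X := by
      have := le_norm_one_sub_conj_mul a z
      rwa [hz] at this
    have hX0 : 0 < X := hy0.trans_le hyX
    have h4 : ‖diskKernel a z‖ = D / X := by
      rw [diskKernel, norm_div, Complex.norm_real, Real.norm_of_nonneg hD.le]
    have h5 : X ^ (-((n + 1) * q - 2)) ≤ y ^ (-((n + 1) * q - 2)) :=
      Real.rpow_le_rpow_of_nonpos hy0 hyX (by linarith)
    have h6 : ((D / X) ^ (n + 1)) ^ q = D ^ ((n + 1) * q) * X ^ (-((n + 1) * q - 2)) * (X ^ 2)⁻¹ := by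
      rw [← Real.rpow_natCast, ← Real.rpow_mul (by positivity), Real.div_rpow hD.le hX0.le,
        ← Real.rpow_two, ← Real.rpow_neg hX0.le, mul_assoc, ← Real.rpow_add hX0, div_eq_mul_inv,
        ← Real.rpow_neg hX0.le]
      push_cast
      congr 2
      ring
    calc _ ≤ (9 * κ * ‖diskKernel a z‖ ^ (n + 1)) ^ q :=
          Real.rpow_le_rpow (norm_nonneg _) h1 hq.le
      _ = (9 * κ) ^ q * (D ^ ((n + 1) * q) * X ^ (-((n + 1) * q - 2)) * (X ^ 2)⁻¹) := by
          rw [Real.mul_rpow (by positivity) (by positivity), h4, h6]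
      _ ≤ (9 * κ) ^ q * (D ^ ((n + 1) * q) * y ^ (-((n + 1) * q - 2)) * (X ^ 2)⁻¹) := by gcongr
      _ = _ := by ring
  have hcont : ContinuousOn (fun z => (‖1 - (starRingEnd ℂ) a * z‖ ^ 2)⁻¹) (sphere 0 r) := by
    refine ContinuousOn.inv₀ (by fun_prop) fun z hz => ?_
    rw [mem_sphere_zero_iff_norm] at hz
    exact pow_ne_zero _ (norm_ne_zero_iff.2
      (one_sub_conj_mul_ne_zero ha (mem_ball_zero_iff.2 (hz ▸ hr.2))))
  have hav : Real.circleAverage (fun z => ‖testFunction q phi n α β a z‖ ^ q) 0 r ≤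
      ((9 * κ) ^ q * D ^ ((n + 1) * q) * y ^ (-((n + 1) * q - 2))) * y⁻¹ := by
    set c := (9 * κ) ^ q * D ^ ((n + 1) * q) * y ^ (-((n + 1) * q - 2)) with hc
    have hi : CircleIntegrable (fun z => c * (‖1 - (starRingEnd ℂ) a * z‖ ^ 2)⁻¹) 0 r :=
      (continuousOn_const.mul hcont).circleIntegrable hr.1.le
    have h1 := Real.circleAverage_mono
      (circleIntegrable_rpow hq hr (testFunction_mem_discHol n α β ha)) hi (by
        rw [abs_of_pos hr.1]
        exact hsphere)
    refine h1.trans ?_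
    have h4 : Real.circleAverage (fun z => c * (‖1 - (starRingEnd ℂ) a * z‖ ^ 2)⁻¹) 0 r =
        c * Real.circleAverage (fun z => (‖1 - (starRingEnd ℂ) a * z‖ ^ 2)⁻¹) 0 r :=
      Real.circleAverage_fun_smul (a := c) (f := fun z => (‖1 - (starRingEnd ℂ) a * z‖ ^ 2)⁻¹)
    rw [h4, circleAverage_inv_norm_sq ha hr]
    have h2 : y ≤ 1 - r ^ 2 * ‖a‖ ^ 2 := by
      have h3 : 0 ≤ ‖a‖ * r := mul_nonneg (norm_nonneg _) hr.1.le
      rw [hy]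
      nlinarith
    gcongr
  calc integralMean q (testFunction q phi n α β a) r
      ≤ (((9 * κ) ^ q * D ^ ((n + 1) * q) * y ^ (-((n + 1) * q - 2))) * y⁻¹) ^ (1 / q) :=
        Real.rpow_le_rpow (circleAverage_rpow_nonneg _ _ _) hav (by positivity)
    _ = ((9 * κ) ^ q * (D ^ ((n + 1) * q) * y ^ (-((n + 1) * q - 1)))) ^ (1 / q) := by
        congr 1
        rw [← Real.rpow_neg_one y, mul_assoc, ← Real.rpow_add hy0, mul_assoc]
        congr 3
        ring
    _ = 9 * κ * (D ^ (n + 1 : ℝ) * y ^ (-(n + 1 - 1 / q) : ℝ)) := by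
        rw [Real.mul_rpow (x := (9 * κ) ^ q) (by positivity) (by positivity),
          Real.mul_rpow (x := D ^ ((n + 1) * q)) (by positivity) (by positivity),
          ← Real.rpow_mul (by positivity),
          ← Real.rpow_mul hD.le, ← Real.rpow_mul hy0.le, mul_one_div_cancel hq.ne', Real.rpow_one]
        congr 3 <;> field_simp
    _ = _ := by
        rw [hκ, Real.div_rpow hD.le hy0.le, Real.rpow_neg hy0.le, Real.rpow_sub hD]
        field_simp

/-- The test functions are uniformly bounded in `H(p, q, φ)`. The range of integration is split at
`|a|`: on the left `1 - |a| r ≥ 1 - r` and the exponent `b` of `φ` is used, on the right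
`1 - |a| r ≥ 1 - |a|` and the other exponent. -/
lemma exists_mixedNorm_testFunction_le (hp : 0 < p) (hq : 0 < q) (hphi : IsNormal phi) :
    ∃ (n : ℕ) (K : ℝ), 0 < K ∧ ∀ α β a : ℂ, ‖α‖ ≤ 3 → ‖β‖ ≤ 3 → a ∈ ball (0 : ℂ) 1 →
      mixedNorm p q phi (testFunction q phi n α β a) ≤ ENNReal.ofReal K := by
  obtain ⟨e, b, he, hb, hanti, hmono⟩ := hphi.exists_antitone_monotone
  -- A power so large that the integral over `r ≤ |a|` converges against the exponent `b` of `φ`.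
  obtain ⟨n, hn⟩ := exists_nat_gt (b + 1 / q + 2 / q)
  obtain ⟨l, hl⟩ : ∃ l : ℝ, l = n + 1 - 1 / q := ⟨_, rfl⟩
  have hq1 : 0 < 1 / q := by positivity
  have hq2 : 0 < 2 / q := by positivity
  have hlb : 0 < l - b := by linarith
  have hl0 : 0 < l := by linarith
  have hnq : 2 ≤ (n + 1) * q := by
    have : 2 / q ≤ n + 1 := by linarith
    rwa [div_le_iff₀ hq] at this
  set G : ℝ := (9 * 2 ^ l) ^ p with hG
  have hG0 : 0 < G := by positivity
  set I : ℝ := G * (1 / ((l - b) * p)) + G * (1 / (e * p)) with hI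
  have hI0 : 0 < I := by positivity
  refine ⟨n, I ^ (1 / p), by positivity, fun α β a hα hβ ha => ?_⟩
  refine mixedNorm_le_of_lintegral_le hp hI0.le ?_
  have hx1 := mem_ball_zero_iff.1 ha
  have hx0 := norm_nonneg a
  have hphix := hphi.pos ‖a‖ ⟨hx0, hx1⟩
  have hmean : ∀ r ∈ Ioo (0 : ℝ) 1, integralMean q (testFunction q phi n α β a) r ≤
      9 * 2 ^ l * (((1 - ‖a‖) / (1 - ‖a‖ * r)) ^ l / phi ‖a‖) := by
    intro r hr
    have hy0 : 0 < 1 - ‖a‖ * r := by nlinarith [hr.1, hr.2]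
    have hx2 : 0 < 1 - ‖a‖ := by linarith
    have hD := one_sub_sq_pos ha
    refine (integralMean_testFunction_le hq hphi hnq hα hβ ha hr).trans ?_
    rw [← hl]
    have h1 : (1 - ‖a‖ ^ 2) / (1 - ‖a‖ * r) ≤ 2 * ((1 - ‖a‖) / (1 - ‖a‖ * r)) := by
      rw [mul_div_assoc']
      gcongr
      nlinarith
    calc _ ≤ 9 / phi ‖a‖ * (2 * ((1 - ‖a‖) / (1 - ‖a‖ * r))) ^ l := by gcongr
      _ = _ := by
        rw [Real.mul_rpow (by norm_num) (by positivity)]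
        ring
  -- The common bound for the integrand in terms of the ratio `φ(r) / φ(|a|)`.
  have hmain : ∀ r ∈ Ioo (0 : ℝ) 1, ∀ u v : ℝ, 0 < u → u ≤ 1 - ‖a‖ * r →
      phi r ≤ phi ‖a‖ * v → 0 ≤ v →
      integralMean q (testFunction q phi n α β a) r ^ p * (phi r ^ p / (1 - r)) ≤
        G * ((((1 - ‖a‖) / u) ^ l * v) ^ p / (1 - r)) := by
    intro r hr u v hu hu' hv hv0
    have hr1 : 0 < 1 - r := by linarith [hr.2]
    have hx2 : 0 < 1 - ‖a‖ := by linarith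
    have hphir := hphi.pos r ⟨hr.1.le, hr.2⟩
    have hy0 : 0 < 1 - ‖a‖ * r := hu.trans_le hu'
    have h1 := integralMean_nonneg q (testFunction q phi n α β a) r
    calc _ = (integralMean q (testFunction q phi n α β a) r * phi r) ^ p / (1 - r) := by
          rw [Real.mul_rpow h1 hphir.le]
          ring
      _ ≤ ((9 * 2 ^ l * (((1 - ‖a‖) / u) ^ l / phi ‖a‖)) * (phi ‖a‖ * v)) ^ p / (1 - r) := by
          gcongr
          refine (hmean r hr).trans ?_
          gcongr
      _ = ((9 * 2 ^ l) * ((((1 - ‖a‖) / u) ^ l * v))) ^ p / (1 - r) := by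
          congr 2
          field_simp
      _ = _ := by
          rw [Real.mul_rpow (by positivity) (by positivity), hG]
          ring
  have hleft : ∀ r ∈ Ioc (0 : ℝ) ‖a‖,
      ENNReal.ofReal (integralMean q (testFunction q phi n α β a) r ^ p * (phi r ^ p / (1 - r))) ≤
        ENNReal.ofReal (G * (1 - ‖a‖) ^ ((l - b) * p)) *
          ENNReal.ofReal ((1 - r) ^ (-((l - b) * p) - 1)) := by
    intro r hr
    have hr1 : 0 < 1 - r := by linarith [hr.2]
    have hx2 : 0 < 1 - ‖a‖ := by linarith
    rw [← ENNReal.ofReal_mul (by positivity)]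
    refine ENNReal.ofReal_le_ofReal ?_
    refine (hmain r ⟨hr.1, hr.2.trans_lt hx1⟩ (1 - r) (((1 - r) / (1 - ‖a‖)) ^ b) hr1
      (by nlinarith [hr.1]) (le_mul_div_rpow_of_monotoneOn hmono hr.1.le hr.2 hx1)
      (by positivity)).trans_eq ?_
    rw [mul_assoc]
    congr 1
    rw [Real.rpow_sub_one hr1.ne', Real.rpow_neg hr1.le, Real.rpow_mul hx2.le, Real.rpow_mul hr1.le,
      ← Real.inv_rpow (by positivity), mul_div_assoc', ← Real.mul_rpow (by positivity)
        (by positivity), Real.div_rpow hx2.le hr1.le, Real.div_rpow hr1.le hx2.le,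
      Real.rpow_sub hx2 l b, Real.rpow_sub hr1 l b]
    congr 2
    field_simp
  have hright : ∀ r ∈ Ioo ‖a‖ 1,
      ENNReal.ofReal (integralMean q (testFunction q phi n α β a) r ^ p * (phi r ^ p / (1 - r))) ≤
        ENNReal.ofReal (G * ((1 - ‖a‖) ^ (e * p))⁻¹) *
          ENNReal.ofReal ((1 - r) ^ (e * p - 1)) := by
    intro r hr
    have hr1 : 0 < 1 - r := by linarith [hr.2]
    have hx2 : 0 < 1 - ‖a‖ := by linarith
    rw [← ENNReal.ofReal_mul (by positivity)]
    refine ENNReal.ofReal_le_ofReal ?_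
    refine (hmain r ⟨hx0.trans_lt hr.1, hr.2⟩ (1 - ‖a‖) (((1 - r) / (1 - ‖a‖)) ^ e) hx2
      (by nlinarith [hr.2]) (le_mul_div_rpow_of_antitoneOn hanti hx0 hr.1.le hr.2)
      (by positivity)).trans_eq ?_
    rw [div_self hx2.ne', Real.one_rpow, one_mul, Real.rpow_sub_one hr1.ne',
      ← Real.rpow_mul (by positivity), Real.div_rpow hr1.le hx2.le]
    field_simp
  calc _ ≤ ∫⁻ r in Ioc (0 : ℝ) ‖a‖ ∪ Ioo ‖a‖ 1, ENNReal.ofReal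
        (integralMean q (testFunction q phi n α β a) r ^ p * (phi r ^ p / (1 - r))) := by
        refine lintegral_mono_set fun r hr => ?_
        rcases le_or_gt r ‖a‖ with h | h
        · exact Or.inl ⟨hr.1, h⟩
        · exact Or.inr ⟨h, hr.2⟩
    _ ≤ _ := lintegral_union_le _ _ _
    _ ≤ ENNReal.ofReal (G * (1 / ((l - b) * p))) + ENNReal.ofReal (G * (1 / (e * p))) := by
        have hx2 : 0 < 1 - ‖a‖ := by linarith
        refine add_le_add ?_ ?_
        · refine (setLIntegral_mono' measurableSet_Ioc hleft).trans ?_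
          rw [lintegral_const_mul' _ _ ENNReal.ofReal_ne_top]
          refine (mul_le_mul_right (lintegral_one_sub_rpow_neg_le (s := (l - b) * p)
            (by positivity) hx0 hx1) _).trans ?_
          rw [← ENNReal.ofReal_mul (by positivity)]
          refine ENNReal.ofReal_le_ofReal (le_of_eq ?_)
          rw [Real.rpow_neg hx2.le]
          field_simp
        · refine (setLIntegral_mono' measurableSet_Ioo hright).trans ?_
          rw [lintegral_const_mul' _ _ ENNReal.ofReal_ne_top,
            lintegral_one_sub_rpow (by positivity) hx1, ← ENNReal.ofReal_mul (by positivity)]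
          refine ENNReal.ofReal_le_ofReal (le_of_eq ?_)
          field_simp
    _ = _ := by rw [← ENNReal.ofReal_add (by positivity) (by positivity)]

end TestFunction

/-! ### The lower estimate -/

/-- At every point `a` of the disc there are two functions, bounded in `H(p, q, φ)` uniformly in
`a`, of which the first has vanishing first derivative and the second has vanishing second
derivative at `a`, while the other derivative is as large as the growth estimates permit. -/
lemma exists_peak_functions {p q : ℝ} {phi : ℝ → ℝ} (hp : 0 < p) (hq : 0 < q)
    (hphi : IsNormal phi) :
    ∃ K : ℝ, 0 < K ∧ ∀ a ∈ ball (0 : ℂ) 1, ∃ U V : mixedNormSpace hp hq hphi,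
      mixedNorm p q phi U ≤ ENNReal.ofReal K ∧ mixedNorm p q phi V ≤ ENNReal.ofReal K ∧
      deriv (U : ℂ → ℂ) a = 0 ∧
      ‖deriv (deriv (U : ℂ → ℂ)) a‖ = ‖a‖ ^ 2 / (phi ‖a‖ * (1 - ‖a‖ ^ 2) ^ (1 / q + 2)) ∧
      ‖deriv (V : ℂ → ℂ) a‖ = ‖a‖ / (phi ‖a‖ * (1 - ‖a‖ ^ 2) ^ (1 / q + 1)) ∧
      deriv (deriv (V : ℂ → ℂ)) a = 0 ∧
      ∃ M : ℝ, 0 ≤ M ∧ ∀ z ∈ ball (0 : ℂ) 1,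
        (‖deriv (U : ℂ → ℂ) z‖ ≤ M ∧ ‖deriv (deriv (U : ℂ → ℂ)) z‖ ≤ M) ∧
        (‖deriv (V : ℂ → ℂ) z‖ ≤ M ∧ ‖deriv (deriv (V : ℂ → ℂ)) z‖ ≤ M) := by
  obtain ⟨n, K, hK, hmix⟩ := exists_mixedNorm_testFunction_le hp hq hphi
  -- With `δ = 1 - |a|²`, the first two derivatives of `α k^{n+1} + β k^{n+2}` at `a` are the
  -- multiples by `ā / δ` and `ā² / δ²` of `α (n+1) + β (n+2)` and `α (n+1) (n+2) + β (n+2) (n+3)`.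
  -- The coefficients below make one of these numbers `0` and the other one `1`.
  have hn1 : (n : ℂ) + 1 ≠ 0 := by exact_mod_cast n.succ_ne_zero
  have hn2 : (n : ℂ) + 2 ≠ 0 := by exact_mod_cast (n + 1).succ_ne_zero
  have e₁ : ‖(n : ℂ) + 1‖ = n + 1 := by exact_mod_cast Complex.norm_natCast (n + 1)
  have e₂ : ‖(n : ℂ) + 2‖ = n + 2 := by exact_mod_cast Complex.norm_natCast (n + 2)
  have e₃ : ‖(n : ℂ) + 3‖ = n + 3 := by exact_mod_cast Complex.norm_natCast (n + 3)
  have hn0 : (0 : ℝ) ≤ n := n.cast_nonneg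
  have hα : ‖-1 / ((n : ℂ) + 1)‖ ≤ 3 := by
    rw [norm_div, norm_neg, norm_one, e₁, div_le_iff₀ (by positivity)]
    linarith
  have hβ : ‖1 / ((n : ℂ) + 2)‖ ≤ 3 := by
    rw [norm_div, norm_one, e₂, div_le_iff₀ (by positivity)]
    linarith
  have hα' : ‖((n : ℂ) + 3) / ((n : ℂ) + 1)‖ ≤ 3 := by
    rw [norm_div, e₁, e₃, div_le_iff₀ (by positivity)]
    linarith
  have hβ' : ‖(-1 : ℂ)‖ ≤ 3 := by
    rw [norm_neg, norm_one]
    norm_num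
  refine ⟨K, hK, fun a ha => ?_⟩
  have hD := one_sub_sq_pos ha
  have hphia := hphi.pos ‖a‖ ⟨norm_nonneg _, mem_ball_zero_iff.1 ha⟩
  have hU := hmix _ _ a hα hβ ha
  have hV := hmix _ _ a hα' hβ' ha
  obtain ⟨M₁, hM₁, h₁⟩ := exists_deriv_testFunction_le (q := q) (phi := phi) n
    (-1 / ((n : ℂ) + 1)) (1 / ((n : ℂ) + 2)) ha
  obtain ⟨M₂, hM₂, h₂⟩ := exists_deriv_testFunction_le (q := q) (phi := phi) n
    (((n : ℂ) + 3) / ((n : ℂ) + 1)) (-1) ha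
  refine ⟨⟨_, testFunction_mem_discHol n _ _ ha, hU.trans_lt ENNReal.ofReal_lt_top⟩,
    ⟨_, testFunction_mem_discHol n _ _ ha, hV.trans_lt ENNReal.ofReal_lt_top⟩,
    hU, hV, ?_, ?_, ?_, ?_, M₁ + M₂, by positivity, fun z hz => ?_⟩
  · rw [deriv_testFunction n _ _ ha ha, diskKernel_self ha]
    field_simp
    simp
  · rw [deriv_deriv_testFunction n _ _ ha ha, diskKernel_self ha]
    have h : -1 / ((n : ℂ) + 1) * (n + 1) * (n + 2) * 1 ^ (n + 3) +
        1 / ((n : ℂ) + 2) * (n + 2) * (n + 3) * 1 ^ (n + 4) = 1 := by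
      field_simp
      simp
      ring
    rw [h, mul_one, norm_mul, norm_mul, norm_div, RCLike.norm_conj, Complex.norm_real,
      Complex.norm_real, Real.norm_of_nonneg hD.le, Real.norm_of_nonneg (by positivity),
      Real.rpow_add hD, Real.rpow_two]
    field_simp
  · rw [deriv_testFunction n _ _ ha ha, diskKernel_self ha]
    have h : ((n : ℂ) + 3) / ((n : ℂ) + 1) * (n + 1) * 1 ^ (n + 2) +
        -1 * ((n : ℂ) + 2) * 1 ^ (n + 3) = 1 := by
      field_simp
      simp
      ring
    rw [h, mul_one, norm_mul, norm_div, RCLike.norm_conj, Complex.norm_real,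
      Complex.norm_real, Real.norm_of_nonneg hD.le, Real.norm_of_nonneg (by positivity),
      Real.rpow_add hD, Real.rpow_one]
    field_simp
  · rw [deriv_deriv_testFunction n _ _ ha ha, diskKernel_self ha]
    field_simp
    simp
  · obtain ⟨h3, h4⟩ := h₁ z hz
    obtain ⟨h5, h6⟩ := h₂ z hz
    exact ⟨⟨by linarith, by linarith⟩, ⟨by linarith, by linarith⟩⟩

lemma exists_seq_of_lt_limsupToBoundary {vphi : ℂ → ℂ} {F : ℂ → ℝ} {x : ℝ≥0∞}
    (h : x < limsupToBoundary vphi F) :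
    ∃ z : ℕ → ℂ, (∀ k, z k ∈ ball (0 : ℂ) 1 ∧ 1 / 2 < ‖vphi (z k)‖ ∧
      x < ENNReal.ofReal (F (z k))) ∧ Tendsto (fun k => ‖vphi (z k)‖) atTop (𝓝 1) := by
  have h1 := frequently_lt_of_lt_limsup (by isBoundedDefault) h
  have h2 : ∀ᶠ z in comap (fun z => ‖vphi z‖) (𝓝 1) ⊓ 𝓟 (ball 0 1),
      z ∈ ball (0 : ℂ) 1 ∧ 1 / 2 < ‖vphi z‖ := by
    refine Filter.inter_mem (mem_inf_of_right (mem_principal_self _)) (mem_inf_of_left ?_)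
    exact preimage_mem_comap (Ioi_mem_nhds (by norm_num : (1 / 2 : ℝ) < 1))
  obtain ⟨z, hz, hz'⟩ := exists_seq_forall_of_frequently (h1.and_eventually h2)
  have hz₁ := tendsto_comap_iff.1 (tendsto_inf.1 hz).1
  exact ⟨z, fun k => ⟨(hz' k).2.1, (hz' k).2.2, (hz' k).1⟩, hz₁⟩

section Operator

variable {p q : ℝ} {phi : ℝ → ℝ} {hp : 0 < p} {hq : 0 < q} {hphi : IsNormal phi} {μ : ℂ → ℝ}
  {vphi g : ℂ → ℂ} {T : mixedNormSpace hp hq hphi →ₗ[ℂ] zygmundSpace μ}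

lemma zygmundNorm_smul (c : ℂ) (f : ℂ → ℂ) :
    zygmundNorm μ (c • f) = ‖c‖ₑ * zygmundNorm μ f := by
  have h1 : ∀ f : ℂ → ℂ, deriv (c • f) = c • deriv f := fun f => by
    funext w
    exact deriv_const_smul_field c f
  simp only [zygmundNorm, zygmundSup, h1, Pi.smul_apply, enorm_smul, mul_add, ENNReal.mul_iSup,
    mul_left_comm]

lemma zygmundNorm_le_mul_opNorm (R : mixedNormSpace hp hq hphi →ₗ[ℂ] zygmundSpace μ) {K : ℝ}
    (hK : 0 < K) {f : mixedNormSpace hp hq hphi} (hf : mixedNorm p q phi f ≤ ENNReal.ofReal K) :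
    zygmundNorm μ (R f) ≤ ENNReal.ofReal K * opNorm R := by
  have hc : ‖((K⁻¹ : ℝ) : ℂ)‖ = K⁻¹ := by
    rw [Complex.norm_real, Real.norm_of_nonneg (by positivity)]
  have h1 : mixedNorm p q phi (((K⁻¹ : ℝ) : ℂ) • f : mixedNormSpace hp hq hphi) ≤ 1 := by
    rw [Submodule.coe_smul, mixedNorm_smul hp hq, hc]
    refine (mul_le_mul_right hf _).trans ?_
    rw [← ENNReal.ofReal_mul (by positivity), inv_mul_cancel₀ hK.ne', ENNReal.ofReal_one]
  have h2 : zygmundNorm μ (R (((K⁻¹ : ℝ) : ℂ) • f)) ≤ opNorm R :=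
    le_iSup₂ (f := fun (f : mixedNormSpace hp hq hphi) (_ : mixedNorm p q phi f ≤ 1) =>
      zygmundNorm μ (R f)) _ h1
  rw [map_smul, Submodule.coe_smul, zygmundNorm_smul, ← ofReal_norm, hc] at h2
  calc zygmundNorm μ (R f)
      = ENNReal.ofReal K * (ENNReal.ofReal K⁻¹ * zygmundNorm μ (R f)) := by
        rw [← mul_assoc, ← ENNReal.ofReal_mul hK.le, mul_inv_cancel₀ hK.ne', ENNReal.ofReal_one,
          one_mul]
    _ ≤ _ := by gcongr

/-- If `S` is compact and the second derivatives of `T t_k` are large at points `z_k` at which each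
fixed `T t_j` has asymptotically small second derivative, then `T - S` is large: apply it to the
differences `t_k - t_j` along a subsequence on which `S t_k` converges. -/
lemma IsCompactOp.ofReal_le_mul_opNorm_sub {S : mixedNormSpace hp hq hphi →ₗ[ℂ] zygmundSpace μ}
    (hS : IsCompactOp S) {t : ℕ → mixedNormSpace hp hq hphi} {K K₁ L : ℝ} (hK₁ : 0 < K₁)
    (ht : ∀ k, mixedNorm p q phi (t k) ≤ ENNReal.ofReal K)
    (htt : ∀ k j, mixedNorm p q phi (t k - t j : mixedNormSpace hp hq hphi) ≤ ENNReal.ofReal K₁)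
    {z : ℕ → ℂ} (hz : ∀ k, z k ∈ ball (0 : ℂ) 1)
    (hL : ∀ k, ENNReal.ofReal L ≤
      ENNReal.ofReal (μ (‖z k‖ : ℂ)) * ‖deriv (deriv (T (t k) : ℂ → ℂ)) (z k)‖ₑ)
    (hdecay : ∀ j, Tendsto (fun k => ENNReal.ofReal (μ (‖z k‖ : ℂ)) *
      ‖deriv (deriv (T (t j) : ℂ → ℂ)) (z k)‖ₑ) atTop (𝓝 0)) :
    ENNReal.ofReal L ≤ ENNReal.ofReal K₁ * opNorm (T - S) := by
  obtain ⟨h, s, hs, hconv⟩ := hS t ⟨K.toNNReal, ht⟩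
  have key : ∀ k j, ENNReal.ofReal L ≤ ENNReal.ofReal K₁ * opNorm (T - S) +
      (ENNReal.ofReal (μ (‖z (s k)‖ : ℂ)) * ‖deriv (deriv (T (t (s j)) : ℂ → ℂ)) (z (s k))‖ₑ +
        zygmundNorm μ (S (t (s k)) - h : zygmundSpace μ)) +
      zygmundNorm μ (S (t (s j)) - h : zygmundSpace μ) := by
    intro k j
    have hY : ((T - S) (t (s k) - t (s j)) : zygmundSpace μ) =
        (T (t (s k)) - T (t (s j))) - ((S (t (s k)) - h) - (S (t (s j)) - h)) := by
      rw [LinearMap.sub_apply, map_sub, map_sub]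
      abel
    have hd : ∀ x y : zygmundSpace μ, deriv (deriv ((x - y : zygmundSpace μ) : ℂ → ℂ)) (z (s k)) =
        deriv (deriv (x : ℂ → ℂ)) (z (s k)) - deriv (deriv (y : ℂ → ℂ)) (z (s k)) := fun x y =>
      (deriv_sub_apply x.2.1 y.2.1 (hz (s k))).2
    have hdY := congrArg (fun x : zygmundSpace μ => deriv (deriv (x : ℂ → ℂ)) (z (s k))) hY
    rw [hd, hd (T (t (s k))), hd (S (t (s k)) - h)] at hdY
    have h1 := (ofReal_mul_norm_le_zygmundNorm μ
      ((T - S) (t (s k) - t (s j)) : zygmundSpace μ) (hz (s k))).trans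
        (zygmundNorm_le_mul_opNorm (T - S) hK₁ (htt _ _))
    have h2 := ofReal_mul_norm_le_zygmundNorm μ (S (t (s k)) - h : zygmundSpace μ) (hz (s k))
    have h3 := ofReal_mul_norm_le_zygmundNorm μ (S (t (s j)) - h : zygmundSpace μ) (hz (s k))
    have h4 : deriv (deriv (T (t (s k)) : ℂ → ℂ)) (z (s k)) =
        deriv (deriv ((T - S) (t (s k) - t (s j)) : ℂ → ℂ)) (z (s k)) +
        (deriv (deriv (T (t (s j)) : ℂ → ℂ)) (z (s k)) +
          deriv (deriv ((S (t (s k)) - h : zygmundSpace μ) : ℂ → ℂ)) (z (s k))) -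
          deriv (deriv ((S (t (s j)) - h : zygmundSpace μ) : ℂ → ℂ)) (z (s k)) := by
      rw [hdY]
      ring
    refine (hL (s k)).trans ?_
    rw [h4]
    refine (mul_le_mul_right ((enorm_sub_le).trans (add_le_add_left ((enorm_add_le _ _).trans
      (add_le_add_right (enorm_add_le _ _) _)) _)) _).trans ?_
    rw [mul_add, mul_add, mul_add]
    gcongr
  -- The limit is taken first in `k`, for fixed `j`, and then in `j`.
  refine ge_of_tendsto' (x := atTop) (f := fun j => ENNReal.ofReal K₁ * opNorm (T - S) +
    zygmundNorm μ (S (t (s j)) - h : zygmundSpace μ)) ?_ fun j => ?_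
  · simpa using tendsto_const_nhds.add hconv
  · refine ge_of_tendsto' (x := atTop) ?_ fun k => key k j
    have := ((tendsto_const_nhds (x := ENNReal.ofReal K₁ * opNorm (T - S))).add
      (((hdecay (s j)).comp hs.tendsto_atTop).add hconv)).add
      (tendsto_const_nhds (x := zygmundNorm μ (S (t (s j)) - h : zygmundSpace μ)))
    simpa using this

lemma IsNormal.mul_rpow_le_mul (h : IsNormal phi) {x s : ℝ} (hx0 : 0 ≤ x) (hx1 : x < 1)
    (hs : 1 ≤ s) : phi x * (1 - x ^ 2) ^ s ≤ phi 0 * (1 - x ^ 2) := by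
  have h0 : (0 : ℝ) ∈ Ico (0 : ℝ) 1 := ⟨le_rfl, one_pos⟩
  have h1 := h.antitoneOn h0 ⟨hx0, hx1⟩ hx0
  have h2 : 0 < 1 - x ^ 2 := by nlinarith
  have h3 : (1 - x ^ 2) ^ s ≤ 1 - x ^ 2 := by
    simpa using Real.rpow_le_rpow_of_exponent_ge h2 (by nlinarith [sq_nonneg x]) hs
  have := (h.pos 0 h0).le
  gcongr

/-- Testing a bounded `C_φ^g` on the peak functions: `μ |φ' g|` and `μ |g'|` tend to zero
as `|φ(z)| → 1`. -/
lemma IsIntegralOp.exists_decay (hT : IsIntegralOp vphi g T) (hb : IsBoundedOp T) :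
    ∃ M : ℝ, 0 ≤ M ∧ ∀ z ∈ ball (0 : ℂ) 1, 1 / 2 < ‖vphi z‖ →
      μ (‖z‖ : ℂ) * ‖deriv vphi z * g z‖ ≤ M * (1 - ‖vphi z‖ ^ 2) ∧
      μ (‖z‖ : ℂ) * ‖deriv g z‖ ≤ M * (1 - ‖vphi z‖ ^ 2) := by
  obtain ⟨K, hK, hpeak⟩ := exists_peak_functions hp hq hphi
  obtain ⟨Q, hQ⟩ := hb
  have hphi0 := hphi.pos 0 ⟨le_rfl, one_pos⟩
  have hbd : ∀ f : mixedNormSpace hp hq hphi, mixedNorm p q phi f ≤ ENNReal.ofReal K →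
      ∀ z ∈ ball (0 : ℂ) 1, μ (‖z‖ : ℂ) * ‖deriv (deriv (T f : ℂ → ℂ)) z‖ ≤ Q * K := by
    intro f hf z hz
    have h1 := (ofReal_mul_norm_le_zygmundNorm μ (T f) hz).trans
      ((hQ f).trans (mul_le_mul_right hf _))
    rw [← ofReal_norm, ← ENNReal.ofReal_mul (hT.weight.nonneg hz), ← ENNReal.ofReal_coe_nnreal,
      ← ENNReal.ofReal_mul Q.coe_nonneg] at h1
    exact (ENNReal.ofReal_le_ofReal_iff (by positivity)).1 h1
  refine ⟨4 * (Q * K) * phi 0, by positivity, fun z hz hv => ?_⟩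
  have ha := hT.mapsTo hz
  have ha1 := mem_ball_zero_iff.1 ha
  have hD := one_sub_sq_pos ha
  have hphia := hphi.pos ‖vphi z‖ ⟨norm_nonneg _, ha1⟩
  have hμ := hT.weight.nonneg hz
  have hq1 : 0 < 1 / q := by positivity
  obtain ⟨U, V, hU, hV, hU1, hU2, hV1, hV2, -⟩ := hpeak _ ha
  have hTU := hbd U hU z hz
  have hTV := hbd V hV z hz
  rw [hT.deriv_deriv_apply U hz, hU1, zero_mul, add_zero, norm_mul, hU2] at hTU
  rw [hT.deriv_deriv_apply V hz, hV2, zero_mul, zero_add, norm_mul, hV1] at hTV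
  have hw₂ := hphi.mul_rpow_le_mul (norm_nonneg _) ha1 (by linarith : 1 ≤ 1 / q + 2)
  have hw₁ := hphi.mul_rpow_le_mul (norm_nonneg _) ha1 (by linarith : 1 ≤ 1 / q + 1)
  have hQK : 0 ≤ Q * K := by positivity
  constructor
  · have h1 : 0 < phi ‖vphi z‖ * (1 - ‖vphi z‖ ^ 2) ^ (1 / q + 2) := by positivity
    rw [div_mul_eq_mul_div, mul_div_assoc', div_le_iff₀ h1] at hTU
    have h2 := mul_le_mul_of_nonneg_left hw₂ hQK
    have h3 : (1 / 4 : ℝ) ≤ ‖vphi z‖ ^ 2 := by nlinarith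
    have h4 := mul_le_mul_of_nonneg_right h3
      (mul_nonneg hμ (norm_nonneg (deriv vphi z * g z)))
    linarith
  · have h1 : 0 < phi ‖vphi z‖ * (1 - ‖vphi z‖ ^ 2) ^ (1 / q + 1) := by positivity
    rw [div_mul_eq_mul_div, mul_div_assoc', div_le_iff₀ h1] at hTV
    have h2 := mul_le_mul_of_nonneg_left hw₁ hQK
    have h4 := mul_le_mul_of_nonneg_right hv.le (mul_nonneg hμ (norm_nonneg (deriv g z)))
    have h5 : 0 ≤ μ (‖z‖ : ℂ) * ‖deriv g z‖ := by positivity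
    linarith

lemma IsIntegralOp.tendsto_deriv_deriv_apply (hT : IsIntegralOp vphi g T) (hb : IsBoundedOp T)
    {z : ℕ → ℂ} (hz : ∀ k, z k ∈ ball (0 : ℂ) 1) (hv : ∀ k, 1 / 2 < ‖vphi (z k)‖)
    (hlim : Tendsto (fun k => ‖vphi (z k)‖) atTop (𝓝 1)) {f : mixedNormSpace hp hq hphi} {M : ℝ}
    (hf : ∀ z ∈ ball (0 : ℂ) 1, ‖deriv (f : ℂ → ℂ) z‖ ≤ M ∧ ‖deriv (deriv (f : ℂ → ℂ)) z‖ ≤ M) :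
    Tendsto (fun k => ENNReal.ofReal (μ (‖z k‖ : ℂ)) *
      ‖deriv (deriv (T f : ℂ → ℂ)) (z k)‖ₑ) atTop (𝓝 0) := by
  obtain ⟨Q, hQ, hdecay⟩ := hT.exists_decay hb
  have hM : 0 ≤ M := (norm_nonneg _).trans (hf 0 (mem_ball_self one_pos)).1
  have h1 : Tendsto (fun k => ENNReal.ofReal (2 * M * Q * (1 - ‖vphi (z k)‖ ^ 2))) atTop (𝓝 0) := by
    have h2 := ((hlim.pow 2).const_sub 1).const_mul (2 * M * Q)
    have h3 := (ENNReal.continuous_ofReal.tendsto _).comp h2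
    simpa [Function.comp_def] using h3
  refine tendsto_of_tendsto_of_tendsto_of_le_of_le tendsto_const_nhds h1
    (fun _ => zero_le) fun k => ?_
  have hμ := hT.weight.nonneg (hz k)
  simp only
  rw [← ofReal_norm, ← ENNReal.ofReal_mul hμ, hT.deriv_deriv_apply f (hz k)]
  refine ENNReal.ofReal_le_ofReal ?_
  obtain ⟨h4, h5⟩ := hf _ (hT.mapsTo (hz k))
  obtain ⟨h6, h7⟩ := hdecay (z k) (hz k) (hv k)
  calc μ (‖z k‖ : ℂ) * ‖deriv (deriv (f : ℂ → ℂ)) (vphi (z k)) * (deriv vphi (z k) * g (z k)) +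
        deriv (f : ℂ → ℂ) (vphi (z k)) * deriv g (z k)‖
      ≤ μ (‖z k‖ : ℂ) * (M * ‖deriv vphi (z k) * g (z k)‖ + M * ‖deriv g (z k)‖) := by
        gcongr
        refine (norm_add_le _ _).trans ?_
        rw [norm_mul _ (deriv vphi (z k) * g (z k)), norm_mul _ (deriv g (z k))]
        gcongr
    _ = M * (μ (‖z k‖ : ℂ) * ‖deriv vphi (z k) * g (z k)‖) +
        M * (μ (‖z k‖ : ℂ) * ‖deriv g (z k)‖) := by ring
    _ ≤ M * (Q * (1 - ‖vphi (z k)‖ ^ 2)) + M * (Q * (1 - ‖vphi (z k)‖ ^ 2)) := by gcongr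
    _ = _ := by ring

/-- If for every `z` near the boundary some `W` in a fixed ball of `H(p, q, φ)`, with bounded
derivatives, makes `μ(|z|) |(T W)''(z)|` at least `F z / 4`, then the upper limit of `F` is
controlled by the distance from `T` to any compact operator. -/
lemma IsIntegralOp.limsupToBoundary_le_mul_opNorm_sub (hT : IsIntegralOp vphi g T)
    (hb : IsBoundedOp T) {S : mixedNormSpace hp hq hphi →ₗ[ℂ] zygmundSpace μ} (hS : IsCompactOp S)
    {K K₁ : ℝ} (hK₁ : 0 < K₁)
    (hsub : ∀ f h : mixedNormSpace hp hq hphi, mixedNorm p q phi f ≤ ENNReal.ofReal K →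
      mixedNorm p q phi h ≤ ENNReal.ofReal K →
      mixedNorm p q phi (f - h : mixedNormSpace hp hq hphi) ≤ ENNReal.ofReal K₁)
    {F : ℂ → ℝ}
    (hW : ∀ z ∈ ball (0 : ℂ) 1, 1 / 2 < ‖vphi z‖ → ∃ W : mixedNormSpace hp hq hphi,
      mixedNorm p q phi W ≤ ENNReal.ofReal K ∧
      (∃ M : ℝ, ∀ w ∈ ball (0 : ℂ) 1,
        ‖deriv (W : ℂ → ℂ) w‖ ≤ M ∧ ‖deriv (deriv (W : ℂ → ℂ)) w‖ ≤ M) ∧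
      F z ≤ 4 * (μ (‖z‖ : ℂ) * ‖deriv (deriv (T W : ℂ → ℂ)) z‖)) :
    limsupToBoundary vphi F ≤ ENNReal.ofReal (4 * K₁) * opNorm (T - S) := by
  refine le_of_forall_lt fun x hx => ?_
  obtain ⟨y, hxy, hy⟩ := exists_between hx
  refine hxy.trans_le ?_
  obtain ⟨z, hz, hlim⟩ := exists_seq_of_lt_limsupToBoundary hy
  have hytop : y ≠ ∞ := (hy.trans_le le_top).ne
  choose W hWn hWb hWF using fun k => hW (z k) (hz k).1 (hz k).2.1
  choose M hM using hWb
  have h1 := hS.ofReal_le_mul_opNorm_sub (T := T) (L := y.toReal / 4) hK₁ hWn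
    (fun k j => hsub _ _ (hWn k) (hWn j)) (fun k => (hz k).1) (fun k => ?_)
    (fun j => hT.tendsto_deriv_deriv_apply hb (fun k => (hz k).1) (fun k => (hz k).2.1) hlim (hM j))
  · calc y = ENNReal.ofReal 4 * ENNReal.ofReal (y.toReal / 4) := by
          rw [← ENNReal.ofReal_mul (by norm_num), mul_div_cancel₀ _ (by norm_num : (4 : ℝ) ≠ 0),
            ENNReal.ofReal_toReal hytop]
      _ ≤ ENNReal.ofReal 4 * (ENNReal.ofReal K₁ * opNorm (T - S)) := by gcongr
      _ = _ := by rw [← mul_assoc, ← ENNReal.ofReal_mul (by norm_num)]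
  · rw [← ofReal_norm, ← ENNReal.ofReal_mul (hT.weight.nonneg (hz k).1)]
    refine ENNReal.ofReal_le_ofReal ?_
    have h2 := (ENNReal.lt_ofReal_iff_toReal_lt hytop).1 (hz k).2.2
    linarith [hWF k]

end Operator

/-- The lower estimate. -/
lemma exists_limsupToBoundary_le {p q : ℝ} {phi : ℝ → ℝ} (hp : 0 < p) (hq : 0 < q)
    (hphi : IsNormal phi) :
    ∃ C : ℝ, 0 < C ∧ ∀ (μ : ℂ → ℝ) (vphi g : ℂ → ℂ)
      (T S : mixedNormSpace hp hq hphi →ₗ[ℂ] zygmundSpace μ),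
      IsIntegralOp vphi g T → IsBoundedOp T → IsCompactOp S →
      limsupToBoundary vphi (boundaryQuotient μ phi vphi (fun z => deriv vphi z * g z)
        (1 / q + 2)) ≤ ENNReal.ofReal C * opNorm (T - S) ∧
      limsupToBoundary vphi (boundaryQuotient μ phi vphi (deriv g) (1 / q + 1)) ≤
        ENNReal.ofReal C * opNorm (T - S) := by
  obtain ⟨K, hK, hpeak⟩ := exists_peak_functions hp hq hphi
  obtain ⟨K', hK', hsub⟩ := exists_mixedNorm_sub_le hp hq hphi
  refine ⟨4 * (K' * K), by positivity, fun μ vphi g T S hT hb hS => ?_⟩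
  have hsub' : ∀ f h : mixedNormSpace hp hq hphi, mixedNorm p q phi f ≤ ENNReal.ofReal K →
      mixedNorm p q phi h ≤ ENNReal.ofReal K →
      mixedNorm p q phi (f - h : mixedNormSpace hp hq hphi) ≤ ENNReal.ofReal (K' * K) :=
    fun f h hf hh => hsub f f.2.1 h h.2.1 K hK.le hf hh
  constructor
  · refine hT.limsupToBoundary_le_mul_opNorm_sub hb hS (by positivity) hsub' fun z hz hv => ?_
    have ha := hT.mapsTo hz
    obtain ⟨U, _, hU, -, hU1, hU2, -, -, M, -, hM⟩ := hpeak _ ha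
    refine ⟨U, hU, ⟨M, fun w hw => (hM w hw).1⟩, ?_⟩
    have hD := one_sub_sq_pos ha
    have hphia := hphi.pos ‖vphi z‖ ⟨norm_nonneg _, mem_ball_zero_iff.1 ha⟩
    have hμ := hT.weight.nonneg hz
    have hE : 0 ≤ boundaryQuotient μ phi vphi (fun z => deriv vphi z * g z) (1 / q + 2) z := by
      unfold boundaryQuotient
      positivity
    have h1 : μ (‖z‖ : ℂ) * ‖deriv (deriv (T U : ℂ → ℂ)) z‖ = ‖vphi z‖ ^ 2 *
        boundaryQuotient μ phi vphi (fun z => deriv vphi z * g z) (1 / q + 2) z := by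
      rw [hT.deriv_deriv_apply U hz, hU1, zero_mul, add_zero, norm_mul, hU2, boundaryQuotient]
      ring
    have h2 : (1 / 4 : ℝ) ≤ ‖vphi z‖ ^ 2 := by nlinarith
    rw [h1]
    linarith [mul_le_mul_of_nonneg_right h2 hE]
  · refine hT.limsupToBoundary_le_mul_opNorm_sub hb hS (by positivity) hsub' fun z hz hv => ?_
    have ha := hT.mapsTo hz
    obtain ⟨_, V, -, hV, -, -, hV1, hV2, M, -, hM⟩ := hpeak _ ha
    refine ⟨V, hV, ⟨M, fun w hw => (hM w hw).2⟩, ?_⟩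
    have hD := one_sub_sq_pos ha
    have hphia := hphi.pos ‖vphi z‖ ⟨norm_nonneg _, mem_ball_zero_iff.1 ha⟩
    have hμ := hT.weight.nonneg hz
    have hE : 0 ≤ boundaryQuotient μ phi vphi (deriv g) (1 / q + 1) z := by
      unfold boundaryQuotient
      positivity
    have h1 : μ (‖z‖ : ℂ) * ‖deriv (deriv (T V : ℂ → ℂ)) z‖ = ‖vphi z‖ *
        boundaryQuotient μ phi vphi (deriv g) (1 / q + 1) z := by
      rw [hT.deriv_deriv_apply V hz, hV2, zero_mul, zero_add, norm_mul, hV1, boundaryQuotient]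
      ring
    rw [h1]
    linarith [mul_le_mul_of_nonneg_right hv.le hE]

end MixedZygmund

end

theorem corollary2p5 (p q : ℝ) (hp : 0 < p) (hq : 0 < q) (phi : ℝ → ℝ)
    (hphi : MixedZygmund.IsNormal phi) :
    ∃ c C : ℝ≥0, 0 < c ∧ 0 < C ∧
      ∀ (μ : ℂ → ℝ) (_ : MixedZygmund.IsWeight μ)
        (vphi g : ℂ → ℂ) (_ : DifferentiableOn ℂ vphi (ball 0 1))
        (_ : MapsTo vphi (ball 0 1) (ball 0 1)) (_ : DifferentiableOn ℂ g (ball 0 1))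
        (T : MixedZygmund.mixedNormSpace hp hq hphi →ₗ[ℂ] MixedZygmund.zygmundSpace μ)
        (_ : ∀ f : MixedZygmund.mixedNormSpace hp hq hphi, ∀ z ∈ ball (0 : ℂ) 1,
          (T f : ℂ → ℂ) z = MixedZygmund.integralOp vphi g f z)
        (_ : MixedZygmund.IsBoundedOp T) (A B : ℝ≥0∞)
        (_ : A = MixedZygmund.limsupToBoundary vphi fun z =>
          μ (‖z‖ : ℂ) * ‖deriv vphi z * g z‖ /
            (phi ‖vphi z‖ * (1 - ‖vphi z‖ ^ 2) ^ (1 / q + 2)))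
        (_ : B = MixedZygmund.limsupToBoundary vphi fun z =>
          μ (‖z‖ : ℂ) * ‖deriv g z‖ /
            (phi ‖vphi z‖ * (1 - ‖vphi z‖ ^ 2) ^ (1 / q + 1))),
        c * max A B ≤ MixedZygmund.essNorm T ∧
        MixedZygmund.essNorm T ≤ C * max A B ∧
        (MixedZygmund.IsCompactOp T ↔ A = 0 ∧ B = 0) := by
  obtain ⟨C₁, hC₁, hupper⟩ := MixedZygmund.exists_essNorm_le hp hq hphi
  obtain ⟨C₂, hC₂, hlower⟩ := MixedZygmund.exists_limsupToBoundary_le hp hq hphi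
  refine ⟨(C₂.toNNReal)⁻¹, (2 * C₁).toNNReal, by positivity, by positivity, ?_⟩
  intro μ hμ vphi g hv hm hg T hT hb A B hA hB
  have hTi : MixedZygmund.IsIntegralOp vphi g T := ⟨hμ, hv, hm, hg, hT⟩
  have hmax : ∀ S : MixedZygmund.mixedNormSpace hp hq hphi →ₗ[ℂ] MixedZygmund.zygmundSpace μ,
      MixedZygmund.IsCompactOp S →
      max A B ≤ ENNReal.ofReal C₂ * MixedZygmund.opNorm (T - S) := fun S hS => by
    obtain ⟨h1, h2⟩ := hlower μ vphi g T S hTi hb hS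
    exact max_le (hA.trans_le h1) (hB.trans_le h2)
  have hC₂' : ENNReal.ofReal C₂ ≠ 0 := (ENNReal.ofReal_pos.2 hC₂).ne'
  refine ⟨le_iInf₂ fun S hS => ?_, ?_, fun hc => ?_, fun h => ?_⟩
  · rw [ENNReal.coe_inv (by simpa using hC₂)]
    exact (ENNReal.inv_mul_le_iff hC₂' ENNReal.ofReal_ne_top).2 (hmax S hS)
  -- The upper estimate has content only if both upper limits are finite.
  · rcases eq_or_ne (max A B) ∞ with htop | htop
    · rw [htop, ENNReal.mul_top]
      · exact le_top
      · simpa using hC₁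
    · have hAm : A ≤ ENNReal.ofReal (max A B).toReal :=
        (le_max_left A B).trans_eq (ENNReal.ofReal_toReal htop).symm
      have hBm : B ≤ ENNReal.ofReal (max A B).toReal :=
        (le_max_right A B).trans_eq (ENNReal.ofReal_toReal htop).symm
      refine (hupper μ vphi g T hTi hb _ _ ENNReal.toReal_nonneg ENNReal.toReal_nonneg
        (hA.symm.trans_le hAm) (hB.symm.trans_le hBm)).trans_eq ?_
      rw [← two_mul, ← mul_assoc, mul_comm C₁, ENNReal.ofReal_mul (by positivity),
        ENNReal.ofReal_toReal htop]
      rfl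
  -- A compact `T` is itself an admissible `S` in the lower estimate.
  · have h0 : MixedZygmund.opNorm (T - T) = 0 := by
      have hd : deriv (0 : ℂ → ℂ) = 0 := by
        funext z
        simp [Pi.zero_def]
      simp [MixedZygmund.opNorm, MixedZygmund.zygmundNorm, MixedZygmund.zygmundSup, hd]
    have h1 := hmax T hc
    rw [h0, mul_zero] at h1
    exact ⟨le_bot_iff.1 ((le_max_left _ _).trans h1), le_bot_iff.1 ((le_max_right _ _).trans h1)⟩
  · exact hTi.isCompactOp_of_limsup_eq_zero hb (hA.symm.trans h.1) (hB.symm.trans h.2)
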